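/- All spaces $X_p$ below are compactly generated and have the homotopy type of a CW complex; $I=[0,1]$. **The cube category $\square$.** Its objects are the natural numbers. A morphism $p\to r$ is a pair $f_i^{\epsilon}$ of a subset $i\subseteq\{1,\dots,p\}$ with $p-r$ elements and a sign function $\epsilon:i\to\{-1,1\}$ (so there is none if $p<r$, and only the identity if $p=r$). The composite of $f_i^{\epsilon}:p\to q$ with $f_j^{\epsilon'}:q\to r$ is $f_{j\vee i}^{\epsilon''}:p\to r$, where $j\vee i=i\cup\kappa(j)$, $\kappa:\{1,\dots,q\}\to\{1,\dots,p\}\setminus i$ is the increasing bijection, $\epsilon''=\epsilon$ on $i$ and $\epsilon''=\epsilon'\circ\kappa^{-1}$ on $\kappa(j)$. Let $\square_p$ be the full subcategory on $0,\dots,p$. **Homotopy diagrams.** For a small category $\mathcal C$, let $\mathcal C_n(A,B)$ be the (discrete) set of chains $(f_n,\dots,f_1)$ of $n$ composable morphisms with $f_n\circ\dots\circ f_1:A\to B$ (for $n=0$: one element if $A=B$, none otherwise). An $h\mathcal C$-diagram $D$ consists of spaces $D_0A$ $(A\in\mathcal C)$ and continuous maps $D:\mathcal C_{n+1}(A,B)\times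 I^n\times D_0A\to D_0B$ $(n\ge 0)$ with $D(\mathrm{id};x)=x$ and, for $n>0$, $$D(f_n,t_n,\dots,t_1,f_0;x)=\begin{cases}D(f_n,t_n,\dots,f_1;x)& f_0=\mathrm{id},\\ D(f_n,t_n,\dots,f_{i+1},t_{i+1}t_i,f_{i-1},\dots,f_0;x)& f_i=\mathrm{id},\ 0<i<n,\\ D(f_{n-1},t_{n-1},\dots,f_0;x)& f_n=\mathrm{id},\\ D(f_n,t_n,\dots,t_{i+1},f_i\circ f_{i-1},t_{i-1},\dots,f_0;x)& t_i=1,\\ D(f_n,t_n,\dots,f_i;D(f_{i-1},t_{i-1},\dots,f_0;x))& t_i=0.\end{cases}$$ Its homotopy colimit is the quotient space of $\bigsqcup_{A,B}\bigsqcup_{n\ge0}\mathcal C_n(A,B)\times I^n\times D_0A$, whose points are written $(t_n,f_n,\dots,t_1,f_1;x)$, by the equivalence relation generated by $$(t_n,f_n,\dots,t_1,f_1;x)\sim\begin{cases}(t_n,f_n,\dots,t_2,f_2;x)& f_1=\mathrm{id},\\ (t_n,f_n,\dots,f_{i+1},t_it_{i-1},f_{i-1},\dots,f_1;x)& f_i=\mathrm{id},\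 1<i,\\ (t_n,f_n,\dots,t_{i+1},f_{i+1}\circ f_i,t_{i-1},\dots,f_1;x)& t_i=1,\ i<n,\\ (t_{n-1},f_{n-1},\dots,f_1;x)& t_n=1,\\ (t_n,f_n,\dots,t_{i+1},f_{i+1};D(f_i,t_{i-1},\dots,f_1;x))& t_i=0.\end{cases}$$ A *homotopical cubical space* ($h\square$-space) $X_\bullet$ is an $h\square$-diagram; $X_p$ is its value at $p$. The geometrical realization $|X_\bullet|$ is its homotopy colimit, and $X_{\le p}$ is the restriction of $X_\bullet$ to $\square_p$; $|X_{\le p}|$ is the homotopy colimit of the latter. **Zero-skeleta.** A $0$-skeleton of $X_2$ is the $0$-skeleton $X_2^{(0)}=K^{(0)}$ of a Hausdorff CW complex $K$ given with a homotopy equivalence $K\to X_2$; it comes with the map $\varphi:K^{(0)}\subseteq K\to X_2$. The square space $Y_\bullet: X_2^{(0)}\rightrightarrows X_1\rightrightarrows X_0$ is the $h\square_2$-space with $Y_2=X_2^{(0)}$, $Y_1=X_1$, $Y_0=X_0$ whose structure maps are those of $X_{\le2}$, precomposed with $\varphi$ where the source is $2$ and the target is $1$ or $0$, and equal to the identity of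 $X_2^{(0)}$ where source and target are both $2$. **Proposition.** Let $X_\bullet$ be an $h\square$-space and let $X_2^{(0)}$ be any $0$-skeleton of $X_2$. Then the three spaces $|Y_\bullet|$, $|X_{\le2}|$ and $|X_\bullet|$ have the same fundamental group. Precisely, each of the two canonical maps $$|Y_\bullet|\longrightarrow|X_{\le 2}|\longrightarrow|X_\bullet|$$ induces a bijection on the sets of path components and, for every base point of its source, an isomorphism of fundamental groups. -/

import Mathlib

open CategoryTheory Topology

universe w v u

/-! ### Chains of composable morphisms with parameters -/

/-- A word `(t_n, f_n, …, t_1, f_1)` where `f_n ∘ ⋯ ∘ f_1 : A ⟶ B` is a chain of `n ≥ 0` composable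
morphisms and `t_i ∈ [0,1]`; `cons t f w` is the word `(t, f, w)`.  The empty word
exists only for `A = B`. -/
inductive TimedChain {C : Type w} [Category.{v} C] (A : C) : C → Type (max w v)
  | nil : TimedChain A A
  | cons {B B' : C} (t : unitInterval) (f : B ⟶ B') (c : TimedChain A B) : TimedChain A B'

namespace TimedChain

variable {C : Type w} [Category.{v} C]

/-- Concatenation of words: `u` is written to the left of `c`. -/
def append {A B : C} (c : TimedChain A B) : {B' : C} → TimedChain B B' → TimedChain A B'
  | _, nil => c
  | _, cons t f u => cons t f (append c u)

/-- The word with morphisms `p = (f_1, …, f_n)` and parameters `t_{i+1} = τ i`. -/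
def ofTimes {A : C} : {B : C} → (p : Quiver.Path A B) → (Fin p.length → unitInterval) → TimedChain A B
  | _, .nil, _ => nil
  | _, .cons p f, τ => cons (τ (Fin.last p.length)) f (ofTimes p fun i => τ i.castSucc)

/-- The set of words from `A` to `B` is topologized as the disjoint union, over `n ≥ 0` and over
the chains of `n` composable morphisms from `A` to `B`, of the cubes `[0,1]^n`. -/
instance {A B : C} : TopologicalSpace (TimedChain A B) :=
  TopologicalSpace.coinduced
    (fun s : (Σ p : Quiver.Path A B, (Fin p.length → unitInterval)) => ofTimes s.1 s.2) inferInstance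

/-- A functor acts on words, keeping the parameters. -/
def map {C' : Type*} [Category C'] (F : C' ⥤ C) {A : C'} :
    {B : C'} → TimedChain A B → TimedChain (F.obj A) (F.obj B)
  | _, nil => nil
  | _, cons t f c => cons t (F.map f) (map F c)

theorem map_append {C' : Type*} [Category C'] (F : C' ⥤ C) {A B : C'} (c : TimedChain A B)
    {B' : C'} (u : TimedChain B B') : map F (append c u) = append (map F c) (map F u) := by
  induction u with
  | nil => rfl
  | cons t f u ih => simp only [append, map, ih]

theorem map_ofTimes {C' : Type*} [Category C'] (F : C' ⥤ C) {A B : C'} (p : Quiver.Path A B) :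
    ∃ h : (F.toPrefunctor.mapPath p).length = p.length, ∀ τ : Fin p.length → unitInterval,
      map F (ofTimes p τ) = ofTimes (F.toPrefunctor.mapPath p) (fun i => τ (Fin.cast h i)) := by
  induction p with
  | nil => exact ⟨rfl, fun _ => rfl⟩
  | cons p f ih =>
    obtain ⟨h, ih⟩ := ih
    refine ⟨congrArg (· + 1) h, fun τ => ?_⟩
    change TimedChain.cons _ _ _ = TimedChain.cons _ _ _
    rw [ih]
    congr 2
    exact Fin.ext h.symm

theorem continuous_map {C' : Type*} [Category C'] (F : C' ⥤ C) (A B : C') :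
    Continuous (map F : TimedChain A B → TimedChain (F.obj A) (F.obj B)) := by
  refine continuous_coinduced_dom.2 (continuous_sigma fun p => ?_)
  obtain ⟨h, e⟩ := map_ofTimes F p
  have h1 : Continuous fun τ : Fin p.length → unitInterval =>
      (⟨F.toPrefunctor.mapPath p, fun i => τ (Fin.cast h i)⟩ :
        Σ p : Quiver.Path (F.obj A) (F.obj B), (Fin p.length → unitInterval)) := by
    refine continuous_sigmaMk.comp (continuous_pi fun i => continuous_apply _)
  exact (continuous_coinduced_rng.comp h1).congr fun τ => (e τ).symm

end TimedChain

/-! ### Homotopy diagrams and their homotopy colimits -/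

/-- A homotopy `C`-diagram (`hC`-diagram) of spaces.
The element `D(f_n, t_n, f_{n-1}, …, t_1, f_0; x)` is `act f_n (t_n, f_{n-1}, …, t_1, f_0) x`. -/
structure HDiagram (C : Type w) [Category.{v} C] where
  /-- the spaces of the diagram -/
  obj : C → Type u
  [top : ∀ A, TopologicalSpace (obj A)]
  /-- the structure maps -/
  act : ∀ {A B B' : C}, (B ⟶ B') → TimedChain A B → obj A → obj B'
  continuous_act : ∀ {A B B' : C} (f : B ⟶ B'),
    Continuous fun z : TimedChain A B × obj A => act f z.1 z.2
  /-- `D(id; x) = x` -/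
  act_id : ∀ {B : C} (x : obj B), act (𝟙 B) .nil x = x
  /-- the case `f_0 = id` -/
  act_first_id : ∀ {A B B' : C} (f : B ⟶ B') (u : TimedChain A B) (t : unitInterval) (x : obj A),
    act f ((TimedChain.cons t (𝟙 A) .nil).append u) x = act f u x
  /-- the case `f_i = id`, `0 < i < n` -/
  act_middle_id : ∀ {A B B' E E' : C} (f : B ⟶ B') (u : TimedChain E' B) (t s : unitInterval) (g : E ⟶ E')
    (c : TimedChain A E) (x : obj A),
    act f ((TimedChain.cons t (𝟙 E') (.cons s g c)).append u) x =
      act f ((TimedChain.cons (t * s) g c).append u) x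
  /-- the case `f_n = id` -/
  act_last_id : ∀ {A B E : C} (t : unitInterval) (g : E ⟶ B) (c : TimedChain A E) (x : obj A),
    act (𝟙 B) (.cons t g c) x = act g c x
  /-- the case `t_i = 1`, `i < n` -/
  act_one : ∀ {A B B' E E' E'' : C} (f : B ⟶ B') (u : TimedChain E'' B) (t : unitInterval) (h : E' ⟶ E'')
    (g : E ⟶ E') (c : TimedChain A E) (x : obj A),
    act f ((TimedChain.cons t h (.cons 1 g c)).append u) x =
      act f ((TimedChain.cons t (g ≫ h) c).append u) x
  /-- the case `t_n = 1` -/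
  act_last_one : ∀ {A B B' E : C} (f : B ⟶ B') (g : E ⟶ B) (c : TimedChain A E) (x : obj A),
    act f (.cons 1 g c) x = act (g ≫ f) c x
  /-- the case `t_i = 0` -/
  act_zero : ∀ {A B B' E E' : C} (f : B ⟶ B') (u : TimedChain E' B) (g : E ⟶ E')
    (c : TimedChain A E) (x : obj A),
    act f ((TimedChain.cons 0 g c).append u) x = act f u (act g c x)

namespace HDiagram

variable {C : Type w} [Category.{v} C]

instance (D : HDiagram.{w, v, u} C) (A : C) : TopologicalSpace (D.obj A) := D.top A

/-- The space `⨆_{A,B} ⨆_n C_n(A,B) × [0,1]^n × D_0 A` of all `(t_n, f_n, …, t_1, f_1; x)`. -/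
abbrev PreHocolim (D : HDiagram.{w, v, u} C) : Type (max w v u) :=
  Σ A : C, Σ B : C, TimedChain A B × D.obj A

/-- The element `(c; x)` of `PreHocolim`. -/
abbrev pt (D : HDiagram.{w, v, u} C) {A B : C} (c : TimedChain A B) (x : D.obj A) :
    D.PreHocolim := ⟨A, B, c, x⟩

theorem continuous_pt (D : HDiagram.{w, v, u} C) (A B : C) :
    Continuous fun z : TimedChain A B × D.obj A => D.pt z.1 z.2 :=
  (continuous_sigmaMk (σ := fun A : C => Σ B : C, TimedChain A B × D.obj A)).comp
    (continuous_sigmaMk (σ := fun B : C => TimedChain A B × D.obj A))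

/-- The generating identifications of the homotopy colimit. -/
inductive Rel (D : HDiagram.{w, v, u} C) : D.PreHocolim → D.PreHocolim → Prop
  /-- the case `f_1 = id` -/
  | first_id {A B : C} (u : TimedChain A B) (t : unitInterval) (x : D.obj A) :
      Rel D (D.pt ((TimedChain.cons t (𝟙 A) .nil).append u) x) (D.pt u x)
  /-- the case `f_i = id`, `1 < i` -/
  | middle_id {A B E E' : C} (u : TimedChain E' B) (t s : unitInterval) (g : E ⟶ E')
      (c : TimedChain A E) (x : D.obj A) :
      Rel D (D.pt ((TimedChain.cons t (𝟙 E') (.cons s g c)).append u) x)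
        (D.pt ((TimedChain.cons (t * s) g c).append u) x)
  /-- the case `t_i = 1`, `i < n` -/
  | one {A B E E' E'' : C} (u : TimedChain E'' B) (t : unitInterval) (h : E' ⟶ E'') (g : E ⟶ E')
      (c : TimedChain A E) (x : D.obj A) :
      Rel D (D.pt ((TimedChain.cons t h (.cons 1 g c)).append u) x)
        (D.pt ((TimedChain.cons t (g ≫ h) c).append u) x)
  /-- the case `t_n = 1` -/
  | last_one {A B E : C} (g : E ⟶ B) (c : TimedChain A E) (x : D.obj A) :
      Rel D (D.pt (TimedChain.cons 1 g c) x) (D.pt c x)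
  /-- the case `t_i = 0` -/
  | zero {A B E E' : C} (u : TimedChain E' B) (g : E ⟶ E') (c : TimedChain A E) (x : D.obj A) :
      Rel D (D.pt ((TimedChain.cons 0 g c).append u) x) (D.pt u (D.act g c x))

/-- The homotopy colimit, with the quotient topology. -/
abbrev Hocolim (D : HDiagram.{w, v, u} C) : Type (max w v u) := Quot D.Rel

/-- The restriction of a homotopy diagram along a functor. -/
def restrict {C' : Type*} [Category C'] (D : HDiagram.{w, v, u} C) (F : C' ⥤ C) :
    HDiagram C' where
  obj A := D.obj (F.obj A)
  act f c x := D.act (F.map f) (c.map F) x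
  continuous_act f := (D.continuous_act (F.map f)).comp
    (((TimedChain.continuous_map F _ _).comp continuous_fst).prodMk continuous_snd)
  act_id x := by simpa [TimedChain.map] using D.act_id x
  act_first_id f u t x := by
    simpa [TimedChain.map, TimedChain.map_append] using D.act_first_id (F.map f) (u.map F) t x
  act_middle_id f u t s g c x := by
    simpa [TimedChain.map, TimedChain.map_append] using
      D.act_middle_id (F.map f) (u.map F) t s (F.map g) (c.map F) x
  act_last_id t g c x := by
    simpa [TimedChain.map] using D.act_last_id t (F.map g) (c.map F) x
  act_one f u t h g c x := by
    simpa [TimedChain.map, TimedChain.map_append] using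
      D.act_one (F.map f) (u.map F) t (F.map h) (F.map g) (c.map F) x
  act_last_one f g c x := by
    simpa [TimedChain.map] using D.act_last_one (F.map f) (F.map g) (c.map F) x
  act_zero f u g c x := by
    simpa [TimedChain.map, TimedChain.map_append] using
      D.act_zero (F.map f) (u.map F) (F.map g) (c.map F) x

/-- The canonical map from the homotopy colimit of a restriction,
`[t_n, f_n, …, t_1, f_1; x] ↦ [t_n, F f_n, …, t_1, F f_1; x]`. -/
def hocolimRestrict {C' : Type*} [Category C'] (D : HDiagram.{w, v, u} C) (F : C' ⥤ C) :
    C((D.restrict F).Hocolim, D.Hocolim) where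
  toFun := Quot.lift (fun z => Quot.mk _ (D.pt (z.2.2.1.map F) z.2.2.2)) (by
    intro a b h
    apply Quot.sound
    cases h with
    | first_id u t x =>
      simpa [TimedChain.map, TimedChain.map_append] using Rel.first_id (D := D) (u.map F) t x
    | middle_id u t s g c x =>
      simpa [TimedChain.map, TimedChain.map_append] using
        Rel.middle_id (D := D) (u.map F) t s (F.map g) (c.map F) x
    | one u t h g c x =>
      simpa [TimedChain.map, TimedChain.map_append] using
        Rel.one (D := D) (u.map F) t (F.map h) (F.map g) (c.map F) x
    | last_one g c x => exact Rel.last_one (D := D) (F.map g) (c.map F) x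
    | zero u g c x =>
      simpa [TimedChain.map, TimedChain.map_append, restrict] using
        Rel.zero (D := D) (u.map F) (F.map g) (c.map F) x)
  continuous_toFun := by
    refine continuous_quot_lift _ (continuous_quot_mk.comp ?_)
    refine continuous_sigma fun A => continuous_sigma fun B => ?_
    exact (D.continuous_pt (F.obj A) (F.obj B)).comp
      (((TimedChain.continuous_map F _ _).comp continuous_fst).prodMk continuous_snd)

/-- A strict morphism of homotopy diagrams: continuous maps commuting with the structure maps. -/
structure Hom (D D' : HDiagram.{w, v, u} C) where
  /-- the maps of spaces -/
  app : ∀ A, C(D.obj A, D'.obj A)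
  app_act : ∀ {A B B' : C} (f : B ⟶ B') (c : TimedChain A B) (x : D.obj A),
    app B' (D.act f c x) = D'.act f c (app A x)

/-- The map of homotopy colimits induced by a strict morphism. -/
def Hom.hocolimMap {D D' : HDiagram.{w, v, u} C} (φ : Hom D D') : C(D.Hocolim, D'.Hocolim) where
  toFun := Quot.lift (fun z => Quot.mk _ (D'.pt z.2.2.1 (φ.app _ z.2.2.2))) (by
    intro a b h
    apply Quot.sound
    cases h with
    | first_id u t x => exact Rel.first_id u t _
    | middle_id u t s g c x => exact Rel.middle_id u t s g c _
    | one u t h g c x => exact Rel.one u t h g c _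
    | last_one g c x => exact Rel.last_one g c _
    | zero u g c x =>
      have := Rel.zero (D := D') u g c (φ.app _ x)
      rwa [← φ.app_act] at this)
  continuous_toFun := by
    refine continuous_quot_lift _ (continuous_quot_mk.comp ?_)
    refine continuous_sigma fun A => continuous_sigma fun B => ?_
    exact (D'.continuous_pt A B).comp
      (continuous_fst.prodMk ((φ.app A).continuous.comp continuous_snd))

end HDiagram

/-! ### The cube category -/

/-- An object of the cube category: a natural number. -/
structure Cube : Type where
  /-- the natural number -/
  dim : ℕ

/-- A morphism `f_i^ε : p ⟶ r` of the cube category, given by a set `i ⊆ {1, …, p}` of cardinality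
`p - r` and a family of signs `ε ∈ {-1,1}^i`.  The field `emb` is the increasing enumeration of the
complement of `i`, and `sgn` is `ε`, extended by `0` on the complement of `i`.  If `p = r` the
identity is the only morphism, and if `p < r` there is none. -/
@[ext]
structure Cube.Hom (p r : Cube) : Type where
  /-- the increasing enumeration of the complement of `i` -/
  emb : Fin r.dim ↪o Fin p.dim
  /-- the signs -/
  sgn : Fin p.dim → SignType
  sgn_eq_zero_iff : ∀ k, sgn k = 0 ↔ k ∈ Set.range emb

/-- The composite `f_j^{ε'} ∘ f_i^ε = f_{j ∨ i}^{ε''}`: the complement of `j ∨ i` consists of those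
elements of the complement of `i` whose rank is not in `j`; the signs of `ε''` are those of `ε` on
`i`, and those of `ε'`, transported to the complement of `i`, elsewhere. -/
noncomputable instance : Category.{0} Cube where
  Hom := Cube.Hom
  id p := ⟨RelEmbedding.refl _, fun _ => 0, fun k => by simp⟩
  comp {p q r} f g :=
    { emb := g.emb.trans f.emb
      sgn := Function.extend f.emb g.sgn f.sgn
      sgn_eq_zero_iff := fun k => by
        by_cases hk : ∃ a, f.emb a = k
        · obtain ⟨a, rfl⟩ := hk
          rw [f.emb.injective.extend_apply, g.sgn_eq_zero_iff]
          simp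
        · rw [Function.extend_apply' _ _ _ hk, f.sgn_eq_zero_iff]
          simp only [Set.mem_range, hk, false_iff]
          rintro ⟨b, hb⟩
          exact hk ⟨_, hb⟩ }
  id_comp {p q} f := by
    refine Cube.Hom.ext (by ext; rfl) ?_
    funext k
    exact Function.Injective.extend_apply (f := (RelEmbedding.refl _ : Fin p.dim ↪o Fin p.dim))
      (RelEmbedding.injective _) _ _ k
  comp_id {p q} f := by
    refine Cube.Hom.ext (by ext; rfl) ?_
    funext k
    by_cases hk : ∃ a, f.emb a = k
    · obtain ⟨a, rfl⟩ := hk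
      exact (f.emb.injective.extend_apply _ _ a).trans
        ((f.sgn_eq_zero_iff _).2 ⟨a, rfl⟩).symm
    · exact Function.extend_apply' _ _ _ hk
  assoc {p q r s} f g h := by
    refine Cube.Hom.ext (by ext; rfl) ?_
    funext k
    symm
    change Function.extend f.emb (Function.extend g.emb h.sgn g.sgn) f.sgn k =
      Function.extend (fun a => f.emb (g.emb a)) h.sgn (Function.extend f.emb g.sgn f.sgn) k
    by_cases hk : ∃ a, f.emb a = k
    · obtain ⟨a, rfl⟩ := hk
      rw [f.emb.injective.extend_apply]
      by_cases ha : ∃ b, g.emb b = a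
      · obtain ⟨b, rfl⟩ := ha
        rw [g.emb.injective.extend_apply]
        exact ((f.emb.injective.comp g.emb.injective).extend_apply _ _ b).symm
      · rw [Function.extend_apply' _ _ _ ha, Function.extend_apply',
          f.emb.injective.extend_apply]
        rintro ⟨b, hb⟩
        exact ha ⟨b, f.emb.injective hb⟩
    · rw [Function.extend_apply' _ _ _ hk, Function.extend_apply', Function.extend_apply' _ _ _ hk]
      rintro ⟨b, hb⟩
      exact hk ⟨_, hb⟩

/-- The full subcategory of the cube category on the objects `0, …, p`. -/
abbrev CubeLE (p : ℕ) : Type := ObjectProperty.FullSubcategory fun a : Cube => a.dim ≤ p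


/-- There are no morphisms that raise the dimension. -/
theorem Cube.dim_le {p r : Cube} (f : p ⟶ r) : r.dim ≤ p.dim := by
  have h := Fintype.card_le_of_embedding (Cube.Hom.emb f).toEmbedding
  simpa using h

/-- The only endomorphisms are the identities. -/
theorem Cube.eq_id {p : Cube} (f : p ⟶ p) : f = 𝟙 p := by
  have h : Cube.Hom.emb f = RelEmbedding.refl _ := by
    have hs : Function.Surjective (Cube.Hom.emb f) :=
      Finite.injective_iff_surjective.1 (Cube.Hom.emb f).injective
    refine DFunLike.coe_injective ((StrictMono.range_inj (Cube.Hom.emb f).strictMono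
      strictMono_id).1 ?_)
    rw [hs.range_eq]
    exact Function.surjective_id.range_eq.symm
  refine Cube.Hom.ext h ?_
  funext k
  exact ((Cube.Hom.sgn_eq_zero_iff f k).2 (by rw [h]; exact ⟨k, rfl⟩))

/-! ### Cubical spaces -/

/-- A homotopical cubical space (`h□`-space). -/
abbrev CubicalSpace : Type (u + 1) := HDiagram.{0, 0, u} Cube

/-- A `h□_p`-space. -/
abbrev CubicalSpaceLE (p : ℕ) : Type (u + 1) := HDiagram.{0, 0, u} (CubeLE p)

namespace CubicalSpace

/-- The truncation `X_{≤ p}` of a cubical space. -/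
noncomputable abbrev truncate (X : CubicalSpace.{u}) (p : ℕ) : CubicalSpaceLE.{u} p :=
  X.restrict (ObjectProperty.ι _)

/-- The canonical map `|X_{≤ p}| → |X|`. -/
noncomputable abbrev truncateMap (X : CubicalSpace.{u}) (p : ℕ) : C((X.truncate p).Hocolim, X.Hocolim) :=
  X.hocolimRestrict (ObjectProperty.ι _)

end CubicalSpace

/-! ### Replacing the space of squares -/

namespace CubeLE

/-- The object `n` of the full subcategory on `0, …, p`. -/
abbrev mk {p : ℕ} (n : ℕ) (h : n ≤ p) : CubeLE p := ⟨⟨n⟩, h⟩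

theorem dim_le {p : ℕ} {A B : CubeLE p} (f : A ⟶ B) : B.obj.dim ≤ A.obj.dim :=
  Cube.dim_le f.hom

theorem eq_id {p : ℕ} {A : CubeLE p} (f : A ⟶ A) : f = 𝟙 A :=
  InducedCategory.hom_ext (Cube.eq_id f.hom)

theorem chain_dim_le {p : ℕ} {A B : CubeLE p} (c : TimedChain A B) : B.obj.dim ≤ A.obj.dim := by
  induction c with
  | nil => exact le_rfl
  | cons t f c ih => exact (dim_le f).trans ih

theorem ext_dim {p : ℕ} {A B : CubeLE p} (h : A.obj.dim = B.obj.dim) : A = B := by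
  obtain ⟨⟨a⟩, ha⟩ := A
  obtain ⟨⟨b⟩, hb⟩ := B
  cases h
  rfl

end CubeLE

namespace CubicalSpaceLE

theorem act_self {p : ℕ} (X : CubicalSpaceLE.{u} p) {A B : CubeLE p} (c : TimedChain A B)
    {B' : CubeLE p} (g : B ⟶ B') (h : A = B') (x : X.obj A) : X.act g c x = h ▸ x := by
  induction c generalizing B' with
  | nil =>
    subst h
    rw [CubeLE.eq_id g]
    exact X.act_id x
  | @cons E B t f c ih =>
    have h1 := CubeLE.dim_le f
    have h2 := CubeLE.dim_le g
    have h3 := CubeLE.chain_dim_le c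
    obtain rfl : A = B := CubeLE.ext_dim (by subst h; omega)
    subst h
    rw [CubeLE.eq_id g, X.act_last_id]
    exact ih f rfl

variable (X : CubicalSpaceLE.{u} 2) (S : Type u)

/-- The spaces `S`, `X_1`, `X_0` in dimensions `2`, `1`, `0`. -/
def ReplaceObj : CubeLE 2 → Type u
  | ⟨⟨0⟩, h⟩ => X.obj (CubeLE.mk 0 h)
  | ⟨⟨1⟩, h⟩ => X.obj (CubeLE.mk 1 h)
  | ⟨⟨2⟩, _⟩ => S
  | ⟨⟨_ + 3⟩, h⟩ => absurd h (by simp)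

instance [TopologicalSpace S] : ∀ A, TopologicalSpace (ReplaceObj X S A)
  | ⟨⟨0⟩, h⟩ => X.top (CubeLE.mk 0 h)
  | ⟨⟨1⟩, h⟩ => X.top (CubeLE.mk 1 h)
  | ⟨⟨2⟩, _⟩ => inferInstanceAs (TopologicalSpace S)
  | ⟨⟨_ + 3⟩, h⟩ => absurd h (by simp)

variable {S} [TopologicalSpace S] (φ : C(S, X.obj (CubeLE.mk 2 le_rfl)))

/-- The maps `φ`, `id`, `id` in dimensions `2`, `1`, `0`. -/
noncomputable def replaceApp : ∀ A, C(ReplaceObj X S A, X.obj A)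
  | ⟨⟨0⟩, _⟩ => ContinuousMap.id _
  | ⟨⟨1⟩, _⟩ => ContinuousMap.id _
  | ⟨⟨2⟩, _⟩ => φ
  | ⟨⟨_ + 3⟩, h⟩ => absurd h (by simp)

/-- The structure maps: `D(f_n, t_n, …, f_0; φ s)` if the target has dimension `0` or `1`; if
it has dimension `2`, then all the morphisms are identities and the structure map is the identity
of `S`. -/
noncomputable def replaceAct {A B : CubeLE 2} : {B' : CubeLE 2} → (B ⟶ B') → TimedChain A B →
    ReplaceObj X S A → ReplaceObj X S B'
  | ⟨⟨0⟩, _⟩, f, c, x => X.act f c (replaceApp X φ A x)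
  | ⟨⟨1⟩, _⟩, f, c, x => X.act f c (replaceApp X φ A x)
  | ⟨⟨2⟩, h⟩, f, c, x =>
    have e : A = ⟨⟨2⟩, h⟩ := CubeLE.ext_dim
      (le_antisymm A.property ((CubeLE.dim_le f).trans (CubeLE.chain_dim_le c)))
    e ▸ x
  | ⟨⟨_ + 3⟩, h⟩, _, _, _ => absurd h (by simp)

theorem replaceApp_act {A B B' : CubeLE 2} (f : B ⟶ B') (c : TimedChain A B)
    (x : ReplaceObj X S A) :
    replaceApp X φ B' (replaceAct X φ f c x) = X.act f c (replaceApp X φ A x) := by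
  match B', f with
  | ⟨⟨0⟩, _⟩, f => rfl
  | ⟨⟨1⟩, _⟩, f => rfl
  | ⟨⟨2⟩, h⟩, f =>
    obtain rfl : A = ⟨⟨2⟩, h⟩ := CubeLE.ext_dim
      (le_antisymm A.property ((CubeLE.dim_le f).trans (CubeLE.chain_dim_le c)))
    exact (act_self X c f rfl _).symm
  | ⟨⟨_ + 3⟩, h⟩, _ => exact absurd h (by simp)

theorem replace_ext {A B B' E : CubeLE 2} (f : B ⟶ B') (c : TimedChain A B) (f' : E ⟶ B')
    (c' : TimedChain A E) (x : ReplaceObj X S A)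
    (h : X.act f c (replaceApp X φ A x) = X.act f' c' (replaceApp X φ A x)) :
    replaceAct X φ f c x = replaceAct X φ f' c' x := by
  match B', f, f' with
  | ⟨⟨0⟩, _⟩, f, f' => exact h
  | ⟨⟨1⟩, _⟩, f, f' => exact h
  | ⟨⟨2⟩, _⟩, f, f' => rfl
  | ⟨⟨_ + 3⟩, h⟩, _, _ => exact absurd h (by simp)

/-- The `h□_2`-space `S ⇉ X_1 ⇉ X_0` obtained from `X_2 ⇉ X_1 ⇉ X_0` by means of `φ : S → X_2`. -/
noncomputable def replaceTwo : CubicalSpaceLE.{u} 2 where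
  obj := ReplaceObj X S
  act f c x := replaceAct X φ f c x
  continuous_act {A B B'} f := by
    have key : Continuous fun z : TimedChain A B × ReplaceObj X S A =>
        X.act f z.1 (replaceApp X φ A z.2) :=
      (X.continuous_act f).comp
        (continuous_fst.prodMk ((replaceApp X φ A).continuous.comp continuous_snd))
    match B', f with
    | ⟨⟨0⟩, _⟩, f => exact key
    | ⟨⟨1⟩, _⟩, f => exact key
    | ⟨⟨2⟩, h⟩, f =>
      by_cases hA : A = ⟨⟨2⟩, h⟩
      · subst hA
        exact continuous_snd
      · refine continuous_iff_continuousAt.2 fun z => (hA ?_).elim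
        exact CubeLE.ext_dim
          (le_antisymm A.property ((CubeLE.dim_le f).trans (CubeLE.chain_dim_le z.1)))
    | ⟨⟨_ + 3⟩, h⟩, _ => exact absurd h (by simp)
  act_id {B} x := by
    match B with
    | ⟨⟨0⟩, _⟩ => exact X.act_id _
    | ⟨⟨1⟩, _⟩ => exact X.act_id _
    | ⟨⟨2⟩, h⟩ => rfl
    | ⟨⟨_ + 3⟩, h⟩ => exact absurd h (by simp)
  act_first_id f u t x := replace_ext X φ _ _ _ _ x (X.act_first_id f u t _)
  act_middle_id f u t s g c x := replace_ext X φ _ _ _ _ x (X.act_middle_id f u t s g c _)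
  act_last_id t g c x := replace_ext X φ _ _ _ _ x (X.act_last_id t g c _)
  act_one f u t h g c x := replace_ext X φ _ _ _ _ x (X.act_one f u t h g c _)
  act_last_one f g c x := replace_ext X φ _ _ _ _ x (X.act_last_one f g c _)
  act_zero {A B B' E E'} f u g c x := by
    have key := X.act_zero f u g c (replaceApp X φ A x)
    rw [← replaceApp_act X φ g c x] at key
    match B', f with
    | ⟨⟨0⟩, _⟩, f => exact key
    | ⟨⟨1⟩, _⟩, f => exact key
    | ⟨⟨2⟩, h⟩, f =>
      have h1 := (CubeLE.dim_le f).trans (CubeLE.chain_dim_le u)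
      obtain rfl : E' = ⟨⟨2⟩, h⟩ := CubeLE.ext_dim (le_antisymm E'.property h1)
      rfl
    | ⟨⟨_ + 3⟩, h⟩, _ => exact absurd h (by simp)

/-- The strict morphism from `S ⇉ X_1 ⇉ X_0` to `X_2 ⇉ X_1 ⇉ X_0` given by `φ`, `id`, `id`. -/
noncomputable def replaceTwoHom : HDiagram.Hom (replaceTwo X φ) X where
  app := replaceApp X φ
  app_act f c x := replaceApp_act X φ f c x

/-- The induced map of geometrical realizations. -/
noncomputable abbrev replaceTwoMap : C((replaceTwo X φ).Hocolim, X.Hocolim) := (replaceTwoHom X φ).hocolimMap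

end CubicalSpaceLE

/-! ### Fundamental groups and skeleta -/

/-- A space is compactly generated and has the homotopy type of a CW complex. -/
def IsCGCWType (Z : Type u) [TopologicalSpace Z] : Prop :=
  CompactlyGeneratedSpace Z ∧
    ∃ (K : Type u) (_ : TopologicalSpace K) (_ : T2Space K)
      (_ : Topology.CWComplex (Set.univ : Set K)), Nonempty (ContinuousMap.HomotopyEquiv K Z)

/-- A continuous map is a bijection on path components and an isomorphism on the
fundamental groups at all base points. -/
def IsPiOneEquiv {Z : Type*} {W : Type*} [TopologicalSpace Z] [TopologicalSpace W]
    (f : C(Z, W)) : Prop :=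
  (∀ z z', Joined (f z) (f z') → Joined z z') ∧ (∀ w, ∃ z, Joined (f z) w) ∧
    ∀ z, Function.Bijective (FundamentalGroup.map f z)

/-- The `0`-skeleton of a CW complex `K`, as a topological space. -/
abbrev ZeroSkeleton (K : Type u) [TopologicalSpace K] [T2Space K]
    [Topology.CWComplex (Set.univ : Set K)] : Type u :=
  ((Topology.CWComplex.skeleton (Set.univ : Set K) 0 :
    Topology.RelCWComplex.Subcomplex (Set.univ : Set K)) : Set K)

/-- The map `K^{(0)} ⊆ K → Z` given by a homotopy equivalence `K → Z`. -/
noncomputable def zeroSkeletonMap {K Z : Type u} [TopologicalSpace K] [T2Space K]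
    [Topology.CWComplex (Set.univ : Set K)] [TopologicalSpace Z]
    (e : ContinuousMap.HomotopyEquiv K Z) : C(ZeroSkeleton K, Z) :=
  e.toFun.comp ⟨Subtype.val, continuous_subtype_val⟩

/-!
The idea is that the fundamental groupoid of a homotopy colimit is a homotopy colimit of fundamental
groupoids, and that a homotopy colimit of groupoids over the cube category only sees the vertices,
the edges, and one square for every path component of the space of squares.

Functors from a fundamental groupoid to a groupoid are represented by the structure `Transport`,
which assigns morphisms to paths.  The van Kampen theorem, in the form that transports on the
members of an open cover which agree on overlaps glue, is `Transport.exists_glue`.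
It is applied to the open stars of the vertex spaces of a homotopy colimit.  The categories here
are acyclic, so that a word `(t_n, f_n, …, t_1, f_1; x)` is a point of a simplex whose vertices are
distinct objects, and barycentric coordinates (`weight`) are well defined on the homotopy colimit;
the star of `Q` is the set of points at which the weight of `Q` is positive.  Sliding the
other weights to zero (`slide`) joins a point of the star to its image under a map to the
space `D_Q` (`retract`).  Where the stars of `Q` and `R` overlap, the points obtained from the two
retractions are related by a morphism `Q ⟶ R` of the diagram, up to a path in `D_R` (`comparePath`).
Consequently a compatible family of transports on the vertex spaces (`GroupoidCocone`) extends to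
the homotopy colimit (`GroupoidCocone.exists_extension`), and so does a compatible family of natural
isomorphisms (`exists_isNatural`).

In the cube category every object has vertices, that is, morphisms to `0`, and any two of them are
connected by edges (`Cube.edgeConnected`).  A cocone is therefore determined by data over `X_0` and
`X_1` (`EdgeData`), subject to the condition that the transports along the edges of the cube of each
point commute (`HasCone`).  In a cube this follows from its squares (`HasCone.of_squares`), so
only the points of `X_2` matter, and there the condition is invariant along paths
(`HasCone.of_path`).  It thus suffices to verify it at one point in every path component of `X_2`.

Let `Z` be `X_{≤ 2}` or `Y`, with its morphism to `X_{≤ 2}`, which is the identity in dimensions `0`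
and `1` and meets every path component of `X_2`; for `Y` the last point holds because a path
component of a CW complex contains a vertex (`exists_joined_zeroSkeletonMap`).  The inclusions of
`Z_0` and `Z_1` in the realization of `Z` define edge data on `X` with values in the fundamental
groupoid of `|Z|`.  The condition holds at the points that come from `Z_2`, whose squares are filled
in `|Z|`, hence everywhere.  The resulting transport on `|X|` is inverse to `|Z| → |X|`, as one
checks on vertices and edges (`isPiOneEquiv_hocolimRestrictMap`).  So `|X_{≤ 2}| → |X|` and
`|Y| → |X|` are equivalences of fundamental groupoids, and by two-out-of-three
(`IsPiOneEquiv.of_comp`) so is `|Y| → |X_{≤ 2}|`.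
-/

section

open unitInterval Set.Icc

/-- A representation of the paths of a space `W` in a groupoid `G`: every path is sent to a morphism
between the objects attached to its endpoints, compatibly with concatenation, and homotopic
paths are sent to the same morphism.  This is a functor from the fundamental groupoid of `W` to `G`
with a prescribed action on objects. -/
structure Transport {W : Type*} [TopologicalSpace W] {G : Type*} [Groupoid G] (obj : W → G) where
  /-- the morphism attached to a path -/
  map : ∀ {a b : W}, Path a b → (obj a ⟶ obj b)
  map_trans : ∀ {a b c : W} (p : Path a b) (q : Path b c), map (p.trans q) = map p ≫ map q
  map_homotopic : ∀ {a b : W} {p q : Path a b}, p.Homotopic q → map p = map q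

namespace Transport

variable {W V : Type*} [TopologicalSpace W] [TopologicalSpace V] {G : Type*} [Groupoid G]

section Basic

variable {obj : W → G} (M : Transport obj)

@[simp]
theorem map_refl (a : W) : M.map (Path.refl a) = 𝟙 (obj a) := by
  have h : M.map (Path.refl a) ≫ M.map (Path.refl a) = M.map (Path.refl a) := by
    rw [← M.map_trans, Path.refl_trans_refl]
  exact (cancel_epi (M.map (Path.refl a))).1 (by rw [h, Category.comp_id])

theorem map_const {a : W} (p : Path a a) (hp : ∀ s, p s = a) : M.map p = 𝟙 (obj a) := by
  rw [show p = Path.refl a from Path.ext (funext hp), map_refl]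

/-- A transport can be pulled back along a continuous map. -/
def comap (f : C(V, W)) : Transport (fun z => obj (f z)) where
  map p := M.map (p.map f.continuous)
  map_trans p q := by rw [Path.map_trans, M.map_trans]
  map_homotopic h := M.map_homotopic (h.map f)

@[simp]
theorem comap_map (f : C(V, W)) {a b : V} (p : Path a b) :
    (M.comap f).map p = M.map (p.map f.continuous) := rfl

/-- Two pairs of composable paths with the same endpoints have the same transport if
they factor, compatibly, through a simply connected space. -/
theorem map_square {T : Type*} [TopologicalSpace T] [SimplyConnectedSpace T] (Γ : C(T, W))
    {a b c d : W} {p₁ : Path a b} {p₂ : Path b d} {q₁ : Path a c} {q₂ : Path c d}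
    {u₁ u₂ u₃ u₄ : T} (p₁' : Path u₁ u₂) (p₂' : Path u₂ u₄) (q₁' : Path u₁ u₃) (q₂' : Path u₃ u₄)
    (h₁ : ∀ s, p₁ s = Γ (p₁' s)) (h₂ : ∀ s, p₂ s = Γ (p₂' s)) (h₃ : ∀ s, q₁ s = Γ (q₁' s))
    (h₄ : ∀ s, q₂ s = Γ (q₂' s)) :
    M.map p₁ ≫ M.map p₂ = M.map q₁ ≫ M.map q₂ := by
  obtain rfl : a = Γ u₁ := by simpa using h₁ 0
  obtain rfl : b = Γ u₂ := by simpa using h₁ 1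
  obtain rfl : c = Γ u₃ := by simpa using h₃ 1
  obtain rfl : d = Γ u₄ := by simpa using h₂ 1
  obtain rfl : p₁ = p₁'.map Γ.continuous := Path.ext (funext h₁)
  obtain rfl : p₂ = p₂'.map Γ.continuous := Path.ext (funext h₂)
  obtain rfl : q₁ = q₁'.map Γ.continuous := Path.ext (funext h₃)
  obtain rfl : q₂ = q₂'.map Γ.continuous := Path.ext (funext h₄)
  simp only [← M.map_trans, ← Path.map_trans]
  exact M.map_homotopic ((SimplyConnectedSpace.paths_homotopic _ _).map Γ)

/-- The canonical representation of the paths of `W` in the fundamental groupoid of `W`. -/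
def fundamental (W : Type*) [TopologicalSpace W] : Transport (FundamentalGroupoid.mk : W → _) where
  map p := (⟦p⟧ : Path.Homotopic.Quotient _ _)
  map_trans _ _ := rfl
  map_homotopic h := Quotient.sound h

end Basic

end Transport

/-! ### Paths and open covers -/

/-- The first half of a path. -/
noncomputable def Path.firstHalf {X : Type*} [TopologicalSpace X] {a b : X} (p : Path a b) :
    Path a (p ⟨1 / 2, by norm_num, by norm_num⟩) where
  toFun s := p (convexComb 0 ⟨1 / 2, by norm_num, by norm_num⟩ s)
  continuous_toFun := p.continuous.comp (continuous_convexComb _ _)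
  source' := by simp
  target' := by simp

/-- The second half of a path. -/
noncomputable def Path.secondHalf {X : Type*} [TopologicalSpace X] {a b : X} (p : Path a b) :
    Path (p ⟨1 / 2, by norm_num, by norm_num⟩) b where
  toFun s := p (convexComb ⟨1 / 2, by norm_num, by norm_num⟩ 1 s)
  continuous_toFun := p.continuous.comp (continuous_convexComb _ _)
  source' := by simp
  target' := by simp

theorem Path.firstHalf_trans_secondHalf {X : Type*} [TopologicalSpace X] {a b : X} (p : Path a b) :
    p.firstHalf.trans p.secondHalf = p := by
  ext s
  rw [Path.trans_apply]
  split_ifs with h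
  · change p _ = p _
    congr 1
    ext
    simp only [coe_convexComb, Set.Icc.coe_zero]
    ring
  · change p _ = p _
    congr 1
    ext
    simp [coe_convexComb]
    ring

/-- A property of paths that holds for the paths inside one member of an open cover and is
stable under concatenation holds for all paths. -/
theorem Path.induction_of_cover {X : Type*} [TopologicalSpace X] {ι : Type*} (U : ι → Set X)
    (hU : ∀ i, IsOpen (U i)) (hc : ∀ z, ∃ i, z ∈ U i)
    {P : ∀ {a b : X}, Path a b → Prop}
    (small : ∀ i {a b : X} (p : Path a b), (∀ s, p s ∈ U i) → P p)
    (trans : ∀ {a b c : X} (p : Path a b) (q : Path b c), P p → P q → P (p.trans q))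
    {a b : X} (p : Path a b) : P p := by
  have key : ∀ (n : ℕ) {a b : X} (p : Path a b),
      (∀ r : I, ∃ i, ∀ s : I, dist r s ≤ (1 / 2) ^ n → p s ∈ U i) → P p := by
    intro n
    induction n with
    | zero =>
      intro a b p hp
      obtain ⟨i, hi⟩ := hp 0
      exact small i p fun s => hi s (by
        rw [Subtype.dist_eq, Real.dist_eq]
        simpa [abs_le] using ⟨by linarith [s.2.1], s.2.2⟩)
    | succ n ih =>
      intro a b p hp
      rw [← p.firstHalf_trans_secondHalf]
      have hd : ∀ x y r s : I, dist x y = 1 / 2 → dist r s ≤ (1 / 2) ^ n →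
          dist (convexComb x y r) (convexComb x y s) ≤ (1 / 2) ^ (n + 1) := by
        intro x y r s hxy h
        have e : ((convexComb x y r : I) : ℝ) - convexComb x y s = (x - y) * (s - r) := by
          simp only [coe_convexComb]
          ring
        rw [Subtype.dist_eq, Real.dist_eq] at hxy h ⊢
        rw [e, abs_mul, hxy, abs_sub_comm, pow_succ]
        linarith
      refine trans _ _ (ih _ fun r => ?_) (ih _ fun r => ?_)
      · obtain ⟨i, hi⟩ := hp (convexComb 0 ⟨1 / 2, by norm_num, by norm_num⟩ r)
        exact ⟨i, fun s hs => hi _ (hd _ _ _ _ (by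
          rw [Subtype.dist_eq, Real.dist_eq]; norm_num) hs)⟩
      · obtain ⟨i, hi⟩ := hp (convexComb ⟨1 / 2, by norm_num, by norm_num⟩ 1 r)
        exact ⟨i, fun s hs => hi _ (hd _ _ _ _ (by
          rw [Subtype.dist_eq, Real.dist_eq]; norm_num) hs)⟩
  obtain ⟨δ, hδ, H⟩ := lebesgue_number_lemma_of_metric (isCompact_univ (X := I))
    (fun i => (hU i).preimage p.continuous) (fun s _ => Set.mem_iUnion.2 (hc (p s)))
  obtain ⟨n, hn⟩ := exists_pow_lt_of_lt_one hδ (by norm_num : (1 / 2 : ℝ) < 1)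
  refine key n p fun r => ?_
  obtain ⟨i, hi⟩ := H r trivial
  exact ⟨i, fun s hs => hi (by rw [Metric.mem_ball, dist_comm]; exact hs.trans_lt hn)⟩

/-! ### Transports glue along open covers -/

namespace Transport

variable {X : Type*} [TopologicalSpace X] {G : Type*} [Groupoid G]

/-- The point of the segment from `u` to `v` in the unit square with parameter `s`. -/
def sqSeg (u v : I × I) (s : I) : I × I := (convexComb u.1 v.1 s, convexComb u.2 v.2 s)

theorem continuous_sqSeg : Continuous fun z : (I × I) × (I × I) × I => sqSeg z.1 z.2.1 z.2.2 := by
  refine Continuous.prodMk ?_ ?_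
  · exact continuous_convexComb_prod.comp (by fun_prop : Continuous
      fun z : (I × I) × (I × I) × I => (z.1.1, z.2.1.1, z.2.2))
  · exact continuous_convexComb_prod.comp (by fun_prop : Continuous
      fun z : (I × I) × (I × I) × I => (z.1.2, z.2.1.2, z.2.2))

@[simp] theorem sqSeg_zero (u v : I × I) : sqSeg u v 0 = u := by simp [sqSeg]
@[simp] theorem sqSeg_one (u v : I × I) : sqSeg u v 1 = v := by simp [sqSeg]
@[simp] theorem sqSeg_self (u : I × I) (s : I) : sqSeg u u s = u := by simp [sqSeg]

theorem convexComb_convexComb (x y r s t : I) :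
    convexComb (convexComb x y r) (convexComb x y s) t = convexComb x y (convexComb r s t) := by
  ext
  simp only [coe_convexComb]
  ring

theorem sqSeg_sqSeg (u v : I × I) (r s t : I) :
    sqSeg (sqSeg u v r) (sqSeg u v s) t = sqSeg u v (convexComb r s t) := by
  simp [sqSeg, convexComb_convexComb]

theorem dist_convexComb_left (x y s : I) : dist (convexComb x y s) x = s * dist x y := by
  simp only [Subtype.dist_eq, Real.dist_eq, coe_convexComb]
  rw [show (1 - (s : ℝ)) * x + s * y - x = s * (y - x) by ring, abs_mul, abs_of_nonneg s.2.1,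
    abs_sub_comm]

theorem dist_convexComb_right (x y s : I) : dist (convexComb x y s) y = (1 - s) * dist x y := by
  simp only [Subtype.dist_eq, Real.dist_eq, coe_convexComb]
  rw [show (1 - (s : ℝ)) * x + s * y - y = (1 - s) * (x - y) by ring, abs_mul,
    abs_of_nonneg (sub_nonneg.2 s.2.2)]

theorem dist_convexComb_lt {x y z : I} {δ : ℝ} (hx : dist x z < δ) (hy : dist y z < δ) (s : I) :
    dist (convexComb x y s) z < δ := by
  rw [Subtype.dist_eq, Real.dist_eq] at hx hy ⊢
  refine lt_of_le_of_lt ?_ (max_lt hx hy)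
  have h0 := s.2.1
  have h1 : (0 : ℝ) ≤ 1 - s := sub_nonneg.2 s.2.2
  calc |((convexComb x y s : I) : ℝ) - z| = |(1 - (s : ℝ)) * (x - z) + s * (y - z)| := by
        rw [coe_convexComb]; ring_nf
    _ ≤ (1 - (s : ℝ)) * |(x : ℝ) - z| + s * |(y : ℝ) - z| := by
        refine (abs_add_le _ _).trans_eq ?_
        rw [abs_mul, abs_mul, abs_of_nonneg h0, abs_of_nonneg h1]
    _ ≤ (1 - (s : ℝ)) * max |(x : ℝ) - z| |(y : ℝ) - z| +
          s * max |(x : ℝ) - z| |(y : ℝ) - z| := by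
        gcongr
        · exact le_max_left _ _
        · exact le_max_right _ _
    _ = max |(x : ℝ) - z| |(y : ℝ) - z| := by ring

theorem dist_sqSeg_lt {x y z : I × I} {δ : ℝ} (hx : dist x z < δ) (hy : dist y z < δ) (s : I) :
    dist (sqSeg x y s) z < δ := by
  rw [Prod.dist_eq, max_lt_iff] at hx hy ⊢
  exact ⟨dist_convexComb_lt hx.1 hy.1 s, dist_convexComb_lt hx.2 hy.2 s⟩

/-- The image of a segment of the unit square under a continuous map. -/
def segPath (h : C(I × I, X)) (u v : I × I) : Path (h u) (h v) where
  toFun s := h (sqSeg u v s)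
  continuous_toFun := h.continuous.comp (continuous_sqSeg.comp
    (continuous_const.prodMk (continuous_const.prodMk continuous_id)))
  source' := by simp
  target' := by simp

@[simp] theorem segPath_apply (h : C(I × I, X)) (u v : I × I) (s : I) :
    segPath h u v s = h (sqSeg u v s) := rfl

/-- A path contained in `U`, as a path of the subspace `U`. -/
def liftPath {U : Set X} {a b : X} (p : Path a b) (hp : ∀ s, p s ∈ U) :
    Path (⟨a, by simpa using hp 0⟩ : U) ⟨b, by simpa using hp 1⟩ where
  toFun s := ⟨p s, hp s⟩
  continuous_toFun := p.continuous.subtype_mk _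
  source' := by simp
  target' := by simp

variable {ι : Type*} {U : ι → Set X} {obj : X → G}
  (M : ∀ i, Transport fun z : U i => obj z)

/-- The value of the `i`-th of a family of local transports on a path contained in `U i`. -/
def loc (i : ι) {a b : X} (p : Path a b) (hp : ∀ s, p s ∈ U i) : obj a ⟶ obj b :=
  (M i).map (liftPath p hp)

theorem loc_const (i : ι) {a : X} (p : Path a a) (hp : ∀ s, p s ∈ U i) (h : ∀ s, p s = a) :
    loc M i p hp = 𝟙 (obj a) :=
  (M i).map_const _ fun s => Subtype.ext (h s)

/-- The three edges of a triangle of the unit square. -/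
theorem loc_triangle (i : ι) (h : C(I × I, X)) (u v w : I × I)
    (H : ∀ α β, h (sqSeg (sqSeg u v α) w β) ∈ U i) (h₁ : ∀ s, segPath h u v s ∈ U i)
    (h₂ : ∀ s, segPath h v w s ∈ U i) (h₃ : ∀ s, segPath h u w s ∈ U i) :
    loc M i (segPath h u v) h₁ ≫ loc M i (segPath h v w) h₂ = loc M i (segPath h u w) h₃ := by
  have hw : h w ∈ U i := by simpa using h₃ 1
  let Γ : C(ℝ × ℝ, U i) := ⟨fun z => ⟨h (sqSeg (sqSeg u v (Set.projIcc 0 1 zero_le_one z.1)) w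
      (Set.projIcc 0 1 zero_le_one z.2)), H _ _⟩,
    (h.continuous.comp (continuous_sqSeg.comp (.prodMk (continuous_sqSeg.comp
      (continuous_const.prodMk (continuous_const.prodMk
        ((continuous_projIcc (h := zero_le_one)).comp continuous_fst))))
      (continuous_const.prodMk ((continuous_projIcc (h := zero_le_one)).comp continuous_snd))))).subtype_mk _⟩
  let id' : Path (0 : ℝ) 1 := ⟨⟨Subtype.val, continuous_subtype_val⟩, rfl, rfl⟩
  have e := (M i).map_square Γ (p₁ := liftPath (segPath h u v) h₁)
    (p₂ := liftPath (segPath h v w) h₂) (q₁ := liftPath (segPath h u w) h₃)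
    (q₂ := Path.refl (⟨h w, hw⟩ : U i))
    (id'.prod (Path.refl 0)) ((Path.refl 1).prod id') ((Path.refl 0).prod id')
    (id'.prod (Path.refl 1))
    (fun s => Subtype.ext (by simp [Γ, id', liftPath, Set.projIcc_val]))
    (fun s => Subtype.ext (by simp [Γ, id', liftPath, Set.projIcc_val]))
    (fun s => Subtype.ext (by simp [Γ, id', liftPath, Set.projIcc_val]))
    (fun s => Subtype.ext (by simp [Γ, id', Set.projIcc_val]))
  unfold loc
  rw [e, map_refl, Category.comp_id]

/-- A development of a family of local transports along a map `h` from the unit square: a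
trivialization of the pullback of the family along `h`. -/
def IsDevelopment (h : C(I × I, X)) {x₀ : X} (t : ∀ u, obj x₀ ⟶ obj (h u)) : Prop :=
  ∀ i u v (hs : ∀ s, segPath h u v s ∈ U i), t u ≫ loc M i (segPath h u v) hs = t v

/-- A development exists on the unit square: it is constructed by transport along the segments
that join the points of the square to the corner `(0, 0)`, each divided into short pieces. -/
theorem exists_development (hU : ∀ i, IsOpen (U i)) (hc : ∀ z, ∃ i, z ∈ U i)
    (hM : ∀ i j {a b : X} (p : Path a b) (hi : ∀ s, p s ∈ U i) (hj : ∀ s, p s ∈ U j),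
      loc M i p hi = loc M j p hj) (h : C(I × I, X)) :
    ∃ t : ∀ u, obj (h (0, 0)) ⟶ obj (h u), IsDevelopment M h t := by
  obtain ⟨δ, hδ, H⟩ := lebesgue_number_lemma_of_metric (isCompact_univ (X := I × I))
    (fun i => (hU i).preimage h.continuous) (fun s _ => Set.mem_iUnion.2 (hc (h s)))
  replace H : ∀ x : I × I, ∃ i, ∀ y, dist y x < δ → h y ∈ U i := fun x =>
    (H x trivial).imp fun i hi y hy => hi hy
  -- It suffices to treat short segments, by repeated bisection.
  suffices hshort : ∃ t : ∀ u, obj (h (0, 0)) ⟶ obj (h u), ∀ u v, dist u v < δ / 3 →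
      ∀ i (hs : ∀ s, segPath h u v s ∈ U i), t u ≫ loc M i (segPath h u v) hs = t v by
    obtain ⟨t, ht⟩ := hshort
    have key : ∀ (n : ℕ) u v, dist u v < δ / 3 * 2 ^ n →
        ∀ i (hs : ∀ s, segPath h u v s ∈ U i), t u ≫ loc M i (segPath h u v) hs = t v := by
      intro n
      induction n with
      | zero => intro u v huv; exact ht u v (by simpa using huv)
      | succ n ih =>
        intro u v huv i hs
        let m : I := ⟨1 / 2, by norm_num, by norm_num⟩
        have hd1 : dist u (sqSeg u v m) < δ / 3 * 2 ^ n := by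
          rw [Prod.dist_eq, max_lt_iff, pow_succ] at huv
          rw [dist_comm, Prod.dist_eq, max_lt_iff]
          simp only [sqSeg, dist_convexComb_left, m]
          constructor <;> linarith
        have hd2 : dist (sqSeg u v m) v < δ / 3 * 2 ^ n := by
          rw [Prod.dist_eq, max_lt_iff, pow_succ] at huv
          rw [Prod.dist_eq, max_lt_iff]
          simp only [sqSeg, dist_convexComb_right, m]
          constructor <;> linarith
        have e1 : ∀ s, sqSeg u (sqSeg u v m) s = sqSeg u v (convexComb 0 m s) := fun s => by
          rw [← sqSeg_sqSeg, sqSeg_zero]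
        have e2 : ∀ s, sqSeg (sqSeg u v m) v s = sqSeg u v (convexComb m 1 s) := fun s => by
          rw [← sqSeg_sqSeg, sqSeg_one]
        have hs1 : ∀ s, segPath h u (sqSeg u v m) s ∈ U i := fun s => by
          rw [segPath_apply, e1]; exact hs _
        have hs2 : ∀ s, segPath h (sqSeg u v m) v s ∈ U i := fun s => by
          rw [segPath_apply, e2]; exact hs _
        rw [← loc_triangle M i h u (sqSeg u v m) v (fun α β => ?_) hs1 hs2 hs, ← Category.assoc,
          ih _ _ hd1, ih _ _ hd2]
        rw [e1]
        nth_rw 2 [← sqSeg_one u v]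
        rw [sqSeg_sqSeg]
        exact hs _
    refine ⟨t, fun i u v => ?_⟩
    obtain ⟨n, hn⟩ := pow_unbounded_of_one_lt (dist u v / (δ / 3)) (by norm_num : (1 : ℝ) < 2)
    refine key n u v ?_ i
    rwa [div_lt_iff₀ (by positivity), mul_comm] at hn
  -- The development is constructed on the squares `[0, k / N]²` by induction on `k`.
  obtain ⟨N, hN⟩ := exists_nat_gt (3 / δ)
  have hN0 : (0 : ℝ) < N := lt_trans (by positivity) hN
  let c : ℕ → I := fun k => ⟨min (k / N) 1, by positivity, min_le_right _ _⟩
  have hc' : ∀ k, dist (c k) (c (k + 1)) < δ / 3 := by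
    intro k
    have h1 : (1 : ℝ) / N < δ / 3 := by
      rw [div_lt_div_iff₀ hN0 (by norm_num)]
      rw [div_lt_iff₀ hδ] at hN
      linarith
    have h2 : ((k + 1 : ℕ) : ℝ) / N = k / N + 1 / N := by push_cast; ring
    have h3 : (0 : ℝ) < 1 / N := by positivity
    rw [Subtype.dist_eq, Real.dist_eq, abs_lt]
    simp only [c, h2]
    rcases min_cases ((k : ℝ) / N) 1 with ⟨e, _⟩ | ⟨e, _⟩ <;>
      rcases min_cases ((k : ℝ) / N + 1 / N) 1 with ⟨e', _⟩ | ⟨e', _⟩ <;> rw [e, e'] <;>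
      constructor <;> linarith
  have key : ∀ k : ℕ, ∃ t : ∀ u, obj (h (0, 0)) ⟶ obj (h (sqSeg (0, 0) u (c k))),
      ∀ u v, dist u v < δ / 3 → ∀ i (hs : ∀ s, segPath h (sqSeg (0, 0) u (c k))
        (sqSeg (0, 0) v (c k)) s ∈ U i),
      t u ≫ loc M i (segPath h (sqSeg (0, 0) u (c k)) (sqSeg (0, 0) v (c k))) hs = t v := by
    intro k
    induction k with
    | zero =>
      have e : (fun u : I × I => sqSeg (0, 0) u (c 0)) = fun _ => (0, 0) := by
        funext u
        have : c 0 = 0 := by ext; simp [c]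
        rw [this, sqSeg_zero]
      -- The type of `t` depends on the map in `e`, which is generalized so that it can be substituted.
      suffices ∀ φ : I × I → I × I, φ = (fun _ => (0, 0)) →
          ∃ t : ∀ u, obj (h (0, 0)) ⟶ obj (h (φ u)),
          ∀ u v, dist u v < δ / 3 → ∀ i (hs : ∀ s, segPath h (φ u) (φ v) s ∈ U i),
          t u ≫ loc M i (segPath h (φ u) (φ v)) hs = t v from this _ e
      rintro φ rfl
      exact ⟨fun u => 𝟙 _, fun u v _ i hs => by
        rw [Category.id_comp]
        exact loc_const M i _ hs fun s => by simp⟩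
    | succ k ih =>
      obtain ⟨t, ht⟩ := ih
      let a : I × I → I × I := fun u => sqSeg (0, 0) u (c k)
      let b : I × I → I × I := fun u => sqSeg (0, 0) u (c (k + 1))
      have hab : ∀ u, dist (b u) (a u) < δ / 3 := by
        intro u
        have : ∀ x : I, dist (convexComb 0 x (c (k + 1))) (convexComb 0 x (c k)) < δ / 3 := by
          intro x
          refine lt_of_le_of_lt ?_ (hc' k)
          simp only [Subtype.dist_eq, Real.dist_eq, coe_convexComb, Set.Icc.coe_zero, mul_zero,
            zero_add, ← sub_mul]
          rw [abs_mul, abs_of_nonneg x.2.1, abs_sub_comm]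
          exact mul_le_of_le_one_right (abs_nonneg _) x.2.2
        rw [Prod.dist_eq, max_lt_iff]
        exact ⟨this _, this _⟩
      have haa : ∀ u v, dist u v < δ / 3 → dist (a v) (a u) < δ / 3 := by
        intro u v huv
        have : ∀ x y : I, dist (convexComb 0 x (c k)) (convexComb 0 y (c k)) ≤ dist y x := by
          intro x y
          simp only [Subtype.dist_eq, Real.dist_eq, coe_convexComb, Set.Icc.coe_zero, mul_zero,
            zero_add, ← mul_sub]
          rw [abs_mul, abs_of_nonneg (c k).2.1, abs_sub_comm]
          exact mul_le_of_le_one_left (abs_nonneg _) (c k).2.2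
        rw [Prod.dist_eq, max_lt_iff] at huv ⊢
        exact ⟨(this _ _).trans_lt huv.1, (this _ _).trans_lt huv.2⟩
      -- The value at `b u` is obtained from the value at `a u` along the segment between them, within
      -- a member of the cover that contains the `δ`-ball around `a u`.
      choose i hi using fun u => H (a u)
      have hself : ∀ x : I × I, dist x x < δ := fun x => by simpa using hδ
      have hseg : ∀ u s, segPath h (a u) (b u) s ∈ U (i u) := fun u s =>
        hi u _ (dist_sqSeg_lt (hself _) ((hab u).trans (by linarith)) s)
      refine ⟨fun u => t u ≫ loc M (i u) (segPath h (a u) (b u)) (hseg u), ?_⟩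
      intro u v huv j hj
      have h1 : dist (a u) (a u) < δ := hself _
      have h2 : dist (a v) (a u) < δ := (haa u v huv).trans (by linarith)
      have h3 : dist (b u) (a u) < δ := (hab u).trans (by linarith)
      have h4 : dist (b v) (a u) < δ := (dist_triangle _ (a v) _).trans_lt (by
        linarith [hab v, haa u v huv])
      have hh : ∀ {x y : I × I}, dist x (a u) < δ → dist y (a u) < δ →
          ∀ s, segPath h x y s ∈ U (i u) := fun hx hy s => hi u _ (dist_sqSeg_lt hx hy s)
      have hh' : ∀ {x y z : I × I}, dist x (a u) < δ → dist y (a u) < δ → dist z (a u) < δ →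
          ∀ α β, h (sqSeg (sqSeg x y α) z β) ∈ U (i u) := fun hx hy hz s _ =>
        hi u _ (dist_sqSeg_lt (dist_sqSeg_lt hx hy s) hz _)
      calc (t u ≫ loc M (i u) (segPath h (a u) (b u)) (hseg u)) ≫
            loc M j (segPath h (b u) (b v)) hj
          = t u ≫ loc M (i u) (segPath h (a u) (b u)) (hh h1 h3) ≫
              loc M (i u) (segPath h (b u) (b v)) (hh h3 h4) := by
            rw [Category.assoc, hM j (i u)]
        _ = t u ≫ loc M (i u) (segPath h (a u) (a v)) (hh h1 h2) ≫
              loc M (i u) (segPath h (a v) (b v)) (hh h2 h4) := by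
            rw [loc_triangle M (i u) h (a u) (b u) (b v) (hh' h1 h3 h4) _ _ (hh h1 h4),
              loc_triangle M (i u) h (a u) (a v) (b v) (hh' h1 h2 h4) _ _ (hh h1 h4)]
        _ = t v ≫ loc M (i u) (segPath h (a v) (b v)) (hh h2 h4) := by
            rw [← Category.assoc, ht u v huv]
        _ = t v ≫ loc M (i v) (segPath h (a v) (b v)) (hseg v) := by
            rw [hM (i u) (i v)]
  obtain ⟨t, ht⟩ := key N
  have e : (fun u : I × I => sqSeg (0, 0) u (c N)) = id := by
    funext u
    have : c N = 1 := by ext; simp [c, hN0.ne']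
    rw [this, sqSeg_one]
    rfl
  have : ∀ φ : I × I → I × I, φ = id →
      (∃ t : ∀ u, obj (h (0, 0)) ⟶ obj (h (φ u)),
        ∀ u v, dist u v < δ / 3 → ∀ i (hs : ∀ s, segPath h (φ u) (φ v) s ∈ U i),
        t u ≫ loc M i (segPath h (φ u) (φ v)) hs = t v) →
      ∃ t : ∀ u, obj (h (0, 0)) ⟶ obj (h u),
        ∀ u v, dist u v < δ / 3 → ∀ i (hs : ∀ s, segPath h u v s ∈ U i),
        t u ≫ loc M i (segPath h u v) hs = t v := by
    rintro φ rfl ⟨t, ht⟩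
    exact ⟨t, ht⟩
  exact this _ e ⟨t, ht⟩

/-- A morphism is the value of a path if it is compatible with all developments along this path. -/
def IsValue {a b : X} (p : Path a b) (g : obj a ⟶ obj b) : Prop :=
  ∀ (h : C(I × I, X)) {x₀ : X} (t : ∀ u, obj x₀ ⟶ obj (h u)), IsDevelopment M h t →
    ∀ u v (hu : h u = a) (hv : h v = b), (∀ s, p s = h (sqSeg u v s)) →
      t u ≫ eqToHom (congrArg obj hu) ≫ g = t v ≫ eqToHom (congrArg obj hv)

theorem isValue_loc (i : ι) {a b : X} (p : Path a b) (hp : ∀ s, p s ∈ U i) :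
    IsValue M p (loc M i p hp) := by
  rintro h x₀ t ht u v rfl rfl hs
  obtain rfl : p = segPath h u v := Path.ext (funext hs)
  simpa using ht i u v hp

theorem IsValue.trans {a b c : X} {p : Path a b} {q : Path b c} {g : obj a ⟶ obj b}
    {g' : obj b ⟶ obj c} (hg : IsValue M p g) (hg' : IsValue M q g') :
    IsValue M (p.trans q) (g ≫ g') := by
  intro h x₀ t ht u v hu hv hs
  let m : I := ⟨1 / 2, by norm_num, by norm_num⟩
  have hp : ∀ s, (p.trans q) (convexComb 0 m s) = p s := by
    intro s
    rw [Path.trans_apply, dif_pos (by simp only [coe_convexComb, m]; simp; linarith [s.2.2])]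
    congr 1
    ext
    simp only [coe_convexComb, m]
    simp
    ring
  have hq : ∀ s, (p.trans q) (convexComb m 1 s) = q s := by
    intro s
    rw [Path.trans_apply]
    split_ifs with h0
    · have h1 : s = 0 := by
        ext
        simp only [coe_convexComb, m, Set.Icc.coe_one] at h0
        rw [Set.Icc.coe_zero]
        linarith [s.2.1]
      subst h1
      simp [m]
    · congr 1
      ext
      simp only [coe_convexComb, m]
      simp
      ring
  have hw : h (sqSeg u v m) = b := by
    rw [← hs]
    have := hq 0
    rwa [convexComb_zero, q.source] at this
  have e1 : ∀ s, sqSeg u (sqSeg u v m) s = sqSeg u v (convexComb 0 m s) := fun s => by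
    rw [← sqSeg_sqSeg, sqSeg_zero]
  have e2 : ∀ s, sqSeg (sqSeg u v m) v s = sqSeg u v (convexComb m 1 s) := fun s => by
    rw [← sqSeg_sqSeg, sqSeg_one]
  have h1 := hg h t ht u (sqSeg u v m) hu hw fun s => by rw [e1, ← hs, hp]
  have h2 := hg' h t ht (sqSeg u v m) v hw hv fun s => by rw [e2, ← hs, hq]
  rw [← h2, ← Category.assoc (t u), ← Category.assoc _ g, Category.assoc (t u), h1]
  simp

section Glue

variable (hU : ∀ i, IsOpen (U i)) (hc : ∀ z, ∃ i, z ∈ U i)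
  (hM : ∀ i j {a b : X} (p : Path a b) (hi : ∀ s, p s ∈ U i) (hj : ∀ s, p s ∈ U j),
    loc M i p hi = loc M j p hj)

include hU hc

theorem exists_isValue {a b : X} (p : Path a b) : ∃ g, IsValue M p g := by
  refine Path.induction_of_cover (P := fun {a b} p => ∃ g, IsValue M p g) U hU hc
    (fun i {a b} p hp => ⟨_, isValue_loc M i p hp⟩) ?_ p
  rintro a b c p q ⟨g, hg⟩ ⟨g', hg'⟩
  exact ⟨_, hg.trans M hg'⟩

include hM

/-- Homotopic paths have the same value.  Given a development along the homotopy, the transport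
around the boundary of the square is trivial, and the two sides on which the homotopy is constant
contribute identities. -/
theorem IsValue.eq_of_homotopic {a b : X} {p q : Path a b} {g g' : obj a ⟶ obj b}
    (hg : IsValue M p g) (hg' : IsValue M q g') (h : p.Homotopic q) : g = g' := by
  obtain ⟨F⟩ := h
  obtain ⟨t, ht⟩ := exists_development M hU hc hM F.toContinuousMap
  have h00 : F (0, 0) = a := by simp
  have h01 : F (0, 1) = b := by simp
  have h10 : F (1, 0) = a := by simp
  have h11 : F (1, 1) = b := by simp
  -- The constant path has the identity as a value.
  have hconst : ∀ a : X, IsValue M (Path.refl a) (𝟙 (obj a)) := by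
    intro a
    obtain ⟨i, hi⟩ := hc a
    have := isValue_loc M i (Path.refl a) fun _ => hi
    rwa [loc_const M i (Path.refl a) (fun _ => hi) fun _ => rfl] at this
  have e0 := hg F.toContinuousMap t ht (0, 0) (0, 1) h00 h01 fun s => by
    simp [sqSeg]
  have e1 := hg' F.toContinuousMap t ht (1, 0) (1, 1) h10 h11 fun s => by
    simp [sqSeg]
  have e2 := hconst a F.toContinuousMap t ht (0, 0) (1, 0) h00 h10 fun s => by
    simp [sqSeg]
  have e3 := hconst b F.toContinuousMap t ht (0, 1) (1, 1) h01 h11 fun s => by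
    simp [sqSeg]
  rw [Category.comp_id] at e2 e3
  rw [← e3, ← e0, ← Category.assoc, ← Category.assoc, e2] at e1
  exact ((cancel_epi _).1 e1).symm

/-- Transports on the members of an open cover which agree on paths contained in two members glue to
a transport on the whole space.  This is the existence part of the theorem of van Kampen for
fundamental groupoids. -/
theorem exists_glue : ∃ Φ : Transport obj, ∀ i {a b : X} (p : Path a b) (hp : ∀ s, p s ∈ U i),
    Φ.map p = loc M i p hp := by
  choose val hval using fun {a b : X} (p : Path a b) => exists_isValue M hU hc p
  refine ⟨⟨val, fun p q => ?_, fun {a b p q} h => ?_⟩, fun i a b p hp => ?_⟩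
  · exact (hval _).eq_of_homotopic M hU hc hM ((hval p).trans M (hval q)) (Path.Homotopic.refl _)
  · exact (hval _).eq_of_homotopic M hU hc hM (hval _) h
  · exact (hval _).eq_of_homotopic M hU hc hM (isValue_loc M i p hp) (Path.Homotopic.refl _)

end Glue

end Transport

/-! ### Natural transformations of transports and equivalences of fundamental groupoids -/

namespace Transport

variable {W : Type*} [TopologicalSpace W] {G H : Type*} [Groupoid G] [Groupoid H]

/-- A transport can be composed with a functor. -/
def postcomp {obj : W → G} (M : Transport obj) (F : G ⥤ H) : Transport fun z => F.obj (obj z) where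
  map p := F.map (M.map p)
  map_trans p q := by rw [M.map_trans, F.map_comp]
  map_homotopic h := by rw [M.map_homotopic h]

/-- A family of morphisms that intertwines two transports. -/
def IsNatural {obj obj' : W → G} (Φ : Transport obj) (Ψ : Transport obj')
    (α : ∀ z, obj z ⟶ obj' z) : Prop :=
  ∀ {a b : W} (p : Path a b), Φ.map p ≫ α b = α a ≫ Ψ.map p

/-- Naturality can be checked on the paths inside the members of an open cover. -/
theorem isNatural_of_cover {ι : Type*} (U : ι → Set W) (hU : ∀ i, IsOpen (U i))
    (hc : ∀ z, ∃ i, z ∈ U i) {obj obj' : W → G} {Φ : Transport obj} {Ψ : Transport obj'}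
    {α : ∀ z, obj z ⟶ obj' z}
    (h : ∀ i {a b : W} (p : Path a b), (∀ s, p s ∈ U i) → Φ.map p ≫ α b = α a ≫ Ψ.map p) :
    IsNatural Φ Ψ α := by
  intro a b p
  refine Path.induction_of_cover (P := fun {a b} p => Φ.map p ≫ α b = α a ≫ Ψ.map p) U hU hc h ?_ p
  intro a b c p q hp hq
  rw [Φ.map_trans, Ψ.map_trans, Category.assoc, hq, ← Category.assoc, hp, Category.assoc]

end Transport

variable {Z W V : Type*} [TopologicalSpace Z] [TopologicalSpace W] [TopologicalSpace V]

theorem joined_of_hom {a b : W} (g : FundamentalGroupoid.mk a ⟶ FundamentalGroupoid.mk b) :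
    Joined a b := by
  obtain ⟨p, -⟩ := Path.Homotopic.Quotient.mk_surjective (show Path.Homotopic.Quotient a b from g)
  exact ⟨p⟩

/-- A continuous map `f` is an equivalence on fundamental groupoids if there is a transport in the
opposite direction which is inverse to `f` up to natural isomorphism. -/
theorem IsPiOneEquiv.of_transport (f : C(Z, W)) {obj : W → FundamentalGroupoid Z}
    (Φ : Transport obj) (α : ∀ z, obj (f z) ⟶ FundamentalGroupoid.mk z)
    (hα : (Φ.comap f).IsNatural (Transport.fundamental Z) α)
    (β : ∀ w, (FundamentalGroupoid.map f).obj (obj w) ⟶ FundamentalGroupoid.mk w)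
    (hβ : (Φ.postcomp (FundamentalGroupoid.map f)).IsNatural (Transport.fundamental W) β) :
    IsPiOneEquiv f := by
  have hα' : ∀ {a b : Z} (p : Path a b), (Transport.fundamental Z).map p =
      inv (α a) ≫ Φ.map (p.map f.continuous) ≫ α b :=
    fun p => (IsIso.eq_inv_comp _).2 (hα p).symm
  have hβ' : ∀ {a b : W} (p q : Path a b), Φ.map p = Φ.map q → p.Homotopic q := by
    intro a b p q h
    refine Quotient.exact (?_ : (⟦p⟧ : Path.Homotopic.Quotient a b) = ⟦q⟧)
    have hp := hβ p
    have hq := hβ q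
    have e : (Φ.postcomp (FundamentalGroupoid.map f)).map p =
      (Φ.postcomp (FundamentalGroupoid.map f)).map q :=
      congrArg (fun g => (FundamentalGroupoid.map f).map g) h
    rw [e, hq] at hp
    exact ((cancel_epi _).1 hp).symm
  refine ⟨?_, ?_, ?_⟩
  · rintro z z' ⟨p⟩
    exact joined_of_hom (inv (α z) ≫ Φ.map p ≫ α z')
  · intro w
    exact ⟨(obj w).as, joined_of_hom (β w)⟩
  · intro z
    constructor
    · intro g g' h
      obtain ⟨p, rfl⟩ := Path.Homotopic.Quotient.mk_surjective
        (show Path.Homotopic.Quotient z z from g)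
      obtain ⟨q, rfl⟩ := Path.Homotopic.Quotient.mk_surjective
        (show Path.Homotopic.Quotient z z from g')
      have h' : (p.map f.continuous).Homotopic (q.map f.continuous) := Quotient.exact h
      exact (hα' p).trans ((by rw [Φ.map_homotopic h'] :
        inv (α z) ≫ Φ.map (p.map f.continuous) ≫ α z =
          inv (α z) ≫ Φ.map (q.map f.continuous) ≫ α z).trans (hα' q).symm)
    · intro g
      obtain ⟨q, rfl⟩ := Path.Homotopic.Quotient.mk_surjective
        (show Path.Homotopic.Quotient (f z) (f z) from g)
      obtain ⟨p, hp⟩ := Path.Homotopic.Quotient.mk_surjective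
        (show Path.Homotopic.Quotient z z from inv (α z) ≫ Φ.map q ≫ α z)
      refine ⟨(⟦p⟧ : Path.Homotopic.Quotient z z), ?_⟩
      refine Quotient.sound (hβ' (p.map f.continuous) q ?_)
      have h := (hα' p).symm.trans hp
      exact (cancel_mono (α z)).1 ((cancel_epi _).1 h)

theorem IsPiOneEquiv.of_comp {f : C(Z, W)} {g : C(W, V)} (hg : IsPiOneEquiv g)
    (h : IsPiOneEquiv (g.comp f)) : IsPiOneEquiv f := by
  refine ⟨fun z z' hz => h.1 z z' (hz.map g.continuous), fun w => ?_, fun z => ?_⟩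
  · obtain ⟨z, hz⟩ := h.2.1 (g w)
    exact ⟨z, hg.1 _ _ hz⟩
  · have e : ⇑(FundamentalGroup.map (g.comp f) z) =
        FundamentalGroup.map g (f z) ∘ FundamentalGroup.map f z := by
      funext x
      obtain ⟨p, rfl⟩ := Path.Homotopic.Quotient.mk_surjective
        (show Path.Homotopic.Quotient z z from x)
      rfl
    have hb := h.2.2 z
    rw [e] at hb
    exact (Function.Bijective.of_comp_iff' (hg.2.2 (f z)) _).1 hb

end

open Set.Icc

local notation "𝕀" => unitInterval

/-! ### Words in an acyclic category -/

/-- A category is acyclic if its only endomorphisms are the identities and it has no cycles through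
different objects. -/
class IsAcyclicCategory (C : Type w) [Category.{v} C] : Prop where
  eq_id : ∀ {A : C} (f : A ⟶ A), f = 𝟙 A
  antisymm : ∀ {A B : C}, Nonempty (A ⟶ B) → Nonempty (B ⟶ A) → A = B

namespace TimedChain

variable {C : Type w} [Category.{v} C]

@[simp]
theorem append_nil {A B : C} (c : TimedChain A B) : append c nil = c := rfl

@[simp]
theorem append_cons {A B E E' : C} (c : TimedChain A B) (t : 𝕀) (f : E ⟶ E')
    (u : TimedChain B E) : append c (cons t f u) = cons t f (append c u) := rfl

@[simp]
theorem nil_append {A B : C} (u : TimedChain A B) : append nil u = u := by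
  induction u with
  | nil => rfl
  | cons t f u ih => rw [append_cons, ih]

theorem append_assoc {A B E F : C} (c : TimedChain A B) (u : TimedChain B E) (v : TimedChain E F) :
    append (append c u) v = append c (append u v) := by
  induction v with
  | nil => rfl
  | cons t f v ih => rw [append_cons, append_cons, append_cons, ih]

theorem nonempty_hom {A B : C} (c : TimedChain A B) : Nonempty (A ⟶ B) := by
  induction c with
  | nil => exact ⟨𝟙 _⟩
  | cons t f c ih => exact ⟨ih.some ≫ f⟩

/-- The sequence of morphisms and the sequence of parameters of a word. -/
def toSigma {A : C} : {B : C} → TimedChain A B →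
    Σ p : Quiver.Path A B, (Fin p.length → 𝕀)
  | _, nil => ⟨.nil, Fin.elim0⟩
  | _, cons t f c => ⟨(toSigma c).1.cons f, Fin.snoc (α := fun _ => 𝕀) (toSigma c).2 t⟩

theorem ofTimes_toSigma {A B : C} (c : TimedChain A B) : ofTimes c.toSigma.1 c.toSigma.2 = c := by
  induction c with
  | nil => rfl
  | cons t f c ih =>
    change cons _ _ (ofTimes _ _) = _
    congr 1
    · exact Fin.snoc_last (α := fun _ => 𝕀) _ _
    · refine Eq.trans ?_ ih
      congr 1
      funext i
      exact Fin.snoc_castSucc (α := fun _ => 𝕀) _ _ _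

theorem toSigma_ofTimes {A B : C} (p : Quiver.Path A B) (τ : Fin p.length → 𝕀) :
    toSigma (ofTimes p τ) = ⟨p, τ⟩ := by
  induction p with
  | nil =>
    refine Sigma.ext rfl (heq_of_eq ?_)
    funext i
    exact i.elim0
  | cons p f ih =>
    have h := ih fun i => τ i.castSucc
    have e : ∀ s : Σ p : Quiver.Path A _, (Fin p.length → 𝕀),
        s = ⟨p, fun i => τ i.castSucc⟩ →
        (⟨s.1.cons f, (Fin.snoc (α := fun _ => 𝕀) s.2 (τ (Fin.last p.length)) :
          Fin (s.1.length + 1) → 𝕀)⟩ :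
          Σ p : Quiver.Path _ _, (Fin p.length → 𝕀)) = ⟨p.cons f, τ⟩ := by
      rintro _ rfl
      exact Sigma.ext rfl (heq_of_eq (Fin.snoc_init_self (α := fun _ => 𝕀) τ))
    exact e _ h

/-- Words are sequences of morphisms together with points of cubes. -/
def sigmaHomeomorph (A B : C) :
    (Σ p : Quiver.Path A B, (Fin p.length → 𝕀)) ≃ₜ TimedChain A B where
  toFun s := ofTimes s.1 s.2
  invFun := toSigma
  left_inv s := toSigma_ofTimes s.1 s.2
  right_inv := ofTimes_toSigma
  continuous_toFun := continuous_coinduced_rng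
  continuous_invFun := continuous_coinduced_dom.2 (continuous_id.congr fun s =>
    (toSigma_ofTimes s.1 s.2).symm)

theorem isOpenEmbedding_ofTimes {A B : C} (p : Quiver.Path A B) :
    IsOpenEmbedding (ofTimes p : (Fin p.length → 𝕀) → TimedChain A B) :=
  (sigmaHomeomorph A B).isOpenEmbedding.comp .sigmaMk

theorem continuous_cons {A B B' : C} (f : B ⟶ B') :
    Continuous fun z : 𝕀 × TimedChain A B => cons z.1 f z.2 := by
  let e : (Σ p : Quiver.Path A B, (Fin p.length → 𝕀) × 𝕀) → 𝕀 × TimedChain A B :=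
    fun s => (s.2.2, ofTimes s.1 s.2.1)
  have he : IsQuotientMap e := by
    have h := (((Homeomorph.sigmaProdDistrib (Y := 𝕀)
      (X := fun p : Quiver.Path A B => (Fin p.length → 𝕀))).symm.trans
      ((sigmaHomeomorph A B).prodCongr (.refl 𝕀))).trans (.prodComm _ _)).isQuotientMap
    exact h
  rw [he.continuous_iff]
  refine continuous_sigma fun p => ?_
  have h : Continuous fun z : (Fin p.length → 𝕀) × 𝕀 =>
      ofTimes (p.cons f) (Fin.snoc (α := fun _ => 𝕀) z.1 z.2) :=
    (isOpenEmbedding_ofTimes (p.cons f)).continuous.comp (by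
      refine continuous_pi fun i => ?_
      refine Fin.lastCases ?_ (fun j => ?_) i
      · simpa using continuous_snd
      · simpa [Function.comp_def] using (continuous_apply j).comp continuous_fst)
  refine h.congr fun z => ?_
  change cons _ _ (ofTimes _ _) = cons _ _ _
  congr 1
  · exact Fin.snoc_last (α := fun _ => 𝕀) _ _
  · congr 1
    funext i
    exact Fin.snoc_castSucc (α := fun _ => 𝕀) _ _ _

/-! ### Barycentric weights -/

/-- The object `Q` occurs in the word `c`. -/
def Hit (Q : C) {A : C} : {B : C} → TimedChain A B → Prop
  | _, nil => A = Q
  | _, cons (B' := B') _ _ c => B' = Q ∨ Hit Q c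

open Classical in
/-- The barycentric weight of the object `Q` in a word.  If the objects `A_0, …, A_n` of the word
`(t_n, f_n, …, t_1, f_1)` are different, the word is the point of an `n`-simplex whose barycentric
coordinate at `A_i` is `(1 - t_i) t_{i+1} ⋯ t_n`, where `t_0 = 0`. -/
noncomputable def weight (Q : C) {A : C} : {B : C} → TimedChain A B → ℝ
  | _, nil => if A = Q then 1 else 0
  | _, cons (B' := B') t _ c => t * weight Q c + (1 - t) * if B' = Q then 1 else 0

theorem weight_nonneg (Q : C) {A B : C} (c : TimedChain A B) : 0 ≤ weight Q c := by
  induction c with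
  | nil => unfold weight; split_ifs <;> norm_num
  | cons t f c ih =>
    have h0 := t.2.1
    have h1 := sub_nonneg.2 t.2.2
    unfold weight
    split_ifs <;> positivity

theorem Hit.of_weight_pos {Q A B : C} {c : TimedChain A B} (h : 0 < weight Q c) : Hit Q c := by
  induction c with
  | nil =>
    by_contra h'
    rw [weight, if_neg (show ¬A = Q from h')] at h
    exact lt_irrefl _ h
  | @cons B B' t f c ih =>
    by_cases h' : B' = Q
    · exact Or.inl h'
    · rw [weight, if_neg h', mul_zero, add_zero] at h
      exact Or.inr (ih (pos_of_mul_pos_right h t.2.1))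

theorem Hit.nonempty {Q A B : C} {c : TimedChain A B} (h : Hit Q c) : Nonempty (Q ⟶ B) := by
  induction c with
  | nil => exact ⟨eqToHom (show A = Q from h).symm⟩
  | cons t f c ih =>
    rcases h with h | h
    · exact ⟨eqToHom h.symm⟩
    · exact ⟨(ih h).some ≫ f⟩

theorem weight_append_congr {Q A A' E B : C} {c : TimedChain A E} {c' : TimedChain A' E}
    (h : weight Q c = weight Q c') (u : TimedChain E B) :
    weight Q (append c u) = weight Q (append c' u) := by
  induction u with
  | nil => exact h
  | cons t f u ih => simp only [append_cons, weight, ih]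

theorem weight_append_pos {Q A E B : C} {c : TimedChain A E} {u : TimedChain E B}
    (h : 0 < weight Q (append c u)) : 0 < weight Q c ∨ Nonempty (E ⟶ Q) := by
  induction u with
  | nil => exact Or.inl h
  | @cons B B' t f u ih =>
    by_cases h' : B' = Q
    · subst h'
      exact Or.inr ⟨(nonempty_hom u).some ≫ f⟩
    · rw [append_cons, weight, if_neg h', mul_zero, add_zero] at h
      exact ih (pos_of_mul_pos_right h t.2.1)

variable [IsAcyclicCategory C]

/-- If a word contains an intermediate object with parameter `1`, then this object has weight `0`
unless it is repeated. -/
theorem ne_of_weight_pos {Q A B E E' E'' : C} {u : TimedChain E'' B} {t : 𝕀} {h : E' ⟶ E''}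
    {g : E ⟶ E'} {c : TimedChain A E} (h₁ : E ≠ E') (h₂ : E' ≠ E'')
    (hQ : 0 < weight Q ((cons t h (cons 1 g c)).append u)) : E' ≠ Q := by
  rintro rfl
  rcases weight_append_pos hQ with h' | h'
  · rw [weight, weight, if_neg (Ne.symm h₂)] at h'
    simp only [Set.Icc.coe_one, one_mul, sub_self, zero_mul, add_zero, mul_zero] at h'
    exact h₁ (IsAcyclicCategory.antisymm ⟨g⟩ (Hit.of_weight_pos (pos_of_mul_pos_right h' t.2.1)).nonempty)
  · exact h₂ (IsAcyclicCategory.antisymm ⟨h⟩ h')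

end TimedChain

namespace HDiagram

open TimedChain

variable {C : Type w} [Category.{v} C] (D : HDiagram.{w, v, u} C)

/-! ### Cells and open stars of the homotopy colimit -/

/-- The point `[c; x]` of the homotopy colimit. -/
def cls {A B : C} (c : TimedChain A B) (x : D.obj A) : D.Hocolim := Quot.mk _ (D.pt c x)

theorem continuous_cls (A B : C) : Continuous fun z : TimedChain A B × D.obj A => D.cls z.1 z.2 :=
  continuous_quot_mk.comp (D.continuous_pt A B)

/-- The inclusion of a vertex space in the homotopy colimit. -/
def inc (A : C) : C(D.obj A, D.Hocolim) :=
  ⟨fun x => D.cls nil x, (D.continuous_cls A A).comp (continuous_const.prodMk continuous_id)⟩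

@[simp] theorem inc_apply (A : C) (x : D.obj A) : D.inc A x = D.cls nil x := rfl

/-- The homotopy colimit is a quotient of the disjoint union of the cells, indexed by the
sequences of composable morphisms. -/
theorem isQuotientMap_cells : IsQuotientMap
    (fun z : Σ i : (Σ A : C, Σ B : C, Quiver.Path A B), (Fin i.2.2.length → 𝕀) × D.obj i.1 =>
      D.cls (ofTimes z.1.2.2 z.2.1) z.2.2) := by
  refine isQuotientMap_quot_mk.comp (g := Quot.mk D.Rel) (f := fun z :
    Σ i : (Σ A : C, Σ B : C, Quiver.Path A B), (Fin i.2.2.length → 𝕀) × D.obj i.1 =>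
      (D.pt (ofTimes z.1.2.2 z.2.1) z.2.2 : D.PreHocolim)) (IsOpenMap.isQuotientMap ?_ ?_ ?_)
  · refine isOpenMap_sigma.2 fun i => ?_
    exact (isOpenMap_sigmaMk (σ := fun A : C => Σ B : C, TimedChain A B × D.obj A)).comp
      ((isOpenMap_sigmaMk (σ := fun B : C => TimedChain i.1 B × D.obj i.1)).comp
        ((isOpenEmbedding_ofTimes i.2.2).isOpenMap.prodMap IsOpenMap.id))
  · refine continuous_sigma fun i => ?_
    exact (D.continuous_pt i.1 i.2.1).comp
      ((isOpenEmbedding_ofTimes i.2.2).continuous.prodMap continuous_id)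
  · rintro ⟨A, B, c, x⟩
    exact ⟨⟨⟨A, B, c.toSigma.1⟩, c.toSigma.2, x⟩, by simp only [ofTimes_toSigma]⟩

/-- Continuity of a map defined on an open subset of the homotopy colimit, with a parameter in a
locally compact space, can be checked on the cells. -/
theorem continuous_of_cells {U : Set D.Hocolim} (hU : IsOpen U) {Y T : Type*} [TopologicalSpace Y]
    [LocallyCompactSpace Y] [TopologicalSpace T] {g : U × Y → T}
    (h : ∀ {A B : C} (p : Quiver.Path A B),
      Continuous fun w : {w : (Fin p.length → 𝕀) × D.obj A // D.cls (ofTimes p w.1) w.2 ∈ U} × Y =>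
        g (⟨_, w.1.2⟩, w.2)) : Continuous g := by
  let S : (Σ A : C, Σ B : C, Quiver.Path A B) → Type _ := fun i =>
    {w : (Fin i.2.2.length → 𝕀) × D.obj i.1 // D.cls (ofTimes i.2.2 w.1) w.2 ∈ U}
  have hS : ∀ i : (Σ A : C, Σ B : C, Quiver.Path A B), IsOpen
      {w : (Fin i.2.2.length → 𝕀) × D.obj i.1 | D.cls (ofTimes i.2.2 w.1) w.2 ∈ U} := fun i =>
    hU.preimage ((D.continuous_cls i.1 i.2.1).comp
      ((isOpenEmbedding_ofTimes i.2.2).continuous.prodMap continuous_id))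
  let j : (Σ i, S i) → (fun z : Σ i : (Σ A : C, Σ B : C, Quiver.Path A B),
      (Fin i.2.2.length → 𝕀) × D.obj i.1 => D.cls (ofTimes z.1.2.2 z.2.1) z.2.2) ⁻¹' U :=
    fun z => ⟨⟨z.1, z.2.1⟩, z.2.2⟩
  have hj : IsQuotientMap j := by
    refine IsOpenMap.isQuotientMap ?_ ?_ ?_
    · refine isOpenMap_sigma.2 fun i O hO => ?_
      have h1 := (isOpenMap_sigmaMk (σ := fun i : (Σ A : C, Σ B : C, Quiver.Path A B) =>
        (Fin i.2.2.length → 𝕀) × D.obj i.1) (i := i)) _ ((hS i).isOpenMap_subtype_val O hO)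
      refine ⟨_, h1, ?_⟩
      ext z
      constructor
      · rintro ⟨_, ⟨w, hw, rfl⟩, hz⟩
        exact ⟨w, hw, Subtype.ext hz⟩
      · rintro ⟨w, hw, rfl⟩
        exact ⟨_, ⟨w, hw, rfl⟩, rfl⟩
    · refine continuous_sigma fun i => Continuous.subtype_mk ?_ _
      exact (continuous_sigmaMk (σ := fun i : (Σ A : C, Σ B : C, Quiver.Path A B) =>
        (Fin i.2.2.length → 𝕀) × D.obj i.1)).comp continuous_subtype_val
    · rintro ⟨⟨i, w⟩, hz⟩
      exact ⟨⟨i, w, hz⟩, rfl⟩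
  refine ((D.isQuotientMap_cells.restrictPreimage_isOpen hU).comp hj).continuous_lift_prod_left ?_
  refine (Homeomorph.sigmaProdDistrib (Y := Y) (X := S)).symm.comp_continuous_iff'.1 ?_
  exact continuous_sigma fun i => h i.2.2

end HDiagram

namespace HDiagram

open TimedChain

variable {C : Type w} [Category.{v} C] (D : HDiagram.{w, v, u} C)

/-! ### The open star of a vertex space and its retraction -/

theorem weight_eq_of_rel (Q : C) {a b : D.PreHocolim} (h : D.Rel a b) :
    a.2.2.1.weight Q = b.2.2.1.weight Q := by
  cases h with
  | first_id u t x =>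
    refine (weight_append_congr (c' := nil) ?_ u).trans (by rw [nil_append])
    simp only [weight]
    ring
  | middle_id u t s g c x =>
    refine weight_append_congr ?_ u
    simp only [weight, Set.Icc.coe_mul]
    ring
  | one u t h g c x =>
    refine weight_append_congr ?_ u
    simp [weight]
  | last_one g c x => simp [weight]
  | zero u g c x =>
    refine (weight_append_congr (c' := nil) ?_ u).trans (by rw [nil_append])
    simp [weight]

/-- The barycentric weight of an object at a point of the homotopy colimit. -/
noncomputable def hweight (Q : C) : D.Hocolim → ℝ :=
  Quot.lift (fun z => z.2.2.1.weight Q) fun _ _ h => D.weight_eq_of_rel Q h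

theorem continuous_hweight (Q : C) : Continuous (D.hweight Q) := by
  refine continuous_quot_lift _ (continuous_sigma fun A => continuous_sigma fun B => ?_)
  refine Continuous.comp (g := fun c : TimedChain A B => c.weight Q) ?_ continuous_fst
  refine continuous_coinduced_dom.2 (continuous_sigma fun p => ?_)
  change Continuous fun τ => weight Q (ofTimes p τ)
  induction p with
  | nil => exact continuous_const
  | cons p f ih =>
    have h1 : Continuous fun τ : Fin (p.cons f).length → 𝕀 => ((τ (Fin.last p.length) : 𝕀) : ℝ) :=
      continuous_subtype_val.comp (continuous_apply _)
    have h2 : Continuous fun τ : Fin (p.cons f).length → 𝕀 =>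
        weight Q (ofTimes p fun i => τ i.castSucc) :=
      ih.comp (continuous_pi fun i => continuous_apply _)
    exact (h1.mul h2).add ((continuous_const.sub h1).mul continuous_const)

/-- The open star of the vertex space of `Q` in the homotopy colimit. -/
def star (Q : C) : Set D.Hocolim := {z | 0 < D.hweight Q z}

theorem isOpen_star (Q : C) : IsOpen (D.star Q) :=
  isOpen_lt continuous_const (D.continuous_hweight Q)

theorem cls_mem_star {Q A B : C} {c : TimedChain A B} {x : D.obj A} :
    D.cls c x ∈ D.star Q ↔ 0 < c.weight Q := Iff.rfl

theorem inc_mem_star (Q : C) (x : D.obj Q) : D.inc Q x ∈ D.star Q := by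
  rw [inc_apply, cls_mem_star, weight, if_pos rfl]
  exact one_pos

theorem exists_mem_star (z : D.Hocolim) : ∃ Q, z ∈ D.star Q := by
  obtain ⟨⟨A, B, c, x⟩, rfl⟩ := Quot.exists_rep z
  change ∃ Q, 0 < c.weight Q
  induction c with
  | nil => exact ⟨A, by rw [weight, if_pos rfl]; exact one_pos⟩
  | @cons B B' t f c ih =>
    rcases eq_or_lt_of_le t.2.1 with h | h
    · refine ⟨B', ?_⟩
      rw [weight, if_pos rfl, ← h]
      norm_num
    · obtain ⟨Q, hQ⟩ := ih
      refine ⟨Q, ?_⟩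
      rw [weight]
      have := sub_nonneg.2 t.2.2
      split_ifs <;> positivity

/-- A function on the representatives of the points of a subset `U` of the homotopy colimit, which
is invariant under the generating identifications, defines a function on `U`. -/
theorem exists_descend (U : Set D.Hocolim) {T : Type*}
    (F : ∀ z : D.PreHocolim, D.cls z.2.2.1 z.2.2.2 ∈ U → T)
    (hF : ∀ a b, D.Rel a b → ∀ ha hb, F a ha = F b hb) :
    ∃ g : U → T, ∀ {A B : C} (c : TimedChain A B) (x : D.obj A) (h : D.cls c x ∈ U),
      g ⟨D.cls c x, h⟩ = F ⟨A, B, c, x⟩ h := by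
  have key : ∀ a b, Relation.EqvGen D.Rel a b → ∀ ha hb, F a ha = F b hb := by
    intro a b h
    induction h with
    | rel a b h => exact hF a b h
    | refl a => intros; rfl
    | symm a b _ ih => exact fun ha hb => (ih hb ha).symm
    | trans a b c h1 _ ih1 ih2 =>
      intro ha hc
      have hb : D.cls b.2.2.1 b.2.2.2 ∈ U := by
        have e : D.cls a.2.2.1 a.2.2.2 = D.cls b.2.2.1 b.2.2.2 := Quot.eqvGen_sound h1
        rwa [← e]
      exact (ih1 ha hb).trans (ih2 hb hc)
  have hrep : ∀ z : U, ∃ a : D.PreHocolim, D.cls a.2.2.1 a.2.2.2 = z := fun z =>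
    Quot.exists_rep z.1
  choose r hr using hrep
  refine ⟨fun z => F (r z) (by rw [hr]; exact z.2), fun {A B} c x h => ?_⟩
  exact key _ _ (Quot.eqvGen_exact (hr ⟨_, h⟩)) _ _

open Classical in
/-- The value of a word `(t_n, f_n, …, t_1, f_1; x)` at the last occurrence of the object `R`:
`D(f_i, t_{i-1}, …, t_1, f_1; x)` if `R` is the target of `f_i`. -/
noncomputable def eval (R : C) {A : C} (x : D.obj A) :
    {B : C} → (c : TimedChain A B) → c.Hit R → D.obj R
  | _, nil, h => (show A = R from h) ▸ x
  | _, cons (B' := B') _ f c, h =>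
    if e : B' = R then e ▸ D.act f c x else eval R x c (h.resolve_left e)

theorem eval_cons_self {A B R : C} (x : D.obj A) (t : 𝕀) (f : B ⟶ R) (c : TimedChain A B)
    (h : (cons t f c).Hit R) : D.eval R x (cons t f c) h = D.act f c x := by
  rw [eval, dif_pos rfl]

theorem eval_cons_of_ne {A B B' R : C} (x : D.obj A) (t : 𝕀) (f : B ⟶ B') (c : TimedChain A B)
    (h : (cons t f c).Hit R) (e : B' ≠ R) :
    D.eval R x (cons t f c) h = D.eval R x c (h.resolve_left e) := by
  rw [eval, dif_neg e]

theorem eval_eq_act {A R : C} (x : D.obj A) (c : TimedChain A R) (h : c.Hit R) :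
    D.eval R x c h = D.act (𝟙 R) c x := by
  cases c with
  | nil => exact (D.act_id x).symm
  | cons t f c => rw [eval_cons_self, act_last_id]

theorem eval_append_congr {R A A' E B : C} {x : D.obj A} {x' : D.obj A'} {c : TimedChain A E}
    {c' : TimedChain A' E}
    (hact : ∀ {B B' : C} (f : B ⟶ B') (u : TimedChain E B),
      D.act f (append c u) x = D.act f (append c' u) x')
    (h0 : ∀ h h', D.eval R x c h = D.eval R x' c' h') (u : TimedChain E B) (h h') :
    D.eval R x (append c u) h = D.eval R x' (append c' u) h' := by
  induction u with
  | nil => exact h0 h h'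
  | @cons B B' t f u ih =>
    by_cases e : B' = R
    · subst e
      exact (D.eval_cons_self x t f _ h).trans
        ((hact f u).trans (D.eval_cons_self x' t f _ h').symm)
    · exact (D.eval_cons_of_ne x t f _ h e).trans
        ((ih _ _).trans (D.eval_cons_of_ne x' t f _ h' e).symm)

theorem continuous_eval_ofTimes (R : C) {A B : C} (p : Quiver.Path A B) {Y : Type*}
    [TopologicalSpace Y] (τ : Y → (Fin p.length → 𝕀)) (x : Y → D.obj A) (hτ : Continuous τ)
    (hx : Continuous x) (h : ∀ y, (ofTimes p (τ y)).Hit R) :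
    Continuous fun y => D.eval R (x y) (ofTimes p (τ y)) (h y) := by
  induction p with
  | nil =>
    rcases isEmpty_or_nonempty Y with hY | ⟨⟨y⟩⟩
    · exact continuous_of_const fun y => hY.elim y
    · obtain rfl : A = R := h y
      exact hx
  | @cons B B' p f ih =>
    have hτ' : Continuous fun y => (fun i : Fin p.length => τ y i.castSucc) :=
      continuous_pi fun i => (continuous_apply _).comp hτ
    by_cases e : B' = R
    · subst e
      refine ((D.continuous_act f).comp
        (((isOpenEmbedding_ofTimes p).continuous.comp hτ').prodMk hx)).congr fun y => ?_
      exact (D.eval_cons_self _ _ _ _ (h y)).symm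
    · refine (ih _ hτ' fun y => (h y).resolve_left e).congr fun y => ?_
      exact (D.eval_cons_of_ne _ _ _ _ (h y) e).symm

variable [IsAcyclicCategory C]

/-- The value at `R` of a word in which `R` occurs is invariant under the identifications.  The choice
of the occurrence does not matter, since by acyclicity two occurrences of `R` are separated by
identities only. -/
theorem eval_eq_of_rel (R : C) {a b : D.PreHocolim} (h : D.Rel a b) (ha hb) :
    D.eval R a.2.2.2 a.2.2.1 ha = D.eval R b.2.2.2 b.2.2.1 hb := by
  cases h with
  | first_id u t x =>
    have := D.eval_append_congr (R := R) (x := x) (x' := x) (c := cons t (𝟙 _) nil) (c' := nil)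
      (fun f u => by rw [nil_append, D.act_first_id]) (fun h h' => ?_) u ha
      (by rw [nil_append]; exact hb)
    · refine this.trans ?_
      congr 1
      exact nil_append u
    · obtain rfl : _ = R := h'
      rw [eval_cons_self, D.act_id]
      rfl
  | @middle_id A B E E' u t s g c x =>
    refine D.eval_append_congr (fun f u => D.act_middle_id f u t s g c x) (fun h h' => ?_) u ha hb
    by_cases e : E' = R
    · subst e
      rw [eval_cons_self, eval_cons_self, D.act_last_id]
    · rw [eval_cons_of_ne _ _ _ _ _ _ e, eval_cons_of_ne _ _ _ _ _ _ e,
        eval_cons_of_ne _ _ _ _ _ _ e]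
  | @one A B E E' E'' u t h g c x =>
    refine D.eval_append_congr (fun f u => D.act_one f u t h g c x) (fun h h' => ?_) u ha hb
    by_cases e : E'' = R
    · subst e
      rw [eval_cons_self, eval_cons_self, D.act_last_one]
    · rw [eval_cons_of_ne _ _ _ _ _ _ e, eval_cons_of_ne _ _ _ _ _ _ e]
      by_cases e' : E' = R
      · subst e'
        obtain rfl := IsAcyclicCategory.antisymm ⟨g⟩ (h'.resolve_left e).nonempty
        rw [eval_cons_self, eval_eq_act, IsAcyclicCategory.eq_id g]
      · rw [eval_cons_of_ne _ _ _ _ _ _ e']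
  | @last_one A B E g c x =>
    by_cases e : B = R
    · subst e
      obtain rfl := IsAcyclicCategory.antisymm ⟨g⟩ (Hit.nonempty hb)
      dsimp only
      rw [eval_cons_self, eval_eq_act, IsAcyclicCategory.eq_id g]
    · exact D.eval_cons_of_ne _ _ _ _ _ e
  | @zero A B E E' u g c x =>
    have := D.eval_append_congr (R := R) (x := x) (x' := D.act g c x) (c := cons 0 g c) (c' := nil)
      (fun f u => by rw [nil_append, D.act_zero]) (fun h h' => ?_) u ha
      (by rw [nil_append]; exact hb)
    · refine this.trans ?_
      congr 1
      exact nil_append u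
    · obtain rfl : E' = R := h'
      rw [eval_cons_self]
      rfl

theorem exists_retract (R : C) : ∃ g : D.star R → D.obj R,
    ∀ {A B : C} (c : TimedChain A B) (x : D.obj A) (h : D.cls c x ∈ D.star R),
      g ⟨D.cls c x, h⟩ = D.eval R x c (Hit.of_weight_pos h) :=
  D.exists_descend (D.star R) (fun z h => D.eval R z.2.2.2 z.2.2.1 (Hit.of_weight_pos h))
    fun _ _ h _ _ => D.eval_eq_of_rel R h _ _

/-- The retraction of the open star of `R` to the vertex space of `R`. -/
noncomputable def retract (R : C) : C(D.star R, D.obj R) where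
  toFun := (D.exists_retract R).choose
  continuous_toFun := by
    have h := D.continuous_of_cells (D.isOpen_star R) (Y := Unit)
      (g := fun z => (D.exists_retract R).choose z.1) fun {A B} p => by
        refine (D.continuous_eval_ofTimes R p
          (Y := {w : (Fin p.length → 𝕀) × D.obj A // D.cls (ofTimes p w.1) w.2 ∈ D.star R} × Unit)
          (fun w => w.1.1.1) (fun w => w.1.1.2) (by fun_prop) (by fun_prop)
          fun w => Hit.of_weight_pos w.1.2).congr fun w => ?_
        exact ((D.exists_retract R).choose_spec _ _ _).symm
    exact h.comp (continuous_id.prodMk continuous_const : Continuous fun z => (z, ()))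

theorem retract_cls (R : C) {A B : C} (c : TimedChain A B) (x : D.obj A)
    (h : D.cls c x ∈ D.star R) :
    D.retract R ⟨D.cls c x, h⟩ = D.eval R x c (Hit.of_weight_pos h) :=
  (D.exists_retract R).choose_spec c x h

end HDiagram

namespace TimedChain

variable {C : Type w} [Category.{v} C]

/-! ### The morphism between two vertices of a simplex -/

open Classical in
/-- The composite of the morphisms of a word that follow the first occurrence of `Q`, if
there is one. -/
noncomputable def leg (Q : C) {A : C} : {B : C} → TimedChain A B → Option (Q ⟶ B)
  | _, nil => if h : A = Q then some (eqToHom h.symm) else none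
  | _, cons (B' := B') _ f c =>
    match leg Q c with
    | some g => some (g ≫ f)
    | none => if h : B' = Q then some (eqToHom h.symm) else none

open Classical in
/-- The composite of the morphisms of a word between the first occurrence of `Q` and the last
occurrence of `R`, for `Q ≠ R`. -/
noncomputable def between (Q R : C) {A : C} : {B : C} → TimedChain A B → Option (Q ⟶ R)
  | _, nil => none
  | _, cons (B' := B') _ f c =>
    if e : B' = R then (leg Q c).map fun g => g ≫ f ≫ eqToHom e else between Q R c

theorem leg_cons_of_some {Q A B B' : C} {t : 𝕀} {f : B ⟶ B'} {c : TimedChain A B} {g : Q ⟶ B}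
    (h : leg Q c = some g) : leg Q (cons t f c) = some (g ≫ f) := by
  rw [leg, h]

theorem leg_cons_of_none {Q A B B' : C} {t : 𝕀} {f : B ⟶ B'} {c : TimedChain A B}
    (h : leg Q c = none) (h' : B' ≠ Q) : leg Q (cons t f c) = none := by
  rw [leg, h]
  exact dif_neg h'

theorem leg_cons_of_ne {Q A B B' : C} {t : 𝕀} {f : B ⟶ B'} {c : TimedChain A B}
    (h' : B' ≠ Q) : leg Q (cons t f c) = (leg Q c).map fun g => g ≫ f := by
  rcases h : leg Q c with _ | g
  · exact leg_cons_of_none h h'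
  · exact leg_cons_of_some h

theorem leg_self_ne_none {A Q : C} (c : TimedChain A Q) : leg Q c ≠ none := by
  cases c with
  | nil => rw [leg, dif_pos rfl]; exact Option.some_ne_none _
  | cons t f c =>
    rcases h : leg Q c with _ | g
    · simp [leg, h]
    · rw [leg_cons_of_some h]
      exact Option.some_ne_none _

theorem between_cons_of_ne {Q R A B B' : C} {t : 𝕀} {f : B ⟶ B'} {c : TimedChain A B}
    (h : B' ≠ R) : between Q R (cons t f c) = between Q R c := by
  rw [between, dif_neg h]

theorem between_cons_self {Q R A B : C} {t : 𝕀} {f : B ⟶ R} {c : TimedChain A B} :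
    between Q R (cons t f c) = (leg Q c).map fun g => g ≫ f := by
  rw [between, dif_pos rfl]
  simp

theorem leg_append_congr {Q A A' E B : C} {c : TimedChain A E} {c' : TimedChain A' E}
    (h : leg Q c = leg Q c') (u : TimedChain E B) :
    leg Q (append c u) = leg Q (append c' u) := by
  induction u with
  | nil => exact h
  | cons t f u ih => simp only [append_cons, leg, ih]

theorem between_append_congr {Q R A A' E B : C} {c : TimedChain A E} {c' : TimedChain A' E}
    (h : leg Q c = leg Q c') (h' : between Q R c = between Q R c') (u : TimedChain E B) :
    between Q R (append c u) = between Q R (append c' u) := by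
  induction u with
  | nil => exact h'
  | cons t f u ih => simp only [append_cons, between, ih, leg_append_congr h]

theorem leg_cons_id {Q A B : C} (t : 𝕀) (c : TimedChain A B) :
    leg Q (cons t (𝟙 B) c) = leg Q c := by
  rcases h : leg Q c with _ | g
  · refine leg_cons_of_none h ?_
    rintro rfl
    exact leg_self_ne_none c h
  · rw [leg_cons_of_some h, Category.comp_id]

theorem between_cons_id {Q R A B : C} (hQR : Q ≠ R) (t : 𝕀) (c : TimedChain A B) :
    between Q R (cons t (𝟙 B) c) = between Q R c := by
  by_cases e : B = R
  · subst e
    rw [between_cons_self]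
    simp only [Category.comp_id, Option.map_id_fun', id]
    cases c with
    | nil => rw [between, leg, dif_neg (Ne.symm hQR)]
    | cons s f c => rw [between_cons_self, leg_cons_of_ne (Ne.symm hQR)]
  · exact between_cons_of_ne e

theorem Hit.leg_ne_none {Q A B : C} {c : TimedChain A B} (h : Hit Q c) : leg Q c ≠ none := by
  induction c with
  | nil =>
    obtain rfl : A = Q := h
    exact leg_self_ne_none nil
  | @cons B B' t f c ih =>
    by_cases e : B' = Q
    · subst e
      exact leg_self_ne_none _
    · rw [leg_cons_of_ne e]
      simpa using ih (h.resolve_left e)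

theorem hit_of_leg {Q A B : C} {c : TimedChain A B} {g : Q ⟶ B} (h : leg Q c = some g) :
    Hit Q c := by
  induction c with
  | nil =>
    by_contra h'
    rw [leg, dif_neg (show ¬A = Q from h')] at h
    exact Option.some_ne_none _ h.symm
  | @cons B B' t f c ih =>
    by_cases e : B' = Q
    · exact Or.inl e
    · rw [leg_cons_of_ne e] at h
      obtain ⟨g, hg, -⟩ := Option.map_eq_some_iff.1 h
      exact Or.inr (ih hg)

theorem hit_of_between {Q R A B : C} {c : TimedChain A B} {g : Q ⟶ R}
    (h : between Q R c = some g) : Hit R c := by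
  induction c with
  | nil => exact (Option.some_ne_none _ h.symm).elim
  | @cons B B' t f c ih =>
    by_cases e : B' = R
    · exact Or.inl e
    · rw [between_cons_of_ne e] at h
      exact Or.inr (ih h)

/-- Two objects occurring in the same word are comparable. -/
theorem Hit.comparable {Q R A B : C} {c : TimedChain A B} (hQ : Hit Q c) (hR : Hit R c) :
    Nonempty (Q ⟶ R) ∨ Nonempty (R ⟶ Q) := by
  induction c with
  | nil => exact Or.inl ⟨eqToHom ((show A = Q from hQ).symm.trans hR)⟩
  | @cons B B' t f c ih =>
    by_cases eQ : B' = Q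
    · subst eQ
      exact Or.inr (Hit.nonempty hR)
    · by_cases eR : B' = R
      · subst eR
        exact Or.inl (Hit.nonempty hQ)
      · exact ih (hQ.resolve_left eQ) (hR.resolve_left eR)

theorem leg_ofTimes (Q : C) {A B : C} (p : Quiver.Path A B) (τ τ' : Fin p.length → 𝕀) :
    leg Q (ofTimes p τ) = leg Q (ofTimes p τ') := by
  induction p with
  | nil => rfl
  | cons p f ih =>
    change leg Q (cons _ _ _) = leg Q (cons _ _ _)
    simp only [leg, ih _ fun i => τ' i.castSucc]

theorem between_ofTimes (Q R : C) {A B : C} (p : Quiver.Path A B) (τ τ' : Fin p.length → 𝕀) :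
    between Q R (ofTimes p τ) = between Q R (ofTimes p τ') := by
  induction p with
  | nil => rfl
  | cons p f ih =>
    change between Q R (cons _ _ _) = between Q R (cons _ _ _)
    simp only [between, ih _ fun i => τ' i.castSucc, leg_ofTimes Q p _ fun i => τ' i.castSucc]

variable [IsAcyclicCategory C]

/-- If `Q` and `R` both occur in a word and there is a morphism from `Q` to `R`, then
`Q` occurs before `R`. -/
theorem between_ne_none {Q R A B : C} (hQR : Q ≠ R) (hom : Nonempty (Q ⟶ R)) {c : TimedChain A B}
    (hQ : Hit Q c) (hR : Hit R c) : between Q R c ≠ none := by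
  induction c with
  | nil => exact (hQR ((show A = Q from hQ).symm.trans hR)).elim
  | @cons B B' t f c ih =>
    by_cases e : B' = R
    · subst e
      rw [between_cons_self]
      simpa using (hQ.resolve_left (Ne.symm hQR)).leg_ne_none
    · rw [between_cons_of_ne e]
      refine ih (hQ.resolve_left ?_) (hR.resolve_left e)
      rintro rfl
      exact hQR (IsAcyclicCategory.antisymm hom ⟨(hR.resolve_left e).nonempty.some ≫ f⟩)

end TimedChain

namespace HDiagram

open TimedChain

variable {C : Type w} [Category.{v} C] (D : HDiagram.{w, v, u} C) [IsAcyclicCategory C]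

/-- The composite of the morphisms from `Q` to `R` is invariant under the identifications of words in
which `Q` and `R` have positive weight, because these identifications remove only identities and
objects of weight zero. -/
theorem between_eq_of_rel {Q R : C} (hQR : Q ≠ R) (hom : Nonempty (Q ⟶ R)) {a b : D.PreHocolim}
    (h : D.Rel a b) (hQ : 0 < weight Q a.2.2.1) (hR : 0 < weight R a.2.2.1) :
    between Q R a.2.2.1 = between Q R b.2.2.1 := by
  cases h with
  | first_id u t x =>
    refine (between_append_congr (c' := nil) (leg_cons_id t nil) (between_cons_id hQR t nil)
      u).trans (by rw [nil_append])
  | middle_id u t s g c x =>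
    exact between_append_congr (c := cons t (𝟙 _) (cons s g c)) (c' := cons (t * s) g c)
      (leg_cons_id t (cons s g c)) (between_cons_id hQR t (cons s g c)) u
  | @one A B E E' E'' u t h g c x =>
    by_cases e1 : E = E'
    · subst e1
      obtain rfl := IsAcyclicCategory.eq_id g
      rw [Category.id_comp]
      refine between_append_congr ?_ ?_ u
      · exact leg_append_congr (leg_cons_id 1 c) (cons t h nil)
      · exact between_append_congr (leg_cons_id 1 c) (between_cons_id hQR 1 c) (cons t h nil)
    by_cases e2 : E' = E''
    · subst e2
      obtain rfl := IsAcyclicCategory.eq_id h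
      rw [Category.comp_id]
      exact between_append_congr (c := cons t (𝟙 _) (cons 1 g c)) (c' := cons t g c)
        (leg_cons_id t (cons 1 g c)) (between_cons_id hQR t (cons 1 g c)) u
    have hQ' := ne_of_weight_pos e1 e2 hQ
    have hR' := ne_of_weight_pos e1 e2 hR
    have e3 : leg Q (cons 1 g c) = (leg Q c).map fun k => k ≫ g := leg_cons_of_ne hQ'
    refine between_append_congr ?_ ?_ u
    · rcases h0 : leg Q c with _ | k
      · rw [h0] at e3
        by_cases e4 : E'' = Q
        · subst e4
          simp [leg, h0, hQ']
        · rw [leg_cons_of_none e3 e4, leg_cons_of_none h0 e4]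
      · rw [h0] at e3
        rw [leg_cons_of_some e3, leg_cons_of_some h0, Category.assoc]
    · by_cases e : E'' = R
      · subst e
        rw [between_cons_self, between_cons_self, e3, Option.map_map]
        congr 1
        funext k
        simp
      · rw [between_cons_of_ne e, between_cons_of_ne e, between_cons_of_ne hR']
  | @last_one A B E g c x =>
    by_cases e : E = B
    · subst e
      obtain rfl := IsAcyclicCategory.eq_id g
      exact between_cons_id hQR 1 c
    · refine between_cons_of_ne ?_
      rintro rfl
      simp only [weight, Set.Icc.coe_one, one_mul, sub_self, zero_mul, add_zero] at hR
      exact e (IsAcyclicCategory.antisymm ⟨g⟩ (Hit.of_weight_pos hR).nonempty)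
  | @zero A B E E' u g c x =>
    refine (between_append_congr (c' := nil) ?_ ?_ u).trans (by rw [nil_append])
    all_goals
      have hQ' : Nonempty (E' ⟶ Q) := by
        rcases weight_append_pos hQ with h | h
        · simp only [weight, Set.Icc.coe_zero, zero_mul, sub_zero, one_mul, zero_add] at h
          split_ifs at h with h'
          · exact ⟨eqToHom h'⟩
          · exact (lt_irrefl _ h).elim
        · exact h
      have hR' : Nonempty (E' ⟶ R) := by
        rcases weight_append_pos hR with h | h
        · simp only [weight, Set.Icc.coe_zero, zero_mul, sub_zero, one_mul, zero_add] at h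
          split_ifs at h with h'
          · exact ⟨eqToHom h'⟩
          · exact (lt_irrefl _ h).elim
        · exact h
      have key : ∀ k : Q ⟶ E', E' = Q := fun k => IsAcyclicCategory.antisymm hQ' ⟨k⟩
    · rcases h : leg Q (cons 0 g c) with _ | k
      · rw [leg, dif_neg]
        rintro rfl
        exact leg_self_ne_none _ h
      · obtain rfl := key k
        rw [leg, dif_pos rfl, IsAcyclicCategory.eq_id k]
        rfl
    · rcases h : between Q R (cons 0 g c) with _ | k
      · rfl
      · obtain rfl : R = E' := IsAcyclicCategory.antisymm (hit_of_between h).nonempty hR'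
        exact (hQR (key k).symm).elim

theorem exists_arrow {Q R : C} (hQR : Q ≠ R) (hom : Nonempty (Q ⟶ R)) :
    ∃ g : (D.star Q ∩ D.star R : Set D.Hocolim) → (Q ⟶ R),
      ∀ {A B : C} (c : TimedChain A B) (x : D.obj A) (h : D.cls c x ∈ D.star Q ∩ D.star R),
        between Q R c = some (g ⟨D.cls c x, h⟩) := by
  obtain ⟨g, hg⟩ := D.exists_descend (D.star Q ∩ D.star R) (fun z _ => between Q R z.2.2.1)
    fun _ _ h ha _ => D.between_eq_of_rel hQR hom h ha.1 ha.2
  have hs : ∀ z, ∃ k, g z = some k := by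
    rintro ⟨z, hz⟩
    obtain ⟨⟨A, B, c, x⟩, rfl⟩ := Quot.exists_rep z
    refine Option.ne_none_iff_exists'.1 ?_
    rw [show g ⟨Quot.mk _ _, hz⟩ = _ from hg c x hz]
    exact between_ne_none hQR hom (Hit.of_weight_pos hz.1) (Hit.of_weight_pos hz.2)
  choose k hk using hs
  exact ⟨k, fun c x h => (hg c x h).symm.trans (hk _)⟩

/-- The morphism from `Q` to `R` that is part of the simplex of a point of the intersection of the
open stars of `Q` and `R`. -/
noncomputable def arrow {Q R : C} (hQR : Q ≠ R) (hom : Nonempty (Q ⟶ R)) :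
    (D.star Q ∩ D.star R : Set D.Hocolim) → (Q ⟶ R) := (D.exists_arrow hQR hom).choose

theorem between_eq_arrow {Q R : C} (hQR : Q ≠ R) (hom : Nonempty (Q ⟶ R)) {A B : C}
    (c : TimedChain A B) (x : D.obj A) (h : D.cls c x ∈ D.star Q ∩ D.star R) :
    between Q R c = some (D.arrow hQR hom ⟨D.cls c x, h⟩) :=
  (D.exists_arrow hQR hom).choose_spec c x h

/-- The morphism from `Q` to `R` is constant along paths. -/
theorem arrow_path {Q R : C} (hQR : Q ≠ R) (hom : Nonempty (Q ⟶ R))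
    {a b : (D.star Q ∩ D.star R : Set D.Hocolim)} (p : Path a b) (s : 𝕀) :
    D.arrow hQR hom (p s) = D.arrow hQR hom a := by
  let _ : TopologicalSpace (Q ⟶ R) := ⊥
  have _ : DiscreteTopology (Q ⟶ R) := ⟨rfl⟩
  have h := D.continuous_of_cells ((D.isOpen_star Q).inter (D.isOpen_star R)) (Y := Unit)
    (g := fun z => D.arrow hQR hom z.1) fun {A B} p => by
      refine continuous_of_const fun y y' => Option.some_injective _ ?_
      rw [← between_eq_arrow, ← between_eq_arrow]
      exact between_ofTimes Q R p _ _
  have h' : Continuous fun s => D.arrow hQR hom (p s) :=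
    h.comp (p.continuous.prodMk continuous_const : Continuous fun s => (p s, ()))
  have e := (IsPreconnected.constant (isPreconnected_univ (α := 𝕀)) h'.continuousOn
    (Set.mem_univ s) (Set.mem_univ 0))
  simpa using e

end HDiagram

/-! ### Sliding towards a vertex space -/

/-- The power `t ^ s` of two numbers in the unit interval. -/
noncomputable def unitInterval.pow (t s : 𝕀) : 𝕀 :=
  ⟨(t : ℝ) ^ (s : ℝ), Real.rpow_nonneg t.2.1 _, Real.rpow_le_one t.2.1 t.2.2 s.2.1⟩

namespace unitInterval

@[simp] theorem pow_zero' (t : 𝕀) : pow t 0 = 1 := Subtype.ext (Real.rpow_zero _)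

@[simp] theorem pow_one' (t : 𝕀) : pow t 1 = t := Subtype.ext (Real.rpow_one _)

@[simp] theorem one_pow' (s : 𝕀) : pow 1 s = 1 := Subtype.ext (Real.one_rpow _)

theorem mul_pow' (t t' s : 𝕀) : pow (t * t') s = pow t s * pow t' s :=
  Subtype.ext (Real.mul_rpow t.2.1 t'.2.1)

theorem pow_pos' {t : 𝕀} (ht : 0 < t) (s : 𝕀) : 0 < pow t s :=
  Subtype.coe_lt_coe.1 (Real.rpow_pos_of_pos (Subtype.coe_lt_coe.2 ht) _)

theorem continuous_pow {Y : Type*} [TopologicalSpace Y] {t s : Y → 𝕀} (ht : Continuous t)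
    (hs : Continuous s) (h : ∀ y, 0 < t y) : Continuous fun y => pow (t y) (s y) :=
  Continuous.subtype_mk ((continuous_subtype_val.comp ht).rpow (continuous_subtype_val.comp hs)
    fun y => Or.inl (ne_of_gt (Subtype.coe_lt_coe.2 (h y)))) _

end unitInterval

namespace TimedChain

variable {C : Type w} [Category.{v} C]

open Classical in
/-- The new parameter, at time `s`, of a morphism `B ⟶ B'` with parameter `t`, when a word slides
towards the object `Q`. -/
noncomputable def slideTime (Q : C) (s : 𝕀) (B B' : C) (t : 𝕀) : 𝕀 :=
  if Nonempty (Q ⟶ B) then if B' = Q then t else unitInterval.pow t s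
  else if B' = Q then s * t else t

/-- The position at time `s ∈ [0,1]` of a word sliding towards the object `Q`.  The parameter of
the morphism that arrives at `Q` is multiplied by `s`, and the parameters of the
morphisms after `Q` are raised to the power `s`. Powers, rather than affine deformations, are
compatible with the identification that removes an identity, which multiplies two parameters. -/
noncomputable def slide (Q : C) (s : 𝕀) {A : C} : {B : C} → TimedChain A B → TimedChain A B
  | _, nil => nil
  | _, cons (B := B) (B' := B') t f c => cons (slideTime Q s B B' t) f (slide Q s c)

/-- The morphisms after the object `Q` have positive parameters. -/
def PosAfter (Q : C) {A : C} : {B : C} → TimedChain A B → Prop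
  | _, nil => True
  | _, cons (B := B) (B' := B') t _ c => (Nonempty (Q ⟶ B) → B' ≠ Q → 0 < t) ∧ PosAfter Q c

theorem slideTime_after {Q B B' : C} (s t : 𝕀) (h : Nonempty (Q ⟶ B)) (h' : B' ≠ Q) :
    slideTime Q s B B' t = unitInterval.pow t s := by rw [slideTime, if_pos h, if_neg h']

theorem slideTime_at {Q B : C} (s t : 𝕀) (h : Nonempty (Q ⟶ B)) :
    slideTime Q s B Q t = t := by rw [slideTime, if_pos h, if_pos rfl]

theorem slideTime_arrive {Q B : C} (s t : 𝕀) (h : ¬Nonempty (Q ⟶ B)) :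
    slideTime Q s B Q t = s * t := by rw [slideTime, if_neg h, if_pos rfl]

theorem slideTime_before {Q B B' : C} (s t : 𝕀) (h : ¬Nonempty (Q ⟶ B)) (h' : B' ≠ Q) :
    slideTime Q s B B' t = t := by rw [slideTime, if_neg h, if_neg h']

theorem slide_append (Q : C) (s : 𝕀) {A E B : C} (c : TimedChain A E) (u : TimedChain E B) :
    slide Q s (append c u) = append (slide Q s c) (slide Q s u) := by
  induction u with
  | nil => rfl
  | cons t f u ih => simp only [append_cons, slide, ih]

@[simp]
theorem slide_one (Q : C) {A B : C} (c : TimedChain A B) : slide Q 1 c = c := by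
  induction c with
  | nil => rfl
  | cons t f c ih =>
    rw [slide, ih]
    congr 1
    unfold slideTime
    split_ifs <;> simp

theorem hit_slide {Q R A B : C} {s : 𝕀} {c : TimedChain A B} : Hit R (slide Q s c) ↔ Hit R c := by
  induction c with
  | nil => rfl
  | cons t f c ih => simp only [slide, Hit, ih]

theorem leg_slide {Q R A B : C} {s : 𝕀} {c : TimedChain A B} : leg R (slide Q s c) = leg R c := by
  induction c with
  | nil => rfl
  | cons t f c ih => simp only [slide, leg, ih]

theorem between_slide {Q R S A B : C} {s : 𝕀} {c : TimedChain A B} :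
    between R S (slide Q s c) = between R S c := by
  induction c with
  | nil => rfl
  | cons t f c ih => simp only [slide, between, ih, leg_slide]

theorem continuous_slideTime {Q B B' : C} {Y : Type*} [TopologicalSpace Y] {s t : Y → 𝕀}
    (hs : Continuous s) (ht : Continuous t)
    (h : ∀ y, Nonempty (Q ⟶ B) → B' ≠ Q → 0 < t y) :
    Continuous fun y => slideTime Q (s y) B B' (t y) := by
  by_cases h1 : Nonempty (Q ⟶ B) <;> by_cases h2 : B' = Q
  · subst h2
    simpa only [slideTime_at _ _ h1] using ht
  · simpa only [slideTime_after _ _ h1 h2] using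
      unitInterval.continuous_pow ht hs fun y => h y h1 h2
  · subst h2
    simp only [slideTime_arrive _ _ h1]
    exact hs.mul ht
  · simpa only [slideTime_before _ _ h1 h2] using ht

/-- Sliding acts continuously on the parameters. -/
theorem exists_slide_ofTimes (Q : C) {A B : C} (p : Quiver.Path A B) {Y : Type*}
    [TopologicalSpace Y] {τ : Y → (Fin p.length → 𝕀)} {s : Y → 𝕀} (hτ : Continuous τ)
    (hs : Continuous s) (h : ∀ y, PosAfter Q (ofTimes p (τ y))) :
    ∃ τ' : Y → (Fin p.length → 𝕀), Continuous τ' ∧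
      ∀ y, slide Q (s y) (ofTimes p (τ y)) = ofTimes p (τ' y) := by
  induction p with
  | nil => exact ⟨τ, hτ, fun _ => rfl⟩
  | @cons B B' p f ih =>
    obtain ⟨τ', hτ', e⟩ := ih (τ := fun y i => τ y i.castSucc)
      (continuous_pi fun i => (continuous_apply _).comp hτ) fun y => (h y).2
    have hl : Continuous fun y => slideTime Q (s y) B B' (τ y (Fin.last p.length)) :=
      continuous_slideTime hs ((continuous_apply _).comp hτ) fun y => (h y).1
    refine ⟨fun y => Fin.snoc (α := fun _ => 𝕀) (τ' y)
      (slideTime Q (s y) B B' (τ y (Fin.last p.length))), ?_, fun y => ?_⟩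
    · refine continuous_pi fun i => ?_
      refine Fin.lastCases ?_ (fun j => ?_) i
      · simpa using hl
      · simpa [Function.comp_def] using (continuous_apply j).comp hτ'
    · change cons _ _ (slide _ _ (ofTimes _ _)) = cons _ _ (ofTimes _ _)
      rw [e y]
      congr 1
      · exact (Fin.snoc_last (α := fun _ => 𝕀) _ _).symm
      · congr 1
        funext i
        exact (Fin.snoc_castSucc (α := fun _ => 𝕀) _ _ _).symm

variable [IsAcyclicCategory C]

theorem PosAfter.of_weight_pos {Q A B : C} {c : TimedChain A B} (h : 0 < weight Q c) :
    PosAfter Q c := by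
  suffices ∀ {B : C} (c : TimedChain A B), (0 < weight Q c ∨ Nonempty (B ⟶ Q)) → PosAfter Q c from
    this c (Or.inl h)
  intro B c
  induction c with
  | nil => exact fun _ => trivial
  | @cons B B' t f c ih =>
    intro h
    have key : B' ≠ Q → 0 < weight Q (cons t f c) → 0 < (t : ℝ) ∧ 0 < weight Q c := by
      intro hB h
      rw [weight, if_neg hB, mul_zero, add_zero] at h
      exact ⟨pos_of_mul_pos_left h (weight_nonneg Q c), pos_of_mul_pos_right h t.2.1⟩
    refine ⟨fun hQ hB => ?_, ih ?_⟩
    · rcases h with h | h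
      · exact Subtype.coe_lt_coe.1 (key hB h).1
      · exact (hB (IsAcyclicCategory.antisymm h ⟨hQ.some ≫ f⟩)).elim
    · by_cases hB : B' = Q
      · subst hB
        exact Or.inr ⟨f⟩
      · rcases h with h | h
        · exact Or.inl (key hB h).2
        · exact Or.inr ⟨f ≫ h.some⟩

theorem PosAfter.slide {Q R A B : C} {s : 𝕀} {c : TimedChain A B} (hQR : Nonempty (Q ⟶ R))
    (h : PosAfter Q c) : PosAfter R (slide Q s c) := by
  induction c with
  | nil => trivial
  | @cons B B' t f c ih =>
    refine ⟨fun hR hB => ?_, ih h.2⟩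
    have hQ : Nonempty (Q ⟶ B) := ⟨hQR.some ≫ hR.some⟩
    by_cases hB' : B' = Q
    · subst hB'
      exact (hB (IsAcyclicCategory.antisymm hQR ⟨hR.some ≫ f⟩)).elim
    · rw [slideTime_after s t hQ hB']
      exact unitInterval.pow_pos' (h.1 hQ hB') s

theorem slide_eq_self {Q A B : C} (s : 𝕀) (c : TimedChain A B) (hB : Nonempty (B ⟶ Q))
    (h : B ≠ Q) : slide Q s c = c := by
  induction c with
  | nil => rfl
  | @cons B B' t f c ih =>
    have hn : ¬Nonempty (Q ⟶ B) := fun hQ => h (IsAcyclicCategory.antisymm hB ⟨hQ.some ≫ f⟩)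
    rw [slide, slideTime_before s t hn h, ih ⟨f ≫ hB.some⟩ fun e => hn ⟨eqToHom e.symm⟩]

/-- Sliding is compatible with the removal of identities. -/
theorem slideTime_mul {Q E E' A B : C} (s t t' : 𝕀) (g : E ⟶ E') {c : TimedChain A E}
    {u : TimedChain E' B} (h : 0 < weight Q ((cons t (𝟙 E') (cons t' g c)).append u)) :
    slideTime Q s E' E' t * slideTime Q s E E' t' = slideTime Q s E E' (t * t') := by
  by_cases h1 : E' = Q
  · subst h1
    rw [slideTime_at s t ⟨𝟙 _⟩]
    by_cases h2 : Nonempty (E' ⟶ E)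
    · rw [slideTime_at s t' h2, slideTime_at _ _ h2]
    · rw [slideTime_arrive _ _ h2, slideTime_arrive _ _ h2, mul_left_comm]
  · by_cases h2 : Nonempty (Q ⟶ E)
    · rw [slideTime_after _ _ ⟨h2.some ≫ g⟩ h1, slideTime_after _ _ h2 h1, slideTime_after _ _ h2 h1,
        unitInterval.mul_pow']
    · rw [slideTime_before _ _ h2 h1, slideTime_before _ _ h2 h1]
      by_cases h3 : Nonempty (Q ⟶ E')
      · rcases weight_append_pos h with h4 | h4
        · have h5 := ((Hit.of_weight_pos h4).resolve_left h1).resolve_left h1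
          exact (h2 (Hit.nonempty h5)).elim
        · exact (h1 (IsAcyclicCategory.antisymm h4 h3)).elim
      · rw [slideTime_before _ _ h3 h1]

end TimedChain

namespace HDiagram

open TimedChain

variable {C : Type w} [Category.{v} C] (D : HDiagram.{w, v, u} C)

/-- Two words with base points represent the same point, and act in the same way, whatever
word is written to the left of them. -/
structure SameHead {A A' E : C} (c : TimedChain A E) (x : D.obj A) (c' : TimedChain A' E)
    (x' : D.obj A') : Prop where
  cls_eq : ∀ {B : C} (u : TimedChain E B), D.cls (append c u) x = D.cls (append c' u) x'
  act_eq : ∀ {B B' : C} (f : B ⟶ B') (u : TimedChain E B),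
    D.act f (append c u) x = D.act f (append c' u) x'

namespace SameHead

variable {D}

theorem trans {A A' A'' E : C} {c : TimedChain A E} {x : D.obj A} {c' : TimedChain A' E}
    {x' : D.obj A'} {c'' : TimedChain A'' E} {x'' : D.obj A''} (h : D.SameHead c x c' x')
    (h' : D.SameHead c' x' c'' x'') : D.SameHead c x c'' x'' :=
  ⟨fun u => (h.cls_eq u).trans (h'.cls_eq u), fun f u => (h.act_eq f u).trans (h'.act_eq f u)⟩

theorem append {A A' E B : C} {c : TimedChain A E} {x : D.obj A} {c' : TimedChain A' E}
    {x' : D.obj A'} (h : D.SameHead c x c' x') (u : TimedChain E B) :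
    D.SameHead (c.append u) x (c'.append u) x' :=
  ⟨fun v => by simpa only [append_assoc] using h.cls_eq (u.append v),
    fun f v => by simpa only [append_assoc] using h.act_eq f (u.append v)⟩

theorem first_id {A : C} (t : 𝕀) (x : D.obj A) : D.SameHead (cons t (𝟙 A) nil) x nil x :=
  ⟨fun u => by rw [nil_append]; exact Quot.sound (Rel.first_id u t x),
    fun f u => by rw [nil_append, D.act_first_id]⟩

theorem middle_id {A E E' : C} (t s : 𝕀) (g : E ⟶ E') (c : TimedChain A E) (x : D.obj A) :
    D.SameHead (cons t (𝟙 E') (cons s g c)) x (cons (t * s) g c) x :=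
  ⟨fun u => Quot.sound (Rel.middle_id u t s g c x), fun f u => D.act_middle_id f u t s g c x⟩

theorem one {A E E' E'' : C} (t : 𝕀) (h : E' ⟶ E'') (g : E ⟶ E') (c : TimedChain A E)
    (x : D.obj A) : D.SameHead (cons t h (cons 1 g c)) x (cons t (g ≫ h) c) x :=
  ⟨fun u => Quot.sound (Rel.one u t h g c x), fun f u => D.act_one f u t h g c x⟩

theorem zero {A E E' : C} (g : E ⟶ E') (c : TimedChain A E) (x : D.obj A) :
    D.SameHead (cons 0 g c) x nil (D.act g c x) :=
  ⟨fun u => by rw [nil_append]; exact Quot.sound (Rel.zero u g c x),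
    fun f u => by rw [nil_append, D.act_zero]⟩

end SameHead

theorem cls_cons_one {A B E : C} (g : E ⟶ B) (c : TimedChain A E) (x : D.obj A) :
    D.cls (cons 1 g c) x = D.cls c x := Quot.sound (Rel.last_one g c x)

theorem cls_cons_zero {A B E : C} (g : E ⟶ B) (c : TimedChain A E) (x : D.obj A) :
    D.cls (cons 0 g c) x = D.cls nil (D.act g c x) := (SameHead.zero g c x).cls_eq nil

variable [IsAcyclicCategory C]

/-- Sliding towards `Q` changes only the parameters from the arrival at `Q` onwards, so it does not
affect the action of words that end at or before `Q`. -/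
theorem act_slide_self {Q A E E' : C} (s : 𝕀) (g : E ⟶ E') (c : TimedChain A E) (x : D.obj A)
    (h : Nonempty (E' ⟶ Q)) : D.act g (slide Q s c) x = D.act g c x := by
  by_cases e : E = Q
  · subst e
    obtain rfl := IsAcyclicCategory.antisymm ⟨g⟩ h
    obtain rfl := IsAcyclicCategory.eq_id g
    cases c with
    | nil => rfl
    | @cons B _ t f c =>
      rw [slide, D.act_last_id, D.act_last_id]
      by_cases e : B = E
      · subst e
        obtain rfl := IsAcyclicCategory.eq_id f
        exact act_slide_self s _ c x h
      · rw [slide_eq_self s c ⟨f⟩ e]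
  · rw [slide_eq_self s c ⟨g ≫ h.some⟩ e]
termination_by sizeOf c

/-- Sliding towards `Q` preserves the identifications of words in which `Q` has positive weight. -/
theorem rel_slide {Q : C} (s : 𝕀) {a b : D.PreHocolim} (h : D.Rel a b)
    (hQ : 0 < weight Q a.2.2.1) :
    D.Rel (D.pt (slide Q s a.2.2.1) a.2.2.2) (D.pt (slide Q s b.2.2.1) b.2.2.2) := by
  cases h with
  | first_id u t x =>
    simp only [slide_append, slide]
    exact Rel.first_id _ _ _
  | middle_id u t t' g c x =>
    simp only [slide_append, slide, ← slideTime_mul s t t' g hQ]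
    exact Rel.middle_id _ _ _ _ _ _
  | @one A B E E' E'' u t h g c x =>
    have key : E' ≠ E'' → slideTime Q s E E' 1 = 1 →
        slideTime Q s E' E'' t = slideTime Q s E E'' t →
        D.Rel (D.pt (slide Q s ((cons t h (cons 1 g c)).append u)) x)
          (D.pt (slide Q s ((cons t (g ≫ h) c).append u)) x) := by
      intro _ h1 h2
      simp only [slide_append, slide, h1, h2]
      exact Rel.one _ _ _ _ _ _
    by_cases e2 : E' = E''
    · subst e2
      obtain rfl := IsAcyclicCategory.eq_id h
      have := slideTime_mul s t 1 g hQ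
      rw [mul_one] at this
      simp only [slide_append, slide, Category.comp_id, ← this]
      exact Rel.middle_id _ _ _ _ _ _
    by_cases e1 : E = E'
    · subst e1
      refine key e2 ?_ rfl
      unfold slideTime
      split_ifs with h1 h2 h3
      · rfl
      · simp
      · subst h3
        exact (h1 ⟨𝟙 _⟩).elim
      · rfl
    have hQ' := ne_of_weight_pos e1 e2 hQ
    refine key e2 ?_ ?_
    · unfold slideTime
      split_ifs <;> simp
    · by_cases h1 : Nonempty (Q ⟶ E)
      · simp only [slideTime, if_pos h1, if_pos (⟨h1.some ≫ g⟩ : Nonempty (Q ⟶ E'))]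
      · by_cases h2 : Nonempty (Q ⟶ E')
        · refine (hQ' (IsAcyclicCategory.antisymm ?_ h2)).elim
          rcases weight_append_pos hQ with h3 | h3
          · rcases Hit.of_weight_pos h3 with h4 | h4 | h4
            · exact ⟨h ≫ eqToHom h4⟩
            · exact ⟨eqToHom h4⟩
            · exact (h1 (Hit.nonempty h4)).elim
          · exact ⟨h ≫ h3.some⟩
        · simp only [slideTime, if_neg h1, if_neg h2]
  | @last_one A B E g c x =>
    have h1 : slideTime Q s E B 1 = 1 := by
      simp only [weight, Set.Icc.coe_one, one_mul, sub_self, zero_mul, add_zero] at hQ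
      have := (Hit.of_weight_pos hQ).nonempty
      unfold slideTime
      split_ifs <;> simp
    simp only [slide, h1]
    exact Rel.last_one _ _ _
  | @zero A B E E' u g c x =>
    have hQ' : Nonempty (E' ⟶ Q) := by
      rcases weight_append_pos hQ with h | h
      · simp only [weight, Set.Icc.coe_zero, zero_mul, sub_zero, one_mul, zero_add] at h
        split_ifs at h with h'
        · exact ⟨eqToHom h'⟩
        · exact (lt_irrefl _ h).elim
      · exact h
    have h1 : slideTime Q s E E' 0 = 0 := by
      unfold slideTime
      split_ifs with h1 h2
      · rfl
      · exact (h2 (IsAcyclicCategory.antisymm hQ' ⟨h1.some ≫ g⟩)).elim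
      · simp
      · rfl
    simp only [slide_append, slide, h1]
    rw [← D.act_slide_self s g c x hQ']
    exact Rel.zero _ _ _ _

end HDiagram

namespace HDiagram

open TimedChain

variable {C : Type w} [Category.{v} C] (D : HDiagram.{w, v, u} C)

variable [IsAcyclicCategory C]

/-! ### The end of a slide -/

theorem leg_eq_id {A Q : C} {c : TimedChain A Q} {k : Q ⟶ Q} : leg Q c = some k ↔ k = 𝟙 Q := by
  obtain ⟨k', hk'⟩ := Option.ne_none_iff_exists'.1 (leg_self_ne_none c)
  rw [hk', IsAcyclicCategory.eq_id k, IsAcyclicCategory.eq_id k']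
  exact ⟨fun _ => rfl, fun _ => rfl⟩

/-- At the end of the slide, a word with target `Q` is equivalent to its value at `Q`. -/
theorem sameHead_slide_zero {A Q : C} (c : TimedChain A Q) (x : D.obj A) (h : c.Hit Q) :
    D.SameHead (slide Q 0 c) x nil (D.eval Q x c h) := by
  cases c with
  | nil => exact ⟨fun _ => rfl, fun _ _ => rfl⟩
  | @cons B _ t f c =>
    rw [eval_cons_self]
    by_cases e : B = Q
    · subst e
      obtain rfl := IsAcyclicCategory.eq_id f
      have hc : Hit B c := by
        cases c with
        | nil => rfl
        | cons t f c => exact Or.inl rfl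
      rw [slide, slideTime_at 0 t ⟨𝟙 _⟩]
      refine ((sameHead_slide_zero c x hc).append (cons t (𝟙 B) nil)).trans ?_
      rw [nil_append, eval_eq_act]
      exact SameHead.first_id t _
    · have hn : ¬Nonempty (Q ⟶ B) := fun h => e (IsAcyclicCategory.antisymm ⟨f⟩ h)
      rw [slide, slideTime_arrive 0 t hn, zero_mul, slide_eq_self 0 c ⟨f⟩ e]
      exact SameHead.zero f c x
termination_by sizeOf c

theorem sameHead_cons_slide_zero {A B B' Q : C} {c : TimedChain A B} {k : Q ⟶ B} (x : D.obj A)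
    (h : leg Q c = some k) (s : 𝕀) (f : B ⟶ B') :
    D.SameHead (cons s f (slide Q 0 c)) x (cons s (k ≫ f) nil) (D.eval Q x c (hit_of_leg h)) := by
  by_cases e : B = Q
  · subst e
    obtain rfl := leg_eq_id.1 h
    rw [Category.id_comp]
    exact (D.sameHead_slide_zero c x _).append (cons s f nil)
  · cases c with
    | nil => exact (e (hit_of_leg h)).elim
    | @cons E _ t g c =>
      rw [leg_cons_of_ne e] at h
      obtain ⟨k', hk', rfl⟩ := Option.map_eq_some_iff.1 h
      rw [slide, slideTime_after 0 t ⟨k'⟩ e, unitInterval.pow_zero', eval_cons_of_ne _ _ _ _ _ _ e,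
        Category.assoc]
      exact (SameHead.one s f g _ x).trans (sameHead_cons_slide_zero x hk' s (g ≫ f))
termination_by sizeOf c

theorem act_slide_zero {A B B' Q : C} {c : TimedChain A B} {k : Q ⟶ B} (x : D.obj A)
    (h : leg Q c = some k) (f : B ⟶ B') :
    D.act f (slide Q 0 c) x = D.act (k ≫ f) nil (D.eval Q x c (hit_of_leg h)) := by
  have := (D.sameHead_cons_slide_zero x h 1 f).act_eq (𝟙 B') nil
  rwa [append_nil, append_nil, D.act_last_id, D.act_last_id] at this

theorem cls_slide_zero {A B Q : C} (c : TimedChain A B) (x : D.obj A) (h : c.Hit Q) :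
    D.cls (slide Q 0 c) x = D.cls nil (D.eval Q x c h) := by
  obtain ⟨k, hk⟩ := Option.ne_none_iff_exists'.1 h.leg_ne_none
  have := (D.sameHead_cons_slide_zero x hk 1 (𝟙 B)).cls_eq nil
  rwa [append_nil, append_nil, cls_cons_one, cls_cons_one] at this

theorem eval_slide_zero {A B Q R : C} {c : TimedChain A B} {k : Q ⟶ R} (hQR : Q ≠ R) (x : D.obj A)
    (h : between Q R c = some k) (hQ : c.Hit Q) (hR : (slide Q 0 c).Hit R) :
    D.eval R x (slide Q 0 c) hR = D.act k nil (D.eval Q x c hQ) := by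
  induction c with
  | nil => exact (Option.some_ne_none _ h.symm).elim
  | @cons B B' t f c ih =>
    by_cases e : B' = R
    · subst e
      rw [between_cons_self] at h
      obtain ⟨k', hk', rfl⟩ := Option.map_eq_some_iff.1 h
      exact (D.eval_cons_self _ _ _ _ _).trans ((D.act_slide_zero x hk' f).trans
        (congrArg _ (D.eval_cons_of_ne _ _ _ _ hQ (Ne.symm hQR)).symm))
    · have e' : B' ≠ Q := by
        rintro rfl
        rw [between_cons_of_ne e] at h
        exact hQR (IsAcyclicCategory.antisymm ⟨k⟩ ⟨(hit_of_between h).nonempty.some ≫ f⟩)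
      rw [between_cons_of_ne e] at h
      exact (D.eval_cons_of_ne _ _ _ _ _ e).trans ((ih h (hQ.resolve_left e') _).trans
        (congrArg _ (D.eval_cons_of_ne _ _ _ _ hQ e').symm))

/-- Sliding towards `R` a word that has already slid to `Q`. -/
theorem sameHead_slide_slide {A Q R : C} (hQR : Q ≠ R) {c : TimedChain A R} {g : Q ⟶ R}
    (x : D.obj A) (h : leg Q c = some g) (s : 𝕀) :
    D.SameHead (slide R s (slide Q 0 c)) x (cons s g nil) (D.eval Q x c (hit_of_leg h)) := by
  cases c with
  | nil => exact (hQR (hit_of_leg h).symm).elim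
  | @cons B _ t f c =>
    rw [leg_cons_of_ne (Ne.symm hQR)] at h
    obtain ⟨k, hk, rfl⟩ := Option.map_eq_some_iff.1 h
    rw [eval_cons_of_ne _ _ _ _ _ _ (Ne.symm hQR), slide,
      slideTime_after 0 t ⟨k⟩ (Ne.symm hQR), unitInterval.pow_zero', slide]
    by_cases e : B = R
    · subst e
      obtain rfl := IsAcyclicCategory.eq_id f
      simp only [slideTime_at s 1 ⟨𝟙 _⟩, Category.comp_id]
      refine ((sameHead_slide_slide hQR x hk s).append (cons 1 (𝟙 B) nil)).trans ?_
      have := SameHead.middle_id (D := D) 1 s k nil (D.eval Q x c (hit_of_leg hk))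
      rwa [one_mul] at this
    · have hn : ¬Nonempty (R ⟶ B) := fun h => e (IsAcyclicCategory.antisymm ⟨f⟩ h)
      rw [slideTime_arrive s 1 hn, mul_one, slide_eq_self s _ ⟨f⟩ e]
      exact D.sameHead_cons_slide_zero x hk s f
termination_by sizeOf c

theorem sameHead_cons_slide_slide {A B B' Q R : C} (hQR : Q ≠ R) {c : TimedChain A B} {g : Q ⟶ R}
    {k : R ⟶ B} (x : D.obj A) (hg : between Q R c = some g) (hk : leg R c = some k) (hQ : c.Hit Q)
    (s t : 𝕀) (f : B ⟶ B') :
    D.SameHead (cons t f (slide R s (slide Q 0 c))) x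
      (cons t (k ≫ f) (cons s g nil)) (D.eval Q x c hQ) := by
  by_cases e : B = R
  · subst e
    obtain rfl := leg_eq_id.1 hk
    rw [Category.id_comp]
    have hg' : leg Q c = some g := by
      cases c with
      | nil => exact (Option.some_ne_none _ hg.symm).elim
      | cons t f c =>
        rw [between_cons_self] at hg
        rw [leg_cons_of_ne (Ne.symm hQR), hg]
    exact (D.sameHead_slide_slide hQR x hg' s).append (cons t f nil)
  · cases c with
    | nil => exact (Option.some_ne_none _ hg.symm).elim
    | @cons E _ t' f' c =>
      rw [leg_cons_of_ne e] at hk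
      obtain ⟨k', hk', rfl⟩ := Option.map_eq_some_iff.1 hk
      rw [between_cons_of_ne e] at hg
      have e' : B ≠ Q := by
        rintro rfl
        exact hQR (IsAcyclicCategory.antisymm ⟨g⟩ ⟨k' ≫ f'⟩)
      rw [slide, slideTime_after 0 t' ⟨g ≫ k'⟩ e', unitInterval.pow_zero', slide,
        slideTime_after s 1 ⟨k'⟩ e, unitInterval.one_pow', eval_cons_of_ne _ _ _ _ _ _ e',
        Category.assoc]
      exact (SameHead.one t f f' _ x).trans
        (sameHead_cons_slide_slide hQR x hg hk' (hQ.resolve_left e') s t (f' ≫ f))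
termination_by sizeOf c

/-- A point of the intersection of the stars of `Q` and `R` that has reached `D_Q` slides towards `R`
along the edge given by the morphism between them. -/
theorem cls_slide_slide {A B Q R : C} (hQR : Q ≠ R) {c : TimedChain A B} {g : Q ⟶ R}
    (x : D.obj A) (hg : between Q R c = some g) (hQ : c.Hit Q) (s : 𝕀) :
    D.cls (slide R s (slide Q 0 c)) x = D.cls (cons s g nil) (D.eval Q x c hQ) := by
  obtain ⟨k, hk⟩ := Option.ne_none_iff_exists'.1 (hit_of_between hg).leg_ne_none
  have := (D.sameHead_cons_slide_slide hQR x hg hk hQ s 1 (𝟙 B)).cls_eq nil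
  rwa [append_nil, append_nil, cls_cons_one, cls_cons_one] at this

/-- The image in `D_S` of a point that slides from `D_Q` towards `R`, for objects `Q`, `R` and `S` in
this order, is given by the homotopy `D(k, s, g; -)`. -/
theorem eval_slide_slide {A B Q R S : C} (hQR : Q ≠ R) (hRS : R ≠ S) {c : TimedChain A B}
    {g : Q ⟶ R} {k : R ⟶ S} (x : D.obj A) (hg : between Q R c = some g)
    (hk : between R S c = some k) (hQ : c.Hit Q) (s : 𝕀)
    (hS : (slide R s (slide Q 0 c)).Hit S) :
    D.eval S x (slide R s (slide Q 0 c)) hS = D.act k (cons s g nil) (D.eval Q x c hQ) := by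
  have hQS : Q ≠ S := by
    rintro rfl
    exact hQR (IsAcyclicCategory.antisymm ⟨g⟩ ⟨k⟩)
  induction c with
  | nil => exact (Option.some_ne_none _ hk.symm).elim
  | @cons B B' t f c ih =>
    by_cases e : B' = S
    · subst e
      rw [between_cons_self] at hk
      obtain ⟨k', hk', rfl⟩ := Option.map_eq_some_iff.1 hk
      rw [between_cons_of_ne (Ne.symm hRS)] at hg
      have h1 := (D.sameHead_cons_slide_slide hQR x hg hk' (hQ.resolve_left (Ne.symm hQS)) s 1
        f).act_eq (𝟙 B') nil
      rw [append_nil, append_nil, D.act_last_id, D.act_last_id] at h1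
      exact (D.eval_cons_self _ _ _ _ _).trans (h1.trans
        (congrArg _ (D.eval_cons_of_ne _ _ _ _ hQ (Ne.symm hQS)).symm))
    · rw [between_cons_of_ne e] at hk
      have hS' : Nonempty (S ⟶ B') := ⟨(hit_of_between hk).nonempty.some ≫ f⟩
      have e1 : B' ≠ R := by
        rintro rfl
        exact hRS (IsAcyclicCategory.antisymm ⟨k⟩ hS')
      have e2 : B' ≠ Q := by
        rintro rfl
        exact hQS (IsAcyclicCategory.antisymm ⟨g ≫ k⟩ hS')
      rw [between_cons_of_ne e1] at hg
      exact (D.eval_cons_of_ne _ _ _ _ _ e).trans ((ih hg hk (hQ.resolve_left e2) _).trans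
        (congrArg _ (D.eval_cons_of_ne _ _ _ _ hQ e2).symm))

theorem between_comp {A B Q R S : C} (hQR : Q ≠ R) (hRS : R ≠ S) {c : TimedChain A B} {g : Q ⟶ R}
    {k : R ⟶ S} (hg : between Q R c = some g) (hk : between R S c = some k) :
    between Q S c = some (g ≫ k) := by
  have key : ∀ {B : C} (c : TimedChain A B) (k : R ⟶ B), between Q R c = some g →
      leg R c = some k → leg Q c = some (g ≫ k) := by
    intro B c k hg hk
    induction c with
    | nil => exact (Option.some_ne_none _ hg.symm).elim
    | @cons B B' t f c ih =>
      by_cases e : B' = R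
      · subst e
        rw [between_cons_self] at hg
        rw [leg_cons_of_ne (Ne.symm hQR), hg, leg_eq_id.1 hk, Category.comp_id]
      · rw [leg_cons_of_ne e] at hk
        obtain ⟨k', hk', rfl⟩ := Option.map_eq_some_iff.1 hk
        rw [between_cons_of_ne e] at hg
        rw [leg_cons_of_some (ih k' hg hk'), Category.assoc]
  induction c with
  | nil => exact (Option.some_ne_none _ hg.symm).elim
  | @cons B B' t f c ih =>
    by_cases e : B' = S
    · subst e
      rw [between_cons_self] at hk
      obtain ⟨k', hk', rfl⟩ := Option.map_eq_some_iff.1 hk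
      rw [between_cons_of_ne (Ne.symm hRS)] at hg
      rw [between_cons_self, key c k' hg hk', Option.map_some, Category.assoc]
    · rw [between_cons_of_ne e] at hk
      have e1 : B' ≠ R := by
        rintro rfl
        exact hRS (IsAcyclicCategory.antisymm ⟨k⟩ ⟨(hit_of_between hk).nonempty.some ≫ f⟩)
      rw [between_cons_of_ne e1] at hg
      rw [between_cons_of_ne e, ih hg hk]

end HDiagram

/-- Transport along the two ways around the boundary of a square. -/
theorem Transport.map_unitSquare {W : Type*} [TopologicalSpace W] {G : Type*} [Groupoid G]
    {obj : W → G} (M : Transport obj) {Γ : 𝕀 × 𝕀 → W} (hΓ : Continuous Γ) {a b c d : W}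
    {p₁ : Path a b} {p₂ : Path b d} {q₁ : Path a c} {q₂ : Path c d}
    (h₁ : ∀ s, p₁ s = Γ (s, 0)) (h₂ : ∀ s, p₂ s = Γ (1, s)) (h₃ : ∀ s, q₁ s = Γ (0, s))
    (h₄ : ∀ s, q₂ s = Γ (s, 1)) :
    M.map p₁ ≫ M.map p₂ = M.map q₁ ≫ M.map q₂ := by
  have _ : ContractibleSpace 𝕀 := (convex_Icc (0 : ℝ) 1).contractibleSpace ⟨0, by simp⟩
  let i : Path (0 : 𝕀) 1 := ⟨ContinuousMap.id 𝕀, rfl, rfl⟩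
  exact M.map_square ⟨Γ, hΓ⟩ (i.prod (Path.refl 0)) ((Path.refl 1).prod i)
    ((Path.refl 0).prod i) (i.prod (Path.refl 1)) h₁ h₂ h₃ h₄

namespace HDiagram

open TimedChain

variable {C : Type w} [Category.{v} C] (D : HDiagram.{w, v, u} C)

/-! ### Paths in the homotopy colimit and in the vertex spaces -/

/-- The map of vertex spaces given by a morphism. -/
def actMap {A B : C} (f : A ⟶ B) : C(D.obj A, D.obj B) :=
  ⟨fun x => D.act f nil x, (D.continuous_act f).comp (continuous_const.prodMk continuous_id)⟩

/-- The homotopy `t ↦ D(g, t, f; x)`, from `D(g; D(f; x))` to `D(g ∘ f; x)`. -/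
def compPath {A B E : C} (f : A ⟶ B) (g : B ⟶ E) (x : D.obj A) :
    Path (D.actMap g (D.actMap f x)) (D.actMap (f ≫ g) x) where
  toFun t := D.act g (cons t f nil) x
  continuous_toFun := (D.continuous_act g).comp (((continuous_cons f).comp
    (continuous_id.prodMk continuous_const)).prodMk continuous_const)
  source' := D.act_zero g nil f nil x
  target' := D.act_last_one g f nil x

/-- The path `t ↦ [t, f; x]`, from `D(f; x)` to `x`. -/
def edgePath {A B : C} (f : A ⟶ B) (x : D.obj A) : Path (D.inc B (D.actMap f x)) (D.inc A x) where
  toFun t := D.cls (cons t f nil) x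
  continuous_toFun := (D.continuous_cls A B).comp (((continuous_cons f).comp
    (continuous_id.prodMk continuous_const)).prodMk continuous_const)
  source' := D.cls_cons_zero f nil x
  target' := D.cls_cons_one f nil x

section

variable {G : Type*} [Groupoid G]

theorem map_edgePath_natural {obj : D.Hocolim → G} (M : Transport obj) {A B : C} (f : A ⟶ B)
    {x y : D.obj A} (p : Path x y) :
    M.map ((p.map (D.actMap f).continuous).map (D.inc B).continuous) ≫ M.map (D.edgePath f y) =
      M.map (D.edgePath f x) ≫ M.map (p.map (D.inc A).continuous) :=
  M.map_unitSquare (Γ := fun z => D.cls (cons z.2 f nil) (p z.1))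
    ((D.continuous_cls A B).comp (((continuous_cons f).comp
      (continuous_snd.prodMk continuous_const)).prodMk (p.continuous.comp continuous_fst)))
    (fun s => (D.cls_cons_zero f nil (p s)).symm) (fun _ => by rw [p.target]; rfl)
    (fun _ => by rw [p.source]; rfl) (fun s => (D.cls_cons_one f nil (p s)).symm)

/-- The boundary of the two-simplex `[s, g, t, f; x]`. -/
theorem map_edgePath_comp {obj : D.Hocolim → G} (M : Transport obj) {A B E : C} (f : A ⟶ B)
    (g : B ⟶ E) (x : D.obj A) :
    M.map (D.edgePath g (D.actMap f x)) ≫ M.map (D.edgePath f x) =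
      M.map ((D.compPath f g x).map (D.inc E).continuous) ≫ M.map (D.edgePath (f ≫ g) x) :=
  M.map_unitSquare (Γ := fun z => D.cls (cons z.1 g (cons z.2 f nil)) x)
    ((D.continuous_cls A E).comp (((continuous_cons g).comp
      (continuous_fst.prodMk ((continuous_cons f).comp
        (continuous_snd.prodMk continuous_const)))).prodMk continuous_const))
    (fun s => ((SameHead.zero f nil x).cls_eq (cons s g nil)).symm)
    (fun _ => (D.cls_cons_one g _ x).symm) (fun _ => (D.cls_cons_zero g _ x).symm)
    (fun s => ((SameHead.one s g f nil x).cls_eq nil).symm)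

theorem map_compPath_natural {A B E : C} {obj : D.obj E → G} (M : Transport obj) (f : A ⟶ B)
    (g : B ⟶ E) {x y : D.obj A} (p : Path x y) :
    M.map ((p.map (D.actMap f).continuous).map (D.actMap g).continuous) ≫
        M.map (D.compPath f g y) =
      M.map (D.compPath f g x) ≫ M.map (p.map (D.actMap (f ≫ g)).continuous) :=
  M.map_unitSquare (Γ := fun z => D.act g (cons z.2 f nil) (p z.1))
    ((D.continuous_act g).comp (((continuous_cons f).comp
      (continuous_snd.prodMk continuous_const)).prodMk (p.continuous.comp continuous_fst)))
    (fun s => (D.act_zero g nil f nil (p s)).symm) (fun _ => by rw [p.target]; rfl)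
    (fun _ => by rw [p.source]; rfl) (fun s => (D.act_last_one g f nil (p s)).symm)

/-- The boundary of the square `D(h, s, g, t, f; x)`. -/
theorem map_compPath_comp {A B E F : C} {obj : D.obj F → G} (M : Transport obj) (f : A ⟶ B)
    (g : B ⟶ E) (h : E ⟶ F) (x : D.obj A) :
    M.map (D.compPath g h (D.actMap f x)) ≫ M.map (D.compPath f (g ≫ h) x) =
      M.map ((D.compPath f g x).map (D.actMap h).continuous) ≫
        M.map ((D.compPath (f ≫ g) h x).cast rfl (by rw [Category.assoc])) :=
  M.map_unitSquare (Γ := fun z => D.act h (cons z.1 g (cons z.2 f nil)) x)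
    ((D.continuous_act h).comp (((continuous_cons g).comp
      (continuous_fst.prodMk ((continuous_cons f).comp
        (continuous_snd.prodMk continuous_const)))).prodMk continuous_const))
    (fun s => (D.act_zero h (cons s g nil) f nil x).symm)
    (fun _ => (D.act_last_one h g _ x).symm) (fun _ => (D.act_zero h nil g _ x).symm)
    (fun s => (D.act_one h nil s g f nil x).symm)

end

theorem continuous_eval_slide {Q R A B : C} (p : Quiver.Path A B) {Y : Type*} [TopologicalSpace Y]
    {τ : Y → (Fin p.length → 𝕀)} {x : Y → D.obj A} {s : Y → 𝕀} (hτ : Continuous τ)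
    (hx : Continuous x) (hs : Continuous s) (h : ∀ y, PosAfter Q (ofTimes p (τ y)))
    (hR : ∀ y, (slide Q (s y) (ofTimes p (τ y))).Hit R) :
    Continuous fun y => D.eval R (x y) (slide Q (s y) (ofTimes p (τ y))) (hR y) := by
  obtain ⟨τ', hτ', e⟩ := exists_slide_ofTimes Q p hτ hs h
  refine (D.continuous_eval_ofTimes R p τ' x hτ' hx fun y => by rw [← e]; exact hR y).congr
    fun y => ?_
  congr 1
  exact (e y).symm

variable [IsAcyclicCategory C]

/-! ### The slide as a deformation -/

theorem exists_slidePoint (Q : C) : ∃ g : C(D.star Q × 𝕀, D.Hocolim),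
    ∀ {A B : C} (c : TimedChain A B) (x : D.obj A) (h : D.cls c x ∈ D.star Q) (s : 𝕀),
      g (⟨D.cls c x, h⟩, s) = D.cls (slide Q s c) x := by
  obtain ⟨g, hg⟩ := D.exists_descend (D.star Q)
    (fun z _ s => D.cls (slide Q s z.2.2.1) z.2.2.2) fun _ _ h ha _ =>
      funext fun s => Quot.sound (D.rel_slide s h ha)
  refine ⟨⟨fun z => g z.1 z.2, ?_⟩, fun c x h s => congrFun (hg c x h) s⟩
  refine D.continuous_of_cells (D.isOpen_star Q) (g := fun z => g z.1 z.2) fun {A B} p => ?_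
  obtain ⟨τ', hτ', e⟩ := exists_slide_ofTimes Q p
    (Y := {w : (Fin p.length → 𝕀) × D.obj A // D.cls (ofTimes p w.1) w.2 ∈ D.star Q} × 𝕀)
    (τ := fun w => w.1.1.1) (s := fun w => w.2) (by fun_prop) (by fun_prop)
    fun w => PosAfter.of_weight_pos w.1.2
  refine ((D.continuous_cls A B).comp (((isOpenEmbedding_ofTimes p).continuous.comp hτ').prodMk
    (by fun_prop : Continuous fun w : {w : (Fin p.length → 𝕀) × D.obj A //
      D.cls (ofTimes p w.1) w.2 ∈ D.star Q} × 𝕀 => w.1.1.2))).congr fun w => ?_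
  refine Eq.trans ?_ (congrFun (hg _ _ w.1.2) w.2).symm
  change D.cls _ _ = D.cls _ _
  rw [e w]
  rfl

/-- The deformation of the open star of `Q` to the vertex space of `Q` inside the
homotopy colimit. -/
noncomputable def slidePoint (Q : C) : C(D.star Q × 𝕀, D.Hocolim) := (D.exists_slidePoint Q).choose

theorem slidePoint_cls (Q : C) {A B : C} (c : TimedChain A B) (x : D.obj A)
    (h : D.cls c x ∈ D.star Q) (s : 𝕀) :
    D.slidePoint Q (⟨D.cls c x, h⟩, s) = D.cls (slide Q s c) x :=
  (D.exists_slidePoint Q).choose_spec c x h s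

/-- The path from the retraction of a point of the open star of `Q` to the point itself. -/
noncomputable def slidePath (Q : C) (z : D.star Q) : Path (D.inc Q (D.retract Q z)) z.1 where
  toFun s := D.slidePoint Q (z, s)
  continuous_toFun := (D.slidePoint Q).continuous.comp (continuous_const.prodMk continuous_id)
  source' := by
    obtain ⟨z, hz⟩ := z
    obtain ⟨⟨A, B, c, x⟩, rfl⟩ := Quot.exists_rep z
    exact (D.slidePoint_cls Q c x hz 0).trans ((D.cls_slide_zero c x _).trans
      (congrArg (D.inc Q) (D.retract_cls Q c x hz).symm))
  target' := by
    obtain ⟨z, hz⟩ := z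
    obtain ⟨⟨A, B, c, x⟩, rfl⟩ := Quot.exists_rep z
    exact (D.slidePoint_cls Q c x hz 1).trans (by rw [slide_one]; rfl)

theorem exists_comparePoint (Q R : C) :
    ∃ g : C((D.star Q ∩ D.star R : Set D.Hocolim) × 𝕀, D.obj R),
      ∀ {A B : C} (c : TimedChain A B) (x : D.obj A) (h : D.cls c x ∈ D.star Q ∩ D.star R)
        (s : 𝕀), g (⟨D.cls c x, h⟩, s) =
          D.eval R x (slide Q s c) (hit_slide.2 (Hit.of_weight_pos h.2)) := by
  obtain ⟨g, hg⟩ := D.exists_descend (D.star Q ∩ D.star R)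
    (fun z h s => D.eval R z.2.2.2 (slide Q s z.2.2.1) (hit_slide.2 (Hit.of_weight_pos h.2)))
    fun _ _ h ha hb => funext fun s => D.eval_eq_of_rel R (D.rel_slide s h ha.1) _
      (hit_slide.2 (Hit.of_weight_pos hb.2))
  refine ⟨⟨fun z => g z.1 z.2, ?_⟩, fun c x h s => congrFun (hg c x h) s⟩
  refine D.continuous_of_cells ((D.isOpen_star Q).inter (D.isOpen_star R))
    (g := fun z => g z.1 z.2) fun {A B} p => ?_
  refine (D.continuous_eval_slide (Q := Q) (R := R) p (Y := {w : (Fin p.length → 𝕀) × D.obj A //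
    D.cls (ofTimes p w.1) w.2 ∈ D.star Q ∩ D.star R} × 𝕀) (τ := fun w => w.1.1.1)
    (x := fun w => w.1.1.2) (s := fun w => w.2) (by fun_prop) (by fun_prop) (by fun_prop)
    (fun w => PosAfter.of_weight_pos w.1.2.1)
    fun w => hit_slide.2 (Hit.of_weight_pos w.1.2.2)).congr fun w => ?_
  exact (congrFun (hg _ _ w.1.2) w.2).symm

/-- The homotopy, on the intersection of the open stars of `Q` and `R`, that compares the
two retractions. -/
noncomputable def comparePoint (Q R : C) :
    C((D.star Q ∩ D.star R : Set D.Hocolim) × 𝕀, D.obj R) := (D.exists_comparePoint Q R).choose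

theorem comparePoint_cls (Q R : C) {A B : C}
    (c : TimedChain A B) (x : D.obj A) (h : D.cls c x ∈ D.star Q ∩ D.star R) (s : 𝕀) :
    D.comparePoint Q R (⟨D.cls c x, h⟩, s) =
      D.eval R x (slide Q s c) (hit_slide.2 (Hit.of_weight_pos h.2)) :=
  (D.exists_comparePoint Q R).choose_spec c x h s

/-- The path from the image, under the morphism `g : Q ⟶ R` belonging to `z`, of the retraction of
`z` in the vertex space of `Q` to the retraction of `z` in the vertex space of `R`. -/
noncomputable def comparePath {Q R : C} (hQR : Q ≠ R) (hom : Nonempty (Q ⟶ R)) (z : D.Hocolim)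
    (hQ : z ∈ D.star Q) (hR : z ∈ D.star R) (g : Q ⟶ R)
    (hg : D.arrow hQR hom ⟨z, hQ, hR⟩ = g) :
    Path (D.actMap g (D.retract Q ⟨z, hQ⟩)) (D.retract R ⟨z, hR⟩) where
  toFun s := D.comparePoint Q R (⟨z, hQ, hR⟩, s)
  continuous_toFun := (D.comparePoint Q R).continuous.comp
    (continuous_const.prodMk continuous_id)
  source' := by
    subst hg
    obtain ⟨⟨A, B, c, x⟩, rfl⟩ := Quot.exists_rep z
    refine (D.comparePoint_cls Q R c x ⟨hQ, hR⟩ 0).trans ((D.eval_slide_zero hQR x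
      (D.between_eq_arrow hQR hom c x ⟨hQ, hR⟩) (Hit.of_weight_pos hQ) _).trans ?_)
    exact congrArg (D.actMap _) (D.retract_cls Q c x hQ).symm
  target' := by
    obtain ⟨⟨A, B, c, x⟩, rfl⟩ := Quot.exists_rep z
    refine (D.comparePoint_cls Q R c x ⟨hQ, hR⟩ 1).trans
      (Eq.trans ?_ (D.retract_cls R c x hR).symm)
    simp only [slide_one]

theorem slidePath_cls (Q : C) {A B : C} (c : TimedChain A B) (x : D.obj A)
    (h : D.cls c x ∈ D.star Q) (s : 𝕀) :
    D.slidePath Q ⟨D.cls c x, h⟩ s = D.cls (slide Q s c) x := D.slidePoint_cls Q c x h s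

theorem comparePath_cls {Q R : C} (hQR : Q ≠ R) (hom : Nonempty (Q ⟶ R)) {A B : C}
    (c : TimedChain A B) (x : D.obj A) (hQ : D.cls c x ∈ D.star Q) (hR : D.cls c x ∈ D.star R)
    (g : Q ⟶ R) (hg : D.arrow hQR hom ⟨D.cls c x, hQ, hR⟩ = g) (s : 𝕀) :
    D.comparePath hQR hom (D.cls c x) hQ hR g hg s =
      D.eval R x (slide Q s c) (hit_slide.2 (Hit.of_weight_pos hR)) :=
  D.comparePoint_cls Q R c x ⟨hQ, hR⟩ s

section

variable {G : Type*} [Groupoid G]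

theorem map_slidePath_natural {obj : D.Hocolim → G} (M : Transport obj) {Q : C} {a b : D.star Q}
    (p : Path a b) :
    M.map ((p.map (D.retract Q).continuous).map (D.inc Q).continuous) ≫ M.map (D.slidePath Q b) =
      M.map (D.slidePath Q a) ≫ M.map (p.map continuous_subtype_val) :=
  M.map_unitSquare (Γ := fun z => D.slidePoint Q (p z.1, z.2))
    ((D.slidePoint Q).continuous.comp
      ((p.continuous.comp continuous_fst).prodMk continuous_snd))
    (fun s => (D.slidePath Q (p s)).source.symm) (fun _ => by rw [p.target]; rfl)
    (fun _ => by rw [p.source]; rfl) (fun s => (D.slidePath Q (p s)).target.symm)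

theorem map_comparePath_natural {Q R : C} {obj : D.obj R → G} (M : Transport obj) (hQR : Q ≠ R)
    (hom : Nonempty (Q ⟶ R)) {a b : D.Hocolim} (p : Path a b) (hQ : ∀ s, p s ∈ D.star Q)
    (hR : ∀ s, p s ∈ D.star R) (hQa hRa hQb hRb) (g : Q ⟶ R) (hga hgb) :
    M.map ((((Transport.liftPath p hQ).map (D.retract Q).continuous)).map
        (D.actMap g).continuous) ≫ M.map (D.comparePath hQR hom b hQb hRb g hgb) =
      M.map (D.comparePath hQR hom a hQa hRa g hga) ≫
        M.map ((Transport.liftPath p hR).map (D.retract R).continuous) := by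
  have hg : ∀ s, D.arrow hQR hom ⟨p s, hQ s, hR s⟩ = g := fun s =>
    (D.arrow_path hQR hom (Transport.liftPath (U := D.star Q ∩ D.star R) p fun s => ⟨hQ s, hR s⟩) s).trans hga
  exact M.map_unitSquare
    (Γ := fun z => D.comparePoint Q R (⟨p z.1, hQ z.1, hR z.1⟩, z.2))
    ((D.comparePoint Q R).continuous.comp
      (((p.continuous.comp continuous_fst).subtype_mk _).prodMk continuous_snd))
    (fun s => (D.comparePath hQR hom (p s) (hQ s) (hR s) g (hg s)).source.symm)
    (fun s => by simp only [p.target]; rfl) (fun s => by simp only [p.source]; rfl)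
    (fun s => (D.comparePath hQR hom (p s) (hQ s) (hR s) g (hg s)).target.symm)

/-- Sliding a word towards `Q` and then towards `R` acts continuously on the parameters. -/
theorem exists_slide_slide {Q R A B : C} (hom : Nonempty (Q ⟶ R)) {c : TimedChain A B}
    (h : PosAfter Q c) : ∃ (p : Quiver.Path A B) (τ : 𝕀 × 𝕀 → (Fin p.length → 𝕀)), Continuous τ ∧
      ∀ y, slide R y.2 (slide Q y.1 c) = ofTimes p (τ y) := by
  obtain ⟨τ, hτ, e⟩ := exists_slide_ofTimes Q c.toSigma.1 (Y := 𝕀 × 𝕀)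
    (τ := fun _ => c.toSigma.2) (s := Prod.fst) continuous_const continuous_fst
    fun _ => by rw [ofTimes_toSigma]; exact h
  obtain ⟨τ', hτ', e'⟩ := exists_slide_ofTimes R c.toSigma.1 hτ continuous_snd fun y => by
    rw [← e, ofTimes_toSigma]
    exact h.slide hom
  refine ⟨_, τ', hτ', fun y => ?_⟩
  rw [← e', ← e, ofTimes_toSigma]

theorem arrow_comp {Q R S : C} (hQR : Q ≠ R) (hRS : R ≠ S) (hQS : Q ≠ S) (hom : Nonempty (Q ⟶ R))
    (hom' : Nonempty (R ⟶ S)) (hom'' : Nonempty (Q ⟶ S)) (z : D.Hocolim) (hQ : z ∈ D.star Q)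
    (hR : z ∈ D.star R) (hS : z ∈ D.star S) :
    D.arrow hQS hom'' ⟨z, hQ, hS⟩ = D.arrow hQR hom ⟨z, hQ, hR⟩ ≫ D.arrow hRS hom' ⟨z, hR, hS⟩ := by
  obtain ⟨⟨A, B, c, x⟩, rfl⟩ := Quot.exists_rep z
  refine Option.some_injective _ ((D.between_eq_arrow hQS hom'' c x ⟨hQ, hS⟩).symm.trans ?_)
  exact between_comp hQR hRS (D.between_eq_arrow hQR hom c x ⟨hQ, hR⟩)
    (D.between_eq_arrow hRS hom' c x ⟨hR, hS⟩)

/-- The square `(s, s')` of words that slide by `s` towards `Q` and then by `s'` towards `R`,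
evaluated at `S`. -/
theorem map_comparePath_comp {Q R S : C} {obj : D.obj S → G} (M : Transport obj) (hQR : Q ≠ R)
    (hRS : R ≠ S) (hQS : Q ≠ S) (hom : Nonempty (Q ⟶ R)) (hom' : Nonempty (R ⟶ S))
    (hom'' : Nonempty (Q ⟶ S)) (z : D.Hocolim) (hQ : z ∈ D.star Q) (hR : z ∈ D.star R)
    (hS : z ∈ D.star S) (g : Q ⟶ R) (k : R ⟶ S) (hg) (hk) (hgk) :
    M.map ((D.comparePath hQR hom z hQ hR g hg).map (D.actMap k).continuous) ≫
        M.map (D.comparePath hRS hom' z hR hS k hk) =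
      M.map (D.compPath g k (D.retract Q ⟨z, hQ⟩)) ≫
        M.map (D.comparePath hQS hom'' z hQ hS (g ≫ k) hgk) := by
  obtain ⟨⟨A, B, c, x⟩, rfl⟩ := Quot.exists_rep z
  obtain ⟨p, τ, hτ, e⟩ := exists_slide_slide hom (PosAfter.of_weight_pos hQ)
  have hg' := D.between_eq_arrow hQR hom c x ⟨hQ, hR⟩
  have hk' := D.between_eq_arrow hRS hom' c x ⟨hR, hS⟩
  rw [show D.arrow hQR hom ⟨D.cls c x, hQ, hR⟩ = g from hg] at hg'
  rw [show D.arrow hRS hom' ⟨D.cls c x, hR, hS⟩ = k from hk] at hk'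
  have hS' : ∀ y : 𝕀 × 𝕀, (slide R y.2 (slide Q y.1 c)).Hit S := fun y =>
    hit_slide.2 (hit_slide.2 (Hit.of_weight_pos hS))
  refine M.map_unitSquare (Γ := fun y => D.eval S x (slide R y.2 (slide Q y.1 c)) (hS' y))
    ?_ (fun s => ?_) (fun s => ?_) (fun s => ?_) (fun s => ?_)
  · refine (D.continuous_eval_ofTimes S p τ (fun _ => x) hτ continuous_const
      fun y => by rw [← e]; exact hS' y).congr fun y => ?_
    congr 1
    exact (e y).symm
  · refine (congrArg (D.actMap k) (D.comparePath_cls hQR hom c x hQ hR g hg s)).trans ?_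
    exact (D.eval_slide_zero hRS x (by rw [between_slide]; exact hk') _ _).symm
  · refine (D.comparePath_cls hRS hom' c x hR hS k hk s).trans ?_
    simp only [slide_one]
  · refine Eq.trans ?_ (D.eval_slide_slide hQR hRS x hg' hk' (Hit.of_weight_pos hQ) s _).symm
    exact congrArg (D.act k (cons s g nil)) (D.retract_cls Q c x hQ)
  · refine (D.comparePath_cls hQS hom'' c x hQ hS (g ≫ k) hgk s).trans ?_
    simp only [slide_one]

/-- The square `(s, s')` of words that slide by `s` towards `Q` and then by `s'` towards `R`,
in the homotopy colimit. -/
theorem map_slidePath_compare {obj : D.Hocolim → G} (M : Transport obj) {Q R : C} (hQR : Q ≠ R)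
    (hom : Nonempty (Q ⟶ R)) (z : D.Hocolim) (hQ : z ∈ D.star Q) (hR : z ∈ D.star R)
    (g : Q ⟶ R) (hg) :
    M.map ((D.comparePath hQR hom z hQ hR g hg).map (D.inc R).continuous) ≫
        M.map (D.slidePath R ⟨z, hR⟩) =
      M.map (D.edgePath g (D.retract Q ⟨z, hQ⟩)) ≫ M.map (D.slidePath Q ⟨z, hQ⟩) := by
  obtain ⟨⟨A, B, c, x⟩, rfl⟩ := Quot.exists_rep z
  obtain ⟨p, τ, hτ, e⟩ := exists_slide_slide hom (PosAfter.of_weight_pos hQ)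
  have hg' := D.between_eq_arrow hQR hom c x ⟨hQ, hR⟩
  rw [show D.arrow hQR hom ⟨D.cls c x, hQ, hR⟩ = g from hg] at hg'
  refine M.map_unitSquare (Γ := fun y => D.cls (slide R y.2 (slide Q y.1 c)) x)
    ?_ (fun s => ?_) (fun s => ?_) (fun s => ?_) (fun s => ?_)
  · refine ((D.continuous_cls A B).comp (((isOpenEmbedding_ofTimes p).continuous.comp hτ).prodMk
      (continuous_const (y := x)))).congr fun y => ?_
    change D.cls (ofTimes p (τ y)) x = _
    rw [← e]
  · refine (congrArg (D.inc R) (D.comparePath_cls hQR hom c x hQ hR g hg s)).trans ?_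
    exact (D.cls_slide_zero _ x _).symm
  · refine (D.slidePath_cls R c x hR s).trans ?_
    simp only [slide_one]
  · refine Eq.trans ?_ (D.cls_slide_slide hQR x hg' (Hit.of_weight_pos hQ) s).symm
    exact congrArg (D.cls (cons s g nil)) (D.retract_cls Q c x hQ)
  · refine (D.slidePath_cls Q c x hQ s).trans ?_
    simp only [slide_one]

end

end HDiagram

theorem Transport.map_const_comp {W : Type*} [TopologicalSpace W] {G : Type*} [Groupoid G]
    {obj : W → G} (M : Transport obj) {a b c : W} {p : Path a b} {q : Path b c} {r : Path a c}
    (hp : ∀ s, p s = a) (hq : ∀ s, q s = b) (hr : ∀ s, r s = a) :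
    M.map p ≫ M.map q = M.map r := by
  obtain rfl : b = a := p.target.symm.trans (hp 1)
  obtain rfl : c = b := q.target.symm.trans (hq 1)
  rw [M.map_const p hp, M.map_const q hq, M.map_const r hr, Category.comp_id]

namespace HDiagram

open TimedChain

variable {C : Type w} [Category.{v} C] (D : HDiagram.{w, v, u} C)

/-! ### Cocones of transports -/

/-- A cocone under a homotopy diagram `D` with vertex a groupoid `G`: transports on the
spaces of the diagram, and natural morphisms along the structure maps that respect composition
up to the transport along the homotopy that compares the composites. -/
structure GroupoidCocone (G : Type*) [Groupoid G] where
  /-- the object attached to a point -/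
  obj : ∀ A, D.obj A → G
  /-- the transport on a space of the diagram -/
  transport : ∀ A, Transport (obj A)
  /-- the morphism attached to a structure map -/
  edge : ∀ {A B : C} (f : A ⟶ B) (x : D.obj A), obj A x ⟶ obj B (D.actMap f x)
  edge_natural : ∀ {A B : C} (f : A ⟶ B) {x y : D.obj A} (p : Path x y),
    (transport A).map p ≫ edge f y =
      edge f x ≫ (transport B).map (p.map (D.actMap f).continuous)
  edge_comp : ∀ {A B E : C} (f : A ⟶ B) (g : B ⟶ E) (x : D.obj A),
    edge f x ≫ edge g (D.actMap f x) ≫ (transport E).map (D.compPath f g x) = edge (f ≫ g) x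

/-- Among the objects whose stars contain a given point there is a first one. -/
theorem exists_base (z : D.Hocolim) :
    ∃ Q, z ∈ D.star Q ∧ ∀ R, z ∈ D.star R → Nonempty (Q ⟶ R) := by
  obtain ⟨⟨A, B, c, x⟩, rfl⟩ := Quot.exists_rep z
  change ∃ Q, 0 < weight Q c ∧ ∀ R, 0 < weight R c → Nonempty (Q ⟶ R)
  induction c with
  | nil =>
    refine ⟨A, by rw [weight, if_pos rfl]; exact one_pos, fun R hR => ?_⟩
    exact ⟨eqToHom (Hit.of_weight_pos hR : A = R)⟩
  | @cons B B' t f c ih =>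
    rcases eq_or_lt_of_le t.2.1 with h | h
    · refine ⟨B', ?_, fun R hR => ?_⟩
      · rw [weight, if_pos rfl, ← h]
        norm_num
      · by_cases e : B' = R
        · exact ⟨eqToHom e⟩
        · rw [weight, if_neg e, ← h] at hR
          norm_num at hR
    · obtain ⟨Q, hQ, hmin⟩ := ih
      refine ⟨Q, ?_, fun R hR => ?_⟩
      · rw [weight]
        have := sub_nonneg.2 t.2.2
        split_ifs <;> positivity
      · by_cases e : B' = R
        · subst e
          exact ⟨(Hit.of_weight_pos hQ).nonempty.some ≫ f⟩
        · rw [weight, if_neg e, mul_zero, add_zero] at hR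
          exact hmin R (pos_of_mul_pos_right hR t.2.1)

/-- The smallest object that has positive weight at a point of the homotopy colimit. -/
noncomputable def base (z : D.Hocolim) : C := (D.exists_base z).choose

theorem mem_star_base (z : D.Hocolim) : z ∈ D.star (D.base z) := (D.exists_base z).choose_spec.1

theorem base_le {z : D.Hocolim} {R : C} (h : z ∈ D.star R) : Nonempty (D.base z ⟶ R) :=
  (D.exists_base z).choose_spec.2 R h

/-- An edge is divided at its midpoint into a part within the star of its source object `A` and a part
within the star of its target object `B`. -/
theorem exists_edgePath_split {A B : C} (f : A ⟶ B) (x : D.obj A) :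
    ∃ (m : 𝕀) (r₁ : Path (D.inc B (D.actMap f x)) (D.cls (cons m f nil) x))
      (r₂ : Path (D.cls (cons m f nil) x) (D.inc A x)), r₁.trans r₂ = D.edgePath f x ∧
      (∀ s, ∃ t < 1, r₁ s = D.cls (cons t f nil) x) ∧
      (∀ s, ∃ t > 0, r₂ s = D.cls (cons t f nil) x) ∧ 0 < m ∧ m < 1 := by
  refine ⟨⟨1 / 2, by norm_num, by norm_num⟩, (D.edgePath f x).firstHalf,
    (D.edgePath f x).secondHalf, (D.edgePath f x).firstHalf_trans_secondHalf,
    fun s => ⟨_, ?_, rfl⟩, fun s => ⟨_, ?_, rfl⟩, ?_, ?_⟩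
  · rw [← Subtype.coe_lt_coe, coe_convexComb]
    have := s.2.2
    simp only [Set.Icc.coe_zero, Set.Icc.coe_one]
    linarith
  · rw [gt_iff_lt, ← Subtype.coe_lt_coe, coe_convexComb]
    have := s.2.1
    simp only [Set.Icc.coe_zero, Set.Icc.coe_one]
    linarith
  · rw [← Subtype.coe_lt_coe]
    norm_num
  · rw [← Subtype.coe_lt_coe]
    norm_num

namespace GroupoidCocone

variable {D} [IsAcyclicCategory C] {G : Type*} [Groupoid G] (F : D.GroupoidCocone G)

open Classical in
/-- The comparison of the transports over the vertex spaces of `Q` and `R` at a point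
of the intersection of the open stars. -/
noncomputable def link (Q R : C) (hom : Nonempty (Q ⟶ R)) (z : D.Hocolim) (hQ : z ∈ D.star Q)
    (hR : z ∈ D.star R) : F.obj Q (D.retract Q ⟨z, hQ⟩) ⟶ F.obj R (D.retract R ⟨z, hR⟩) :=
  if e : Q = R then eqToHom (by subst e; rfl) else
    F.edge (D.arrow e hom ⟨z, hQ, hR⟩) _ ≫
      (F.transport R).map (D.comparePath e hom z hQ hR _ rfl)

theorem link_self (Q : C) (hom : Nonempty (Q ⟶ Q)) (z : D.Hocolim) (hQ : z ∈ D.star Q)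
    (hR : z ∈ D.star Q) : F.link Q Q hom z hQ hR = 𝟙 _ := by
  rw [link, dif_pos rfl, eqToHom_refl]

theorem link_of_ne {Q R : C} (hQR : Q ≠ R) (hom : Nonempty (Q ⟶ R)) (z : D.Hocolim)
    (hQ : z ∈ D.star Q) (hR : z ∈ D.star R) (g : Q ⟶ R)
    (hg : D.arrow hQR hom ⟨z, hQ, hR⟩ = g) :
    F.link Q R hom z hQ hR =
      F.edge g _ ≫ (F.transport R).map (D.comparePath hQR hom z hQ hR g hg) := by
  subst hg
  rw [link, dif_neg hQR]

theorem link_comp {Q R S : C} (hom : Nonempty (Q ⟶ R)) (hom' : Nonempty (R ⟶ S))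
    (hom'' : Nonempty (Q ⟶ S)) (z : D.Hocolim) (hQ : z ∈ D.star Q) (hR : z ∈ D.star R)
    (hS : z ∈ D.star S) :
    F.link Q R hom z hQ hR ≫ F.link R S hom' z hR hS = F.link Q S hom'' z hQ hS := by
  by_cases hQR : Q = R
  · subst hQR
    rw [link_self, Category.id_comp]
  by_cases hRS : R = S
  · subst hRS
    rw [link_self, Category.comp_id]
  have hQS : Q ≠ S := by
    rintro rfl
    exact hQR (IsAcyclicCategory.antisymm hom hom')
  have hgk := D.arrow_comp hQR hRS hQS hom hom' hom'' z hQ hR hS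
  rw [F.link_of_ne hQR hom z hQ hR _ rfl, F.link_of_ne hRS hom' z hR hS _ rfl,
    F.link_of_ne hQS hom'' z hQ hS _ hgk, ← F.edge_comp]
  simp only [Category.assoc]
  rw [← D.map_comparePath_comp (F.transport S) hQR hRS hQS hom hom' hom'' z hQ hR hS _ _ rfl rfl,
    ← reassoc_of% F.edge_natural]

theorem link_natural {Q R : C} (hom : Nonempty (Q ⟶ R)) {a b : D.Hocolim} (p : Path a b)
    (hQ : ∀ s, p s ∈ D.star Q) (hR : ∀ s, p s ∈ D.star R) (hQa hRa hQb hRb) :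
    (F.transport Q).map ((Transport.liftPath p hQ).map (D.retract Q).continuous) ≫
        F.link Q R hom b hQb hRb =
      F.link Q R hom a hQa hRa ≫
        (F.transport R).map ((Transport.liftPath p hR).map (D.retract R).continuous) := by
  by_cases hQR : Q = R
  · subst hQR
    rw [link_self, link_self, Category.id_comp, Category.comp_id]
  have hb : D.arrow hQR hom ⟨b, hQb, hRb⟩ = D.arrow hQR hom ⟨a, hQa, hRa⟩ := by
    have := D.arrow_path hQR hom
      (Transport.liftPath (U := D.star Q ∩ D.star R) p fun s => ⟨hQ s, hR s⟩) 1
    rwa [Path.target] at this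
  rw [F.link_of_ne hQR hom a hQa hRa _ rfl, F.link_of_ne hQR hom b hQb hRb _ hb,
    ← Category.assoc, F.edge_natural, Category.assoc, Category.assoc,
    ← D.map_comparePath_natural (F.transport R) hQR hom p hQ hR hQa hRa hQb hRb _ rfl hb]

/-- The object attached by the extension of a cocone to a point of the homotopy colimit. -/
noncomputable def pointObj (z : D.Hocolim) : G :=
  F.obj (D.base z) (D.retract (D.base z) ⟨z, D.mem_star_base z⟩)

/-- The comparison of the object attached to a point of the open star of `Q` with the object
attached to its retraction. -/
noncomputable def toStar (Q : C) (z : D.Hocolim) (hQ : z ∈ D.star Q) :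
    F.pointObj z ⟶ F.obj Q (D.retract Q ⟨z, hQ⟩) :=
  F.link (D.base z) Q (D.base_le hQ) z (D.mem_star_base z) hQ

theorem toStar_link {Q R : C} (hom : Nonempty (Q ⟶ R)) (z : D.Hocolim) (hQ : z ∈ D.star Q)
    (hR : z ∈ D.star R) :
    F.toStar Q z hQ ≫ F.link Q R hom z hQ hR = F.toStar R z hR := F.link_comp _ _ _ _ _ _ _

/-- The transport on the open star of `Q` that is given by the retraction. -/
noncomputable def starTransport (Q : C) :
    Transport fun z : D.star Q => F.pointObj z where
  map {a b} p := F.toStar Q a a.2 ≫ (F.transport Q).map (p.map (D.retract Q).continuous) ≫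
    inv (F.toStar Q b b.2)
  map_trans p q := by simp [Path.map_trans, Transport.map_trans]
  map_homotopic h := by rw [(F.transport Q).map_homotopic (h.map (D.retract Q))]

theorem loc_starTransport (Q : C) {a b : D.Hocolim} (p : Path a b) (hp : ∀ s, p s ∈ D.star Q)
    (ha : a ∈ D.star Q) (hb : b ∈ D.star Q) :
    Transport.loc F.starTransport Q p hp = F.toStar Q a ha ≫
      (F.transport Q).map ((Transport.liftPath p hp).map (D.retract Q).continuous) ≫
        inv (F.toStar Q b hb) := rfl

theorem loc_starTransport_eq_of_hom {Q R : C} (hom : Nonempty (Q ⟶ R)) {a b : D.Hocolim}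
    (p : Path a b) (hQ : ∀ s, p s ∈ D.star Q) (hR : ∀ s, p s ∈ D.star R) :
    Transport.loc F.starTransport Q p hQ = Transport.loc F.starTransport R p hR := by
  have hQa : a ∈ D.star Q := by simpa using hQ 0
  have hQb : b ∈ D.star Q := by simpa using hQ 1
  have hRa : a ∈ D.star R := by simpa using hR 0
  have hRb : b ∈ D.star R := by simpa using hR 1
  rw [F.loc_starTransport Q p hQ hQa hQb, F.loc_starTransport R p hR hRa hRb,
    ← F.toStar_link hom a hQa hRa, ← F.toStar_link hom b hQb hRb, Category.assoc,
    ← reassoc_of% F.link_natural hom p hQ hR hQa hRa hQb hRb]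
  simp

theorem loc_starTransport_eq (Q R : C) {a b : D.Hocolim} (p : Path a b)
    (hQ : ∀ s, p s ∈ D.star Q) (hR : ∀ s, p s ∈ D.star R) :
    Transport.loc F.starTransport Q p hQ = Transport.loc F.starTransport R p hR := by
  have h : Nonempty (Q ⟶ R) ∨ Nonempty (R ⟶ Q) := by
    have hQ0 := hQ 0
    have hR0 := hR 0
    obtain ⟨⟨A, B, c, x⟩, e⟩ := Quot.exists_rep (p 0)
    rw [← e] at hQ0 hR0
    exact Hit.comparable (Hit.of_weight_pos hQ0) (Hit.of_weight_pos hR0)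
  rcases h with h | h
  · exact F.loc_starTransport_eq_of_hom h p hQ hR
  · exact (F.loc_starTransport_eq_of_hom h p hR hQ).symm

/-- A cocone of transports extends to the homotopy colimit. -/
theorem exists_extension : ∃ (obj : D.Hocolim → G) (Φ : Transport obj)
    (η : ∀ A (x : D.obj A), F.obj A x ⟶ obj (D.inc A x)),
    (∀ A {x y : D.obj A} (p : Path x y), (F.transport A).map p ≫ η A y =
      η A x ≫ Φ.map (p.map (D.inc A).continuous)) ∧
    ∀ {A B : C} (f : A ⟶ B), A ≠ B → ∀ x,
      F.edge f x ≫ η B (D.actMap f x) ≫ Φ.map (D.edgePath f x) = η A x := by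
  obtain ⟨Φ, hΦ⟩ := Transport.exists_glue F.starTransport D.isOpen_star D.exists_mem_star
    F.loc_starTransport_eq
  have hρ : ∀ A (x : D.obj A), D.retract A ⟨D.inc A x, D.inc_mem_star A x⟩ = x := fun A x =>
    D.retract_cls A nil x _
  let cp : ∀ A (x : D.obj A), Path x (D.retract A ⟨D.inc A x, D.inc_mem_star A x⟩) := fun A x =>
    (Path.refl x).cast rfl (hρ A x)
  refine ⟨F.pointObj, Φ, fun A x => (F.transport A).map (cp A x) ≫
    inv (F.toStar A (D.inc A x) (D.inc_mem_star A x)), fun A x y p => ?_,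
    fun {A B} f hAB x => ?_⟩
  · have hp : ∀ s, (p.map (D.inc A).continuous) s ∈ D.star A := fun s => D.inc_mem_star A (p s)
    have key : Φ.map (p.map (D.inc A).continuous) = _ := (hΦ A _ hp).trans
      (F.loc_starTransport A _ hp (D.inc_mem_star A x) (D.inc_mem_star A y))
    rw [key]
    simp only [Category.assoc, IsIso.inv_hom_id_assoc]
    rw [← Category.assoc, ← Category.assoc]
    congr 1
    -- Both paths are reparametrizations of `p`.
    rw [← Transport.map_trans, ← Transport.map_trans]
    refine (F.transport A).map_homotopic ?_
    have e : ∀ {x' y' : D.obj A} (hx : x' = x) (hy : y' = y) (q : Path x' y'),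
        (∀ s, q s = p s) → (p.trans ((Path.refl y).cast rfl hy)).Homotopic
          (((Path.refl x).cast rfl hx).trans q) := by
      rintro _ _ rfl rfl q hq
      obtain rfl : q = p := Path.ext (funext hq)
      exact (Path.Homotopic.trans ⟨Path.Homotopy.transRefl q⟩
        (Path.Homotopic.symm ⟨Path.Homotopy.reflTrans q⟩))
    exact e (hρ A x) (hρ A y) _ fun s => hρ A (p s)
  · have hB : ∀ t : 𝕀, t < 1 → D.cls (cons t f nil) x ∈ D.star B := fun t ht => by
      rw [cls_mem_star, weight, weight, if_neg hAB, if_pos rfl]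
      have : (t : ℝ) < 1 := ht
      linarith
    have hA : ∀ t : 𝕀, 0 < t → D.cls (cons t f nil) x ∈ D.star A := fun t ht => by
      rw [cls_mem_star, weight, weight, if_pos rfl, if_neg (Ne.symm hAB)]
      have : (0 : ℝ) < t := ht
      linarith
    have rA : ∀ t h, D.retract A ⟨D.cls (cons t f nil) x, h⟩ = x := fun t h =>
      (D.retract_cls A _ x h).trans (D.eval_cons_of_ne _ _ _ _ _ (Ne.symm hAB))
    have rB : ∀ t h, D.retract B ⟨D.cls (cons t f nil) x, h⟩ = D.actMap f x := fun t h =>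
      (D.retract_cls B _ x h).trans (D.eval_cons_self _ _ _ _ _)
    obtain ⟨m, r₁, r₂, hr, h₁, h₂, hm0, hm1⟩ := D.exists_edgePath_split f x
    have hmA : D.cls (cons m f nil) x ∈ D.star A := hA m hm0
    have hmB : D.cls (cons m f nil) x ∈ D.star B := hB m hm1
    have h1 : ∀ s, r₁ s ∈ D.star B := fun s => by
      obtain ⟨t, ht, e⟩ := h₁ s
      rw [e]
      exact hB t ht
    have h2 : ∀ s, r₂ s ∈ D.star A := fun s => by
      obtain ⟨t, ht, e⟩ := h₂ s
      rw [e]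
      exact hA t ht
    have harr : D.arrow hAB ⟨f⟩ ⟨D.cls (cons m f nil) x, hmA, hmB⟩ = f := by
      refine Option.some_injective _ ((D.between_eq_arrow hAB ⟨f⟩ _ x _).symm.trans ?_)
      simp [between, leg]
    let q : Path x (D.retract A ⟨D.cls (cons m f nil) x, hmA⟩) :=
      (Path.refl x).cast rfl (rA m hmA)
    have e1 : F.edge f x ≫ (F.transport B).map (q.map (D.actMap f).continuous) =
        (F.transport A).map q ≫ F.edge f _ := (F.edge_natural f q).symm
    have e2 : (F.transport B).map (cp B (D.actMap f x)) ≫ (F.transport B).map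
        ((Transport.liftPath r₁ h1).map (D.retract B).continuous) =
        (F.transport B).map (q.map (D.actMap f).continuous) ≫ (F.transport B).map
          (D.comparePath hAB ⟨f⟩ _ hmA hmB f harr) := by
      refine ((F.transport B).map_const_comp (r := (Path.refl _).cast rfl (rB m hmB))
        (fun s => rfl) (fun s => ?_) fun s => rfl).trans
          ((F.transport B).map_const_comp (fun s => rfl) (fun s => ?_) fun s => rfl).symm
      · refine Eq.trans ?_ (hρ B (D.actMap f x)).symm
        obtain ⟨t, ht, e⟩ := h₁ s
        change D.retract B ⟨r₁ s, h1 s⟩ = _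
        simp only [e]
        exact rB t _
      · refine (D.comparePath_cls hAB ⟨f⟩ _ x hmA hmB f harr s).trans ?_
        exact (D.eval_cons_self _ _ _ _ _).trans (congrArg (D.actMap f) (rA m hmA).symm)
    have e3 : (F.transport A).map q ≫ (F.transport A).map
        ((Transport.liftPath r₂ h2).map (D.retract A).continuous) =
        (F.transport A).map (cp A x) := by
      refine (F.transport A).map_const_comp (fun s => rfl) (fun s => ?_) fun s => rfl
      refine Eq.trans ?_ (rA m hmA).symm
      obtain ⟨t, ht, e⟩ := h₂ s
      change D.retract A ⟨r₂ s, h2 s⟩ = _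
      simp only [e]
      exact rA t _
    rw [← hr, Φ.map_trans, hΦ B _ h1, hΦ A _ h2,
      F.loc_starTransport B _ h1 (D.inc_mem_star B _) hmB,
      F.loc_starTransport A _ h2 hmA (D.inc_mem_star A _), ← F.toStar_link ⟨f⟩ _ hmA hmB,
      F.link_of_ne hAB ⟨f⟩ _ hmA hmB f harr]
    simp only [Category.assoc, IsIso.inv_hom_id_assoc, IsIso.inv_comp]
    rw [reassoc_of% e2, reassoc_of% e1]
    simp only [IsIso.hom_inv_id_assoc]
    rw [reassoc_of% e3]

end GroupoidCocone

variable [IsAcyclicCategory C]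

/-- Natural isomorphisms of transports on the homotopy colimit are determined by their
restrictions to the vertex spaces, and any family of natural morphisms on the vertex spaces that is
compatible with the edges extends. -/
theorem exists_isNatural {G : Type*} [Groupoid G] {obj obj' : D.Hocolim → G} (Φ : Transport obj)
    (Ψ : Transport obj') (α : ∀ A (x : D.obj A), obj (D.inc A x) ⟶ obj' (D.inc A x))
    (hα : ∀ A, (Φ.comap (D.inc A)).IsNatural (Ψ.comap (D.inc A)) (α A))
    (he : ∀ {A B : C} (f : A ⟶ B), A ≠ B → ∀ x,
      Φ.map (D.edgePath f x) ≫ α A x = α B (D.actMap f x) ≫ Ψ.map (D.edgePath f x)) :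
    ∃ β, Φ.IsNatural Ψ β := by
  let β : ∀ Q (z : D.Hocolim), z ∈ D.star Q → (obj z ⟶ obj' z) := fun Q z hQ =>
    inv (Φ.map (D.slidePath Q ⟨z, hQ⟩)) ≫ α Q _ ≫ Ψ.map (D.slidePath Q ⟨z, hQ⟩)
  -- The morphism `β` does not depend on the star used to define it.
  have hβ : ∀ Q R z hQ hR, Nonempty (Q ⟶ R) → β Q z hQ = β R z hR := by
    intro Q R z hQ hR hom
    by_cases hQR : Q = R
    · subst hQR
      rfl
    have e1 := D.map_slidePath_compare Φ hQR hom z hQ hR _ rfl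
    have e2 := D.map_slidePath_compare Ψ hQR hom z hQ hR _ rfl
    have e3 := he (D.arrow hQR hom ⟨z, hQ, hR⟩) hQR (D.retract Q ⟨z, hQ⟩)
    have e4 := hα R (D.comparePath hQR hom z hQ hR _ rfl)
    simp only [Transport.comap_map] at e4
    change inv _ ≫ _ = inv _ ≫ _
    rw [IsIso.inv_comp_eq, ← cancel_epi (Φ.map (D.edgePath _ _)), reassoc_of% e3, ← e2,
      ← reassoc_of% e4, ← reassoc_of% e1, IsIso.hom_inv_id_assoc]
  have hβ' : ∀ Q R z hQ hR, β Q z hQ = β R z hR := by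
    intro Q R z hQ hR
    have h : Nonempty (Q ⟶ R) ∨ Nonempty (R ⟶ Q) := by
      obtain ⟨⟨A, B, c, x⟩, rfl⟩ := Quot.exists_rep z
      exact Hit.comparable (Hit.of_weight_pos hQ) (Hit.of_weight_pos hR)
    rcases h with h | h
    · exact hβ Q R z hQ hR h
    · exact (hβ R Q z hR hQ h).symm
  refine ⟨fun z => β (D.base z) z (D.mem_star_base z), ?_⟩
  refine Transport.isNatural_of_cover (α := fun z => β (D.base z) z (D.mem_star_base z)) D.star
    D.isOpen_star D.exists_mem_star fun Q {a b} p hp => ?_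
  have ha : a ∈ D.star Q := by simpa using hp 0
  have hb : b ∈ D.star Q := by simpa using hp 1
  rw [hβ' _ Q a _ ha, hβ' _ Q b _ hb]
  have e1 := D.map_slidePath_natural Φ (Transport.liftPath p hp)
  have e2 := D.map_slidePath_natural Ψ (Transport.liftPath p hp)
  have e3 := hα Q ((Transport.liftPath p hp).map (D.retract Q).continuous)
  have e4 : (Transport.liftPath p hp).map continuous_subtype_val = p := rfl
  rw [e4] at e1 e2
  simp only [Transport.comap_map] at e3
  change _ ≫ inv _ ≫ _ ≫ _ = (inv _ ≫ _ ≫ _) ≫ _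
  rw [← cancel_epi (Φ.map (D.slidePath Q ⟨a, ha⟩)), ← reassoc_of% e1]
  simp only [IsIso.hom_inv_id_assoc, Category.assoc]
  rw [reassoc_of% e3, e2]

end HDiagram

/-- The constant path between two equal points. -/
def Path.ofEq {W : Type*} [TopologicalSpace W] {a b : W} (h : a = b) : Path a b :=
  (Path.refl a).cast rfl h.symm

/-- Paths with the same values have the same transport, up to constant paths. -/
theorem Transport.map_ofEq_comp {W : Type*} [TopologicalSpace W] {G : Type*} [Groupoid G]
    {obj : W → G} (M : Transport obj) {a b a' b' : W} (ha : a = a') (hb : b = b') (p : Path a b)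
    (p' : Path a' b') (h : ∀ s, p s = p' s) :
    M.map (Path.ofEq ha) ≫ M.map p' = M.map p ≫ M.map (Path.ofEq hb) :=
  M.map_unitSquare (Γ := fun z => p z.2) (p.continuous.comp continuous_snd)
    (fun _ => p.source.symm) (fun s => (h s).symm) (fun _ => rfl) (fun _ => p.target.symm)

namespace HDiagram

open TimedChain

variable {C : Type w} [Category.{v} C] (D : HDiagram.{w, v, u} C)

theorem actMap_id {A : C} (x : D.obj A) : D.actMap (𝟙 A) x = x := D.act_id x

/-- The homotopy `t ↦ D(g, t, f; x)`, as a path that ends at `D(w; x)` for `w = g ∘ f`. -/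
def compPathTo {A B E : C} (f : A ⟶ B) (g : B ⟶ E) {w : A ⟶ E} (hw : f ≫ g = w) (x : D.obj A) :
    Path (D.actMap g (D.actMap f x)) (D.actMap w x) :=
  (D.compPath f g x).cast rfl (by rw [hw])

theorem compPathTo_id_right {A B : C} (f : A ⟶ B) {w : A ⟶ B} (hw : f ≫ 𝟙 B = w) (x : D.obj A)
    (t : 𝕀) : D.compPathTo f (𝟙 B) hw x t = D.actMap (𝟙 B) (D.actMap f x) :=
  (D.act_last_id t f nil x).trans (D.actMap_id _).symm

theorem compPathTo_id_left {A B : C} (f : A ⟶ B) {w : A ⟶ B} (hw : 𝟙 A ≫ f = w) (x : D.obj A)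
    (t : 𝕀) : D.compPathTo (𝟙 A) f hw x t = D.actMap f (D.actMap (𝟙 A) x) :=
  have h : D.compPathTo (𝟙 A) f hw x t = D.actMap f x := D.act_first_id f nil t x
  h.trans (congrArg (D.actMap f) (D.actMap_id x).symm)

section

variable {G : Type*} [Groupoid G]

theorem map_compPathTo_natural {A B E : C} {obj : D.obj E → G} (M : Transport obj) (f : A ⟶ B)
    (g : B ⟶ E) {w : A ⟶ E} (hw : f ≫ g = w) {x y : D.obj A} (p : Path x y) :
    M.map ((p.map (D.actMap f).continuous).map (D.actMap g).continuous) ≫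
        M.map (D.compPathTo f g hw y) =
      M.map (D.compPathTo f g hw x) ≫ M.map (p.map (D.actMap w).continuous) := by
  subst hw
  exact D.map_compPath_natural M f g p

theorem map_compPathTo_comp {A B E F : C} {obj : D.obj F → G} (M : Transport obj) {f : A ⟶ B}
    {g : B ⟶ E} {h : E ⟶ F} {fg : A ⟶ E} {gh : B ⟶ F} {w : A ⟶ F} (hfg : f ≫ g = fg)
    (hgh : g ≫ h = gh) (hw : f ≫ gh = w) (hw' : fg ≫ h = w) (x : D.obj A) :
    M.map (D.compPathTo g h hgh (D.actMap f x)) ≫ M.map (D.compPathTo f gh hw x) =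
      M.map ((D.compPathTo f g hfg x).map (D.actMap h).continuous) ≫
        M.map (D.compPathTo fg h hw' x) := by
  subst hfg hgh hw
  exact D.map_compPath_comp M f g h x

end

/-! ### Data on vertices and edges -/

/-- A transport over the space of vertices `D_o`, and an identification along the edges, that is the
points of `D_l`, of the objects attached to the two ends of an edge. -/
structure EdgeData {o l : C} (d₀ d₁ : l ⟶ o) (G : Type*) [Groupoid G] where
  /-- the object attached to a vertex -/
  obj : D.obj o → G
  /-- the transport on the space of vertices -/
  transport : Transport obj
  /-- the morphism attached to an edge -/
  link : ∀ y : D.obj l, obj (D.actMap d₀ y) ⟶ obj (D.actMap d₁ y)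
  link_natural : ∀ {y y' : D.obj l} (p : Path y y'),
    transport.map (p.map (D.actMap d₀).continuous) ≫ link y' =
      link y ≫ transport.map (p.map (D.actMap d₁).continuous)

namespace EdgeData

variable {D} {o l : C} {d₀ d₁ : l ⟶ o} {G : Type*} [Groupoid G] (F : D.EdgeData d₀ d₁ G)

/-- The morphism that the edge `h : A ⟶ l` of a point `x` of `D_A` gives between the objects attached
to the vertices `w` and `w'` of `x`. -/
noncomputable def face {A : C} (x : D.obj A) (h : A ⟶ l) {w w' : A ⟶ o} (hw : h ≫ d₀ = w)
    (hw' : h ≫ d₁ = w') : F.obj (D.actMap w x) ⟶ F.obj (D.actMap w' x) :=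
  inv (F.transport.map (D.compPathTo h d₀ hw x)) ≫ F.link (D.actMap h x) ≫
    F.transport.map (D.compPathTo h d₁ hw' x)

theorem face_natural {A : C} {x y : D.obj A} (p : Path x y) (h : A ⟶ l) {w w' : A ⟶ o}
    (hw : h ≫ d₀ = w) (hw' : h ≫ d₁ = w') :
    F.transport.map (p.map (D.actMap w).continuous) ≫ F.face y h hw hw' =
      F.face x h hw hw' ≫ F.transport.map (p.map (D.actMap w').continuous) := by
  have e₀ := D.map_compPathTo_natural F.transport h d₀ hw p
  have e₁ := D.map_compPathTo_natural F.transport h d₁ hw' p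
  have e := F.link_natural (p.map (D.actMap h).continuous)
  unfold face
  rw [← cancel_epi (F.transport.map (D.compPathTo h d₀ hw x)), ← reassoc_of% e₀]
  simp only [Category.assoc, IsIso.hom_inv_id_assoc]
  rw [reassoc_of% e, e₁]

theorem face_comp {A B : C} (f : A ⟶ B) (x : D.obj A) (h : B ⟶ l) {w w' : B ⟶ o}
    (hw : h ≫ d₀ = w) (hw' : h ≫ d₁ = w') {fh : A ⟶ l} (hfh : f ≫ h = fh) {v v' : A ⟶ o}
    (hv : f ≫ w = v) (hv' : f ≫ w' = v') (hhv : fh ≫ d₀ = v) (hhv' : fh ≫ d₁ = v') :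
    F.transport.map (D.compPathTo f w hv x) ≫ F.face x fh hhv hhv' =
      F.face (D.actMap f x) h hw hw' ≫ F.transport.map (D.compPathTo f w' hv' x) := by
  have e₀ := D.map_compPathTo_comp F.transport hfh hw hv hhv x
  have e₁ := D.map_compPathTo_comp F.transport hfh hw' hv' hhv' x
  have e := F.link_natural (D.compPathTo f h hfh x)
  unfold face
  rw [← cancel_epi (F.transport.map (D.compPathTo h d₀ hw (D.actMap f x))), reassoc_of% e₀]
  simp only [Category.assoc, IsIso.hom_inv_id_assoc]
  rw [reassoc_of% e, e₁]

/-- The objects attached to the vertices of `x` can be identified with one object, compatibly with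
all the edges of `x`. -/
def HasCone {A : C} (x : D.obj A) : Prop :=
  ∃ (P : G) (b : ∀ w : A ⟶ o, P ⟶ F.obj (D.actMap w x)),
    ∀ (h : A ⟶ l) {w w' : A ⟶ o} (hw : h ≫ d₀ = w) (hw' : h ≫ d₁ = w'),
      b w ≫ F.face x h hw hw' = b w'

theorem HasCone.of_path {A : C} {x y : D.obj A} (p : Path x y) (hx : F.HasCone x) :
    F.HasCone y := by
  obtain ⟨P, b, hb⟩ := hx
  refine ⟨P, fun w => b w ≫ F.transport.map (p.map (D.actMap w).continuous),
    fun h {w w'} hw hw' => ?_⟩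
  rw [Category.assoc, F.face_natural p h hw hw', ← Category.assoc, hb]

end EdgeData

/-- The edges `h : A ⟶ l`, with ends `d₀ ∘ h` and `d₁ ∘ h`, connect all the vertices `A ⟶ o`. -/
def EdgeConnected {o l : C} (d₀ d₁ : l ⟶ o) : Prop :=
  ∀ (A : C) (S : Set (A ⟶ o)), S.Nonempty →
    (∀ h : A ⟶ l, h ≫ d₀ ∈ S ↔ h ≫ d₁ ∈ S) → ∀ w, w ∈ S

namespace EdgeData

variable {D} {o l : C} {d₀ d₁ : l ⟶ o} {G : Type*} [Groupoid G] (F : D.EdgeData d₀ d₁ G)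

/-- Data on the vertices and edges extend to a cocone if all points have a cone. -/
theorem exists_groupoidCocone (hne : ∀ A : C, Nonempty (A ⟶ o)) (hconn : EdgeConnected d₀ d₁)
    (hF : ∀ {A : C} (x : D.obj A), F.HasCone x) :
    ∃ (E : D.GroupoidCocone G) (ι : ∀ x : D.obj o, E.obj o x ⟶ F.obj x),
      (E.transport o).IsNatural F.transport ι ∧
      ∀ y : D.obj l, (E.edge d₀ y ≫ ι (D.actMap d₀ y)) ≫ F.link y =
        E.edge d₁ y ≫ ι (D.actMap d₁ y) := by
  choose P b hb using fun (A : C) (x : D.obj A) => hF x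
  -- The transport along a path, computed at one vertex, does not depend on the vertex.
  have indep : ∀ {A : C} {x y : D.obj A} (p : Path x y) (w w' : A ⟶ o),
      b A x w ≫ F.transport.map (p.map (D.actMap w).continuous) ≫ inv (b A y w) =
        b A x w' ≫ F.transport.map (p.map (D.actMap w').continuous) ≫ inv (b A y w') := by
    intro A x y p w w'
    refine hconn A {w | b A x w ≫ F.transport.map (p.map (D.actMap w).continuous) ≫
      inv (b A y w) = b A x w' ≫ F.transport.map (p.map (D.actMap w').continuous) ≫
        inv (b A y w')} ⟨w', rfl⟩ (fun h => ?_) w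
    have e : b A x (h ≫ d₀) ≫ F.transport.map (p.map (D.actMap (h ≫ d₀)).continuous) ≫
        inv (b A y (h ≫ d₀)) = b A x (h ≫ d₁) ≫
          F.transport.map (p.map (D.actMap (h ≫ d₁)).continuous) ≫ inv (b A y (h ≫ d₁)) := by
      rw [← hb A x h rfl rfl, ← hb A y h rfl rfl, Category.assoc,
        ← reassoc_of% F.face_natural p h rfl rfl]
      simp
    change _ = _ ↔ _ = _
    rw [e]
  let v : ∀ A : C, A ⟶ o := fun A => (hne A).some
  let T : ∀ A : C, Transport (P A) := fun A =>
    { map := fun {x y} p => b A x (v A) ≫ F.transport.map (p.map (D.actMap (v A)).continuous) ≫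
        inv (b A y (v A))
      map_trans := fun p q => by simp [Path.map_trans, Transport.map_trans]
      map_homotopic := fun h => by rw [F.transport.map_homotopic (h.map (D.actMap (v A)))] }
  have hT : ∀ {A : C} {x y : D.obj A} (p : Path x y) (w : A ⟶ o), (T A).map p =
      b A x w ≫ F.transport.map (p.map (D.actMap w).continuous) ≫ inv (b A y w) :=
    fun p w => indep p _ w
  -- The same holds for the morphism attached to a structure map.
  have indep' : ∀ {A B : C} (f : A ⟶ B) (x : D.obj A) (w w' : B ⟶ o),
      b A x (f ≫ w) ≫ inv (F.transport.map (D.compPathTo f w rfl x)) ≫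
          inv (b B (D.actMap f x) w) =
        b A x (f ≫ w') ≫ inv (F.transport.map (D.compPathTo f w' rfl x)) ≫
          inv (b B (D.actMap f x) w') := by
    intro A B f x w w'
    refine hconn B {w | b A x (f ≫ w) ≫ inv (F.transport.map (D.compPathTo f w rfl x)) ≫
      inv (b B (D.actMap f x) w) = b A x (f ≫ w') ≫
        inv (F.transport.map (D.compPathTo f w' rfl x)) ≫ inv (b B (D.actMap f x) w')}
      ⟨w', rfl⟩ (fun h => ?_) w
    have e : b A x (f ≫ h ≫ d₀) ≫ inv (F.transport.map (D.compPathTo f (h ≫ d₀) rfl x)) ≫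
          inv (b B (D.actMap f x) (h ≫ d₀)) =
        b A x (f ≫ h ≫ d₁) ≫ inv (F.transport.map (D.compPathTo f (h ≫ d₁) rfl x)) ≫
          inv (b B (D.actMap f x) (h ≫ d₁)) := by
      have e1 := F.face_comp f x h rfl rfl rfl rfl rfl (Category.assoc f h d₀)
        (Category.assoc f h d₁)
      rw [← IsIso.eq_inv_comp] at e1
      rw [← hb A x (f ≫ h) (Category.assoc f h d₀) (Category.assoc f h d₁),
        ← hb B (D.actMap f x) h rfl rfl, e1]
      simp
    change _ = _ ↔ _ = _
    rw [e]
  let e : ∀ {A B : C} (f : A ⟶ B) (x : D.obj A), P A x ⟶ P B (D.actMap f x) := fun {A B} f x =>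
    b A x (f ≫ v B) ≫ inv (F.transport.map (D.compPathTo f (v B) rfl x)) ≫
      inv (b B (D.actMap f x) (v B))
  have he : ∀ {A B : C} (f : A ⟶ B) (x : D.obj A) (w : B ⟶ o) {w' : A ⟶ o} (hw : f ≫ w = w'),
      e f x = b A x w' ≫ inv (F.transport.map (D.compPathTo f w hw x)) ≫
        inv (b B (D.actMap f x) w) := by
    rintro A B f x w _ rfl
    exact indep' f x _ w
  let E : D.GroupoidCocone G :=
    { obj := P
      transport := T
      edge := e
      edge_natural := fun {A B} f {x y} p => by
        rw [hT p (f ≫ v B), hT (p.map (D.actMap f).continuous) (v B), he f x (v B) rfl,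
          he f y (v B) rfl]
        have := D.map_compPathTo_natural F.transport f (v B) rfl p
        rw [← IsIso.inv_comp_eq, ← Category.assoc, ← IsIso.eq_comp_inv] at this
        simp only [Category.assoc, IsIso.inv_hom_id_assoc]
        rw [← reassoc_of% this]
      edge_comp := fun {A B E'} f g x => by
        rw [he f x (g ≫ v E') (Category.assoc f g (v E')).symm, he g _ (v E') rfl,
          hT (D.compPath f g x) (v E'), he (f ≫ g) x (v E') rfl]
        have := D.map_compPathTo_comp F.transport (f := f) (g := g) (h := v E') rfl rfl
          (Category.assoc f g (v E')).symm rfl x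
        have hc : D.compPathTo f g rfl x = D.compPath f g x := rfl
        rw [← IsIso.comp_inv_eq, hc] at this
        simp only [Category.assoc, IsIso.inv_hom_id_assoc]
        rw [← reassoc_of% this]
        simp only [IsIso.inv_hom_id_assoc] }
  refine ⟨E, fun x => b o x (𝟙 o) ≫ F.transport.map (Path.ofEq (D.actMap_id x)), ?_, ?_⟩
  · intro x y p
    change (T o).map p ≫ _ = _
    rw [hT p (𝟙 o)]
    simp only [Category.assoc, IsIso.inv_hom_id_assoc]
    rw [← F.transport.map_ofEq_comp (D.actMap_id x) (D.actMap_id y)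
      (p.map (D.actMap (𝟙 o)).continuous) p fun s => D.actMap_id (p s)]
  · intro y
    have key : ∀ d : l ⟶ o, E.edge d y ≫ b o (D.actMap d y) (𝟙 o) ≫
        F.transport.map (Path.ofEq (D.actMap_id (D.actMap d y))) = b l y d := by
      intro d
      change e d y ≫ _ = _
      rw [he d y (𝟙 o) (Category.comp_id d)]
      simp only [Category.assoc, IsIso.inv_hom_id_assoc]
      rw [show D.compPathTo d (𝟙 o) (Category.comp_id d) y = Path.ofEq (D.actMap_id _) from
        Path.ext (funext fun t => D.compPathTo_id_right d _ y t), IsIso.inv_hom_id,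
        Category.comp_id]
    rw [key, key, ← hb l y (𝟙 l) (Category.id_comp d₀) (Category.id_comp d₁)]
    congr 1
    have e0 : ∀ d : l ⟶ o, D.compPathTo (𝟙 l) d (Category.id_comp d) y =
        (Path.ofEq (D.actMap_id y)).map (D.actMap d).continuous := fun d =>
      Path.ext (funext fun t => D.compPathTo_id_left d _ y t)
    rw [face, ← cancel_epi (F.transport.map (D.compPathTo (𝟙 l) d₀ (Category.id_comp d₀) y)),
      IsIso.hom_inv_id_assoc, e0, e0, F.link_natural]

/-- Data on the vertices and edges extend to a transport on the homotopy colimit if all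
points have a cone. -/
theorem exists_extension [IsAcyclicCategory C] (hol : l ≠ o) (hne : ∀ A : C, Nonempty (A ⟶ o))
    (hconn : EdgeConnected d₀ d₁) (hF : ∀ {A : C} (x : D.obj A), F.HasCone x) :
    ∃ (obj : D.Hocolim → G) (Φ : Transport obj) (ι : ∀ x : D.obj o, obj (D.inc o x) ⟶ F.obj x),
      (Φ.comap (D.inc o)).IsNatural F.transport ι ∧
      ∀ y : D.obj l, inv (Φ.map (D.edgePath d₀ y)) ≫ ι (D.actMap d₀ y) ≫ F.link y =
        inv (Φ.map (D.edgePath d₁ y)) ≫ ι (D.actMap d₁ y) := by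
  obtain ⟨E, ι, hι, hE⟩ := F.exists_groupoidCocone hne hconn hF
  obtain ⟨obj, Φ, η, hη, hΦ⟩ := E.exists_extension
  refine ⟨obj, Φ, fun x => inv (η o x) ≫ ι x, fun {x y} p => ?_, fun y => ?_⟩
  · have e1 := hη o p
    rw [← IsIso.inv_comp_eq] at e1
    rw [Transport.comap_map, ← e1]
    simp only [Category.assoc, IsIso.hom_inv_id_assoc]
    rw [hι p]
  · have key : ∀ d : l ⟶ o, inv (Φ.map (D.edgePath d y)) ≫ inv (η o (D.actMap d y)) =
        inv (η l y) ≫ E.edge d y := fun d => by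
      rw [← cancel_epi (η l y), IsIso.hom_inv_id_assoc, ← hΦ d hol y, Category.assoc,
        Category.assoc, IsIso.hom_inv_id_assoc, IsIso.hom_inv_id, Category.comp_id]
    have := hE y
    simp only [Category.assoc] at this
    rw [Category.assoc, reassoc_of% key d₀, reassoc_of% key d₁, this]

end EdgeData

/-- A natural isomorphism over the space of vertices extends to the homotopy colimit if
its transports from the two ends of every edge to the edge agree. -/
theorem exists_isNatural_of_edges [IsAcyclicCategory C] {o l : C} {d₀ d₁ : l ⟶ o}
    (hne : ∀ A : C, Nonempty (A ⟶ o)) (hconn : EdgeConnected d₀ d₁) {G : Type*} [Groupoid G]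
    {obj obj' : D.Hocolim → G} (Φ : Transport obj) (Ψ : Transport obj')
    (α : ∀ x : D.obj o, obj (D.inc o x) ⟶ obj' (D.inc o x))
    (hα : (Φ.comap (D.inc o)).IsNatural (Ψ.comap (D.inc o)) α)
    (he : ∀ y : D.obj l,
      inv (Φ.map (D.edgePath d₀ y)) ≫ α (D.actMap d₀ y) ≫ Ψ.map (D.edgePath d₀ y) =
        inv (Φ.map (D.edgePath d₁ y)) ≫ α (D.actMap d₁ y) ≫ Ψ.map (D.edgePath d₁ y)) :
    ∃ β, Φ.IsNatural Ψ β := by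
  let a : ∀ {A : C} (x : D.obj A) (w : A ⟶ o), obj (D.inc A x) ⟶ obj' (D.inc A x) :=
    fun x w => inv (Φ.map (D.edgePath w x)) ≫ α (D.actMap w x) ≫ Ψ.map (D.edgePath w x)
  have hcomp : ∀ {A B : C} (f : A ⟶ B) (w : B ⟶ o) (x : D.obj A),
      Φ.map (D.edgePath f x) ≫ a x (f ≫ w) = a (D.actMap f x) w ≫ Ψ.map (D.edgePath f x) := by
    intro A B f w x
    have e1 := D.map_edgePath_comp Φ f w x
    have e2 := D.map_edgePath_comp Ψ f w x
    have e3 := hα (D.compPath f w x)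
    simp only [Transport.comap_map] at e3
    simp only [a, Category.assoc]
    rw [← cancel_epi (Φ.map (D.edgePath w (D.actMap f x))), reassoc_of% e1,
      IsIso.hom_inv_id_assoc, IsIso.hom_inv_id_assoc, reassoc_of% e3, e2]
  have indep : ∀ {A : C} (x : D.obj A) (w w' : A ⟶ o), a x w = a x w' := by
    intro A x w w'
    refine hconn A {w | a x w = a x w'} ⟨w', rfl⟩ (fun h => ?_) w
    have e : a x (h ≫ d₀) = a x (h ≫ d₁) := by
      rw [← cancel_epi (Φ.map (D.edgePath h x)), hcomp, hcomp]
      congr 1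
      exact he _
    change _ = _ ↔ _ = _
    rw [e]
  refine D.exists_isNatural Φ Ψ (fun A x => a x (hne A).some) (fun A {x y} p => ?_)
    fun {A B} f _ x => ?_
  · have e1 := D.map_edgePath_natural Φ (hne A).some p
    have e2 := D.map_edgePath_natural Ψ (hne A).some p
    have e3 := hα (p.map (D.actMap (hne A).some).continuous)
    simp only [Transport.comap_map] at e3 ⊢
    simp only [a, Category.assoc]
    rw [← cancel_epi (Φ.map (D.edgePath (hne A).some x)), ← reassoc_of% e1,
      IsIso.hom_inv_id_assoc, IsIso.hom_inv_id_assoc, reassoc_of% e3, e2]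
  · rw [indep x _ (f ≫ (hne B).some)]
    exact hcomp f _ x

end HDiagram

/-! ### Combinatorics of cubes -/

theorem SignType.eq_neg_one_or_one {s : SignType} (h : s ≠ 0) : s = -1 ∨ s = 1 := by
  revert s
  decide

namespace Cube

instance : IsAcyclicCategory Cube where
  eq_id := Cube.eq_id
  antisymm := by
    rintro ⟨p⟩ ⟨r⟩ ⟨f⟩ ⟨g⟩
    exact congrArg Cube.mk (le_antisymm (Cube.dim_le g) (Cube.dim_le f))

/-- A morphism of the cube category is determined by its signs, extended by zero. -/
theorem hom_ext {p r : Cube} {f g : p ⟶ r} (h : Hom.sgn f = Hom.sgn g) : f = g := by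
  refine Hom.ext (DFunLike.coe_injective ((StrictMono.range_inj (Hom.emb f).strictMono
    (Hom.emb g).strictMono).1 ?_)) h
  ext k
  rw [← Hom.sgn_eq_zero_iff, ← Hom.sgn_eq_zero_iff, h]

theorem comp_sgn_emb {p q r : Cube} (f : p ⟶ q) (g : q ⟶ r) (a : Fin q.dim) :
    Hom.sgn (f ≫ g) (Hom.emb f a) = Hom.sgn g a :=
  (Hom.emb f).injective.extend_apply _ _ a

theorem comp_sgn_of_ne {p q r : Cube} (f : p ⟶ q) (g : q ⟶ r) {k : Fin p.dim}
    (hk : Hom.sgn f k ≠ 0) : Hom.sgn (f ≫ g) k = Hom.sgn f k :=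
  Function.extend_apply' _ _ _ fun h => hk ((Hom.sgn_eq_zero_iff f k).2 h)

theorem sgn_vertex_ne_zero {p : Cube} (w : p ⟶ ⟨0⟩) (k : Fin p.dim) : Hom.sgn w k ≠ 0 := by
  rw [Ne, Hom.sgn_eq_zero_iff]
  rintro ⟨i, -⟩
  exact i.elim0

/-- Every function to the set of signs with the right number of zeros comes from a morphism. -/
theorem exists_sgn_eq {p r : Cube} (σ : Fin p.dim → SignType)
    (h : (Finset.univ.filter fun k => σ k = 0).card = r.dim) :
    ∃ f : p ⟶ r, Hom.sgn f = σ :=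
  ⟨⟨Finset.orderEmbOfFin _ h, σ, fun k => by
    rw [Finset.range_orderEmbOfFin]
    simp⟩, rfl⟩

theorem exists_vertex {p : Cube} (σ : Fin p.dim → SignType) (h : ∀ k, σ k ≠ 0) :
    ∃ w : p ⟶ ⟨0⟩, Hom.sgn w = σ :=
  exists_sgn_eq σ (by simp [h])

theorem exists_edge {p : Cube} (w : p ⟶ ⟨0⟩) (k : Fin p.dim) :
    ∃ h : p ⟶ ⟨1⟩, Hom.sgn h = Function.update (Hom.sgn w) k 0 := by
  refine exists_sgn_eq _ ?_
  rw [show (Finset.univ.filter fun i => Function.update (Hom.sgn w) k 0 i = 0) = {k} from ?_]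
  · rfl
  · ext i
    by_cases hi : i = k
    · simp [hi]
    · simp [hi, sgn_vertex_ne_zero]

theorem exists_square {p : Cube} (w : p ⟶ ⟨0⟩) {j k : Fin p.dim} (hjk : j ≠ k) :
    ∃ f : p ⟶ ⟨2⟩, Hom.sgn f = Function.update (Function.update (Hom.sgn w) j 0) k 0 := by
  refine exists_sgn_eq _ ?_
  rw [show (Finset.univ.filter fun i =>
    Function.update (Function.update (Hom.sgn w) j 0) k 0 i = 0) = {j, k} from ?_]
  · exact Finset.card_pair hjk
  · ext i
    by_cases hi : i = k
    · simp [hi]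
    · by_cases hj : i = j
      · simp [hj, hjk]
      · simp [hi, hj, sgn_vertex_ne_zero]

/-- A morphism `φ` factors through `f` if its signs extend those of `f`. -/
theorem exists_factor {p q r : Cube} (f : p ⟶ q) (φ : p ⟶ r)
    (h : ∀ k, Hom.sgn f k ≠ 0 → Hom.sgn φ k = Hom.sgn f k) : ∃ ψ : q ⟶ r, f ≫ ψ = φ := by
  have hr : ∀ i, ∃ a, Hom.emb f a = Hom.emb φ i := by
    intro i
    refine (Hom.sgn_eq_zero_iff f _).1 ?_
    by_contra hk
    exact hk ((h _ hk).symm.trans ((Hom.sgn_eq_zero_iff φ _).2 ⟨i, rfl⟩))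
  choose e he using hr
  have hmono : StrictMono e := fun i j hij => by
    rw [← (Hom.emb f).lt_iff_lt, he, he]
    exact (Hom.emb φ).strictMono hij
  refine ⟨⟨OrderEmbedding.ofStrictMono e hmono, fun a => Hom.sgn φ (Hom.emb f a), fun a => ?_⟩, ?_⟩
  · rw [Hom.sgn_eq_zero_iff]
    constructor
    · rintro ⟨i, hi⟩
      exact ⟨i, (Hom.emb f).injective ((he i).trans hi)⟩
    · rintro ⟨i, rfl⟩
      exact ⟨i, (he i).symm⟩
  · refine hom_ext (funext fun k => ?_)
    by_cases hk : Hom.sgn f k = 0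
    · obtain ⟨a, rfl⟩ := (Hom.sgn_eq_zero_iff f k).1 hk
      exact comp_sgn_emb f _ a
    · rw [comp_sgn_of_ne f _ hk, h k hk]

instance {p q : Cube} (f : p ⟶ q) : Epi f where
  left_cancellation {r} ψ ψ' h := hom_ext (funext fun a => by
    rw [← comp_sgn_emb f ψ, ← comp_sgn_emb f ψ', h])

theorem exists_end (s : SignType) (hs : s ≠ 0) : ∃ d : (⟨1⟩ : Cube) ⟶ ⟨0⟩, ∀ i, Hom.sgn d i = s :=
  (exists_vertex (p := ⟨1⟩) (fun _ => s) fun _ => hs).imp fun _ h i => congrFun h i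

/-- The negative end of the one-dimensional cube. -/
noncomputable def d₀ : (⟨1⟩ : Cube) ⟶ ⟨0⟩ := (exists_end (-1) (by decide)).choose

/-- The positive end of the one-dimensional cube. -/
noncomputable def d₁ : (⟨1⟩ : Cube) ⟶ ⟨0⟩ := (exists_end 1 (by decide)).choose

theorem sgn_d₀ (i) : Hom.sgn d₀ i = -1 := (exists_end (-1) (by decide)).choose_spec i

theorem sgn_d₁ (i) : Hom.sgn d₁ i = 1 := (exists_end 1 (by decide)).choose_spec i

theorem comp_d₀_sgn {p : Cube} (h : p ⟶ ⟨1⟩) {k : Fin p.dim} (hk : Hom.sgn h k = 0) :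
    Hom.sgn (h ≫ d₀) k = -1 := by
  obtain ⟨a, rfl⟩ := (Hom.sgn_eq_zero_iff h k).1 hk
  rw [comp_sgn_emb, sgn_d₀]

theorem comp_d₁_sgn {p : Cube} (h : p ⟶ ⟨1⟩) {k : Fin p.dim} (hk : Hom.sgn h k = 0) :
    Hom.sgn (h ≫ d₁) k = 1 := by
  obtain ⟨a, rfl⟩ := (Hom.sgn_eq_zero_iff h k).1 hk
  rw [comp_sgn_emb, sgn_d₁]

theorem exists_sgn_eq_zero {p : Cube} (h : p ⟶ ⟨1⟩) : ∃ k, Hom.sgn h k = 0 :=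
  ⟨Hom.emb h 0, (Hom.sgn_eq_zero_iff h _).2 ⟨0, rfl⟩⟩

theorem sgn_ne_zero_of_ne {p : Cube} (h : p ⟶ ⟨1⟩) {j k : Fin p.dim} (hk : Hom.sgn h k = 0)
    (hj : j ≠ k) : Hom.sgn h j ≠ 0 := by
  intro h0
  obtain ⟨a, rfl⟩ := (Hom.sgn_eq_zero_iff h k).1 hk
  obtain ⟨b, rfl⟩ := (Hom.sgn_eq_zero_iff h j).1 h0
  exact hj (congrArg _ (Subsingleton.elim (α := Fin 1) b a))

theorem comp_eq_of_update {p : Cube} {h : p ⟶ ⟨1⟩} {d : (⟨1⟩ : Cube) ⟶ ⟨0⟩} {s : SignType}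
    (hd : ∀ i, Hom.sgn d i = s) {k : Fin p.dim} {w w' : p ⟶ ⟨0⟩}
    (hh : Hom.sgn h = Function.update (Hom.sgn w) k 0)
    (hw : Hom.sgn w' = Function.update (Hom.sgn w) k s) : h ≫ d = w' := by
  refine hom_ext (funext fun j => ?_)
  by_cases hj : j = k
  · subst hj
    obtain ⟨a, ha⟩ := (Hom.sgn_eq_zero_iff h j).1 (by rw [hh]; simp)
    rw [← ha, comp_sgn_emb, hd, ha, hw]
    simp
  · have : Hom.sgn h j ≠ 0 := by
      rw [hh, Function.update_of_ne hj]
      exact sgn_vertex_ne_zero w j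
    rw [comp_sgn_of_ne h d this, hh, hw, Function.update_of_ne hj, Function.update_of_ne hj]

theorem nonempty_vertex (p : Cube) : Nonempty (p ⟶ (⟨0⟩ : Cube)) :=
  ⟨(exists_vertex (fun _ => 1) fun _ => by decide).choose⟩

/-- The one-dimensional skeleton of a cube is connected. -/
theorem edgeConnected : HDiagram.EdgeConnected d₀ d₁ := by
  intro p S hS hedge
  -- The signs of a vertex are changed one at a time, along an edge of the cube.
  have step : ∀ (k : Fin p.dim) (w w' : p ⟶ ⟨0⟩), (∀ j, j ≠ k → Hom.sgn w j = Hom.sgn w' j) →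
      w ∈ S → w' ∈ S := by
    intro k w w' hw hwS
    obtain ⟨h, hh⟩ := exists_edge w k
    have key : ∀ v : p ⟶ ⟨0⟩, (∀ j, j ≠ k → Hom.sgn w j = Hom.sgn v j) →
        h ≫ d₀ = v ∨ h ≫ d₁ = v := by
      intro v hv
      have hup : Hom.sgn v = Function.update (Hom.sgn w) k (Hom.sgn v k) := by
        funext j
        by_cases hj : j = k
        · simp [hj]
        · rw [Function.update_of_ne hj, hv j hj]
      rcases SignType.eq_neg_one_or_one (sgn_vertex_ne_zero v k) with e | e
      · exact Or.inl (comp_eq_of_update sgn_d₀ hh (by rw [← e]; exact hup))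
      · exact Or.inr (comp_eq_of_update sgn_d₁ hh (by rw [← e]; exact hup))
    have hall : h ≫ d₀ ∈ S ∧ h ≫ d₁ ∈ S := by
      rcases key w fun _ _ => rfl with e | e
      · have h0 : h ≫ d₀ ∈ S := by rwa [e]
        exact ⟨h0, (hedge h).1 h0⟩
      · have h1 : h ≫ d₁ ∈ S := by rwa [e]
        exact ⟨(hedge h).2 h1, h1⟩
    rcases key w' hw with e | e
    · rw [← e]; exact hall.1
    · rw [← e]; exact hall.2
  have all : ∀ (T : Finset (Fin p.dim)) (w w' : p ⟶ ⟨0⟩),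
      (∀ j, j ∉ T → Hom.sgn w j = Hom.sgn w' j) → w ∈ S → w' ∈ S := by
    intro T
    induction T using Finset.induction_on with
    | empty =>
      intro w w' h hw
      rwa [← hom_ext (funext fun j => h j (Finset.notMem_empty j))]
    | insert k T _ ih =>
      intro w w' h hw
      obtain ⟨w'', hw''⟩ := exists_vertex (Function.update (Hom.sgn w) k (Hom.sgn w' k)) fun j => by
        by_cases hj : j = k
        · subst hj
          rw [Function.update_self]
          exact sgn_vertex_ne_zero w' j
        · rw [Function.update_of_ne hj]
          exact sgn_vertex_ne_zero w j
      refine ih w'' w' (fun j hj => ?_) (step k w w'' (fun j hj => ?_) hw)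
      · rw [hw'']
        by_cases hk : j = k
        · rw [hk, Function.update_self]
        · rw [Function.update_of_ne hk]
          exact h j (by simp [hk, hj])
      · rw [hw'', Function.update_of_ne hj]
  obtain ⟨w, hw⟩ := hS
  exact fun w' => all Finset.univ w w' (fun j hj => (hj (Finset.mem_univ j)).elim) hw

end Cube

namespace CubeLE

instance {p : ℕ} : IsAcyclicCategory (CubeLE p) where
  eq_id := CubeLE.eq_id
  antisymm := by
    rintro A B ⟨f⟩ ⟨g⟩
    exact CubeLE.ext_dim (le_antisymm (CubeLE.dim_le g) (CubeLE.dim_le f))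

/-- The negative end of the one-dimensional cube. -/
noncomputable def d₀ : (mk 1 one_le_two : CubeLE 2) ⟶ mk 0 zero_le_two := ⟨Cube.d₀⟩

/-- The positive end of the one-dimensional cube. -/
noncomputable def d₁ : (mk 1 one_le_two : CubeLE 2) ⟶ mk 0 zero_le_two := ⟨Cube.d₁⟩

theorem nonempty_vertex (A : CubeLE 2) : Nonempty (A ⟶ mk 0 zero_le_two) :=
  (Cube.nonempty_vertex A.obj).map fun w => ⟨w⟩

theorem edgeConnected : HDiagram.EdgeConnected d₀ d₁ := by
  intro A S hS hedge w
  exact Cube.edgeConnected A.obj {w | (⟨w⟩ : A ⟶ mk 0 zero_le_two) ∈ S}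
    (by obtain ⟨w, hw⟩ := hS; exact ⟨w.hom, hw⟩) (fun h => hedge ⟨h⟩) w.hom

end CubeLE

namespace HDiagram.EdgeData

variable {X : HDiagram.{0, 0, u} Cube} {G : Type*} [Groupoid G] (F : X.EdgeData Cube.d₀ Cube.d₁ G)

open Cube

/-- The transport around a square of a cube is trivial if all points of `X_2` have a cone. -/
theorem face_square (hF : ∀ y : X.obj ⟨2⟩, F.HasCone y) {A : Cube} (x : X.obj A)
    {w₀₀ w₁₀ w₀₁ w₁₁ : A ⟶ ⟨0⟩} {h₁ h₂ h₃ h₄ : A ⟶ ⟨1⟩} (a₁ : h₁ ≫ d₀ = w₀₀) (b₁ : h₁ ≫ d₁ = w₁₀)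
    (a₂ : h₂ ≫ d₀ = w₁₀) (b₂ : h₂ ≫ d₁ = w₁₁) (a₃ : h₃ ≫ d₀ = w₀₀) (b₃ : h₃ ≫ d₁ = w₀₁)
    (a₄ : h₄ ≫ d₀ = w₀₁) (b₄ : h₄ ≫ d₁ = w₁₁) {j k : Fin A.dim} (hjk : j ≠ k)
    (e₁ : Hom.sgn h₁ j = 0) (e₂ : Hom.sgn h₂ k = 0) (e₃ : Hom.sgn h₃ k = 0)
    (e₄ : Hom.sgn h₄ j = 0) :
    F.face x h₁ a₁ b₁ ≫ F.face x h₂ a₂ b₂ = F.face x h₃ a₃ b₃ ≫ F.face x h₄ a₄ b₄ := by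
  -- The square is the image of a morphism `f` to `2`, and the cone of `D_f(x)` trivializes it.
  obtain ⟨f, hf⟩ := exists_square w₀₀ hjk
  have hf' : ∀ i, Hom.sgn f i ≠ 0 → i ≠ j ∧ i ≠ k ∧ Hom.sgn f i = Hom.sgn w₀₀ i := by
    intro i hi
    rw [hf] at hi ⊢
    have hk : i ≠ k := by rintro rfl; simp at hi
    have hj : i ≠ j := by rintro rfl; simp [Function.update_of_ne hk] at hi
    exact ⟨hj, hk, by rw [Function.update_of_ne hk, Function.update_of_ne hj]⟩
  have s₁ : ∀ i, Hom.sgn f i ≠ 0 → Hom.sgn h₁ i = Hom.sgn f i := fun i hi => by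
    obtain ⟨hj, hk, e⟩ := hf' i hi
    rw [e, ← a₁, comp_sgn_of_ne _ _ (sgn_ne_zero_of_ne h₁ e₁ hj)]
  have s₂ : ∀ i, Hom.sgn f i ≠ 0 → Hom.sgn h₂ i = Hom.sgn f i := fun i hi => by
    obtain ⟨hj, hk, e⟩ := hf' i hi
    rw [← s₁ i hi, ← comp_sgn_of_ne h₁ d₁ (sgn_ne_zero_of_ne h₁ e₁ hj), b₁, ← a₂,
      comp_sgn_of_ne _ _ (sgn_ne_zero_of_ne h₂ e₂ hk)]
  have s₃ : ∀ i, Hom.sgn f i ≠ 0 → Hom.sgn h₃ i = Hom.sgn f i := fun i hi => by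
    obtain ⟨hj, hk, e⟩ := hf' i hi
    rw [e, ← a₃, comp_sgn_of_ne _ _ (sgn_ne_zero_of_ne h₃ e₃ hk)]
  have s₄ : ∀ i, Hom.sgn f i ≠ 0 → Hom.sgn h₄ i = Hom.sgn f i := fun i hi => by
    obtain ⟨hj, hk, e⟩ := hf' i hi
    rw [← s₃ i hi, ← comp_sgn_of_ne h₃ d₁ (sgn_ne_zero_of_ne h₃ e₃ hk), b₃, ← a₄,
      comp_sgn_of_ne _ _ (sgn_ne_zero_of_ne h₄ e₄ hj)]
  obtain ⟨g₁, rfl⟩ := exists_factor f h₁ s₁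
  obtain ⟨g₂, rfl⟩ := exists_factor f h₂ s₂
  obtain ⟨g₃, rfl⟩ := exists_factor f h₃ s₃
  obtain ⟨g₄, rfl⟩ := exists_factor f h₄ s₄
  have c : ∀ (g g' : (⟨2⟩ : Cube) ⟶ ⟨1⟩) (d d' : (⟨1⟩ : Cube) ⟶ ⟨0⟩) {v : A ⟶ ⟨0⟩},
      (f ≫ g) ≫ d = v → (f ≫ g') ≫ d' = v → g ≫ d = g' ≫ d' := by
    intro g g' d d' v h h'
    rw [← cancel_epi f, ← Category.assoc, h, ← Category.assoc, h']
  obtain ⟨P, b, hb⟩ := hF (X.actMap f x)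
  have key : ∀ (g : (⟨2⟩ : Cube) ⟶ ⟨1⟩) {v v' : (⟨2⟩ : Cube) ⟶ ⟨0⟩} {w w' : A ⟶ ⟨0⟩}
      (hv : g ≫ d₀ = v) (hv' : g ≫ d₁ = v') (hw : f ≫ v = w) (hw' : f ≫ v' = w')
      (h : (f ≫ g) ≫ d₀ = w) (h' : (f ≫ g) ≫ d₁ = w'),
      (b v ≫ F.transport.map (X.compPathTo f v hw x)) ≫ F.face x (f ≫ g) h h' =
        b v' ≫ F.transport.map (X.compPathTo f v' hw' x) := by
    intro g v v' w w' hv hv' hw hw' h h'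
    rw [Category.assoc, F.face_comp f x g hv hv' rfl hw hw' h h', ← Category.assoc,
      hb g hv hv']
  have k₁ := key g₁ (v := g₁ ≫ d₀) (v' := g₂ ≫ d₀) rfl (c g₁ g₂ d₁ d₀ b₁ a₂)
    (by rw [← Category.assoc, a₁]) (by rw [← Category.assoc, a₂]) a₁ b₁
  have k₂ := key g₂ (v := g₂ ≫ d₀) (v' := g₂ ≫ d₁) rfl rfl
    (by rw [← Category.assoc, a₂]) (by rw [← Category.assoc, b₂]) a₂ b₂
  have k₃ := key g₃ (v := g₁ ≫ d₀) (v' := g₄ ≫ d₀) (c g₃ g₁ d₀ d₀ a₃ a₁) (c g₃ g₄ d₁ d₀ b₃ a₄)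
    (by rw [← Category.assoc, a₁]) (by rw [← Category.assoc, a₄]) a₃ b₃
  have k₄ := key g₄ (v := g₄ ≫ d₀) (v' := g₂ ≫ d₁) rfl (c g₄ g₂ d₁ d₁ b₄ b₂)
    (by rw [← Category.assoc, a₄]) (by rw [← Category.assoc, b₂]) a₄ b₄
  rw [← cancel_epi (b (g₁ ≫ d₀) ≫ F.transport.map (X.compPathTo f (g₁ ≫ d₀)
    (by rw [← Category.assoc, a₁]) x))]
  refine (Category.assoc _ _ _).symm.trans (Eq.trans ?_ (Category.assoc _ _ _))
  rw [k₁, k₂, k₃, k₄]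

/-- All points have a cone if the points of `X_2` have a cone.  The cone is constructed by adding the
directions of the cube one after the other. -/
theorem HasCone.of_squares (hF : ∀ y : X.obj ⟨2⟩, F.HasCone y) {A : Cube} (x : X.obj A) :
    F.HasCone x := by
  classical
  obtain ⟨v, hv⟩ := exists_vertex (p := A) (fun _ => -1) fun _ => by decide
  -- A cone on the face of the cube spanned by the directions in `T` that contains the vertex `v`
  -- all of whose signs are `-1`.
  have key : ∀ T : Finset (Fin A.dim),
      ∃ b : ∀ w : A ⟶ ⟨0⟩, (∀ k, k ∉ T → Hom.sgn w k = -1) →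
        (F.obj (X.actMap v x) ⟶ F.obj (X.actMap w x)),
        ∀ (h : A ⟶ ⟨1⟩) {w w' : A ⟶ ⟨0⟩} (hw : h ≫ d₀ = w) (hw' : h ≫ d₁ = w') (H H'),
          b w H ≫ F.face x h hw hw' = b w' H' := by
    intro T
    induction T using Finset.induction_on with
    | empty =>
      refine ⟨fun w H => eqToHom (by
        rw [hom_ext ((funext fun k => H k (Finset.notMem_empty k)).trans hv.symm)]), ?_⟩
      intro h w w' hw hw' H H'
      obtain ⟨k, hk⟩ := exists_sgn_eq_zero h
      have := H' k (Finset.notMem_empty k)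
      rw [← hw', comp_d₁_sgn h hk] at this
      exact absurd this (by decide)
    | insert k T hkT ih =>
      obtain ⟨b, hb⟩ := ih
      have hlo : ∀ w : A ⟶ ⟨0⟩, ∃ w' : A ⟶ ⟨0⟩,
          Hom.sgn w' = Function.update (Hom.sgn w) k (-1) := fun w =>
        exists_vertex _ fun j => by
          by_cases hj : j = k
          · rw [hj, Function.update_self]; decide
          · rw [Function.update_of_ne hj]; exact sgn_vertex_ne_zero w j
      -- The vertex `lo w` is the projection of `w` to the previous face, and `ed w` is the edge from
      -- `lo w` in the direction `k`.  The cone is extended along these edges.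
      choose lo lo_sgn using hlo
      choose ed ed_sgn using fun w : A ⟶ ⟨0⟩ => exists_edge w k
      have ed₀ : ∀ w, ed w ≫ d₀ = lo w := fun w =>
        comp_eq_of_update sgn_d₀ (ed_sgn w) (lo_sgn w)
      have one_of_ne : ∀ w : A ⟶ ⟨0⟩, Hom.sgn w k ≠ -1 → Hom.sgn w k = 1 := fun w h =>
        (SignType.eq_neg_one_or_one (sgn_vertex_ne_zero w k)).resolve_left h
      have ed₁ : ∀ w, Hom.sgn w k ≠ -1 → ed w ≫ d₁ = w := fun w h =>
        comp_eq_of_update sgn_d₁ (ed_sgn w) (by rw [← one_of_ne w h, Function.update_eq_self])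
      have Hsame : ∀ {w : A ⟶ ⟨0⟩}, (∀ j, j ∉ insert k T → Hom.sgn w j = -1) →
          Hom.sgn w k = -1 → ∀ j, j ∉ T → Hom.sgn w j = -1 := by
        intro w H h j hj
        by_cases hjk : j = k
        · rw [hjk, h]
        · exact H j (by simp [hjk, hj])
      have Hlo : ∀ {w : A ⟶ ⟨0⟩}, (∀ j, j ∉ insert k T → Hom.sgn w j = -1) →
          ∀ j, j ∉ T → Hom.sgn (lo w) j = -1 := by
        intro w H j hj
        rw [lo_sgn]
        by_cases hjk : j = k
        · rw [hjk, Function.update_self]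
        · rw [Function.update_of_ne hjk]
          exact H j (by simp [hjk, hj])
      refine ⟨fun w H => if h : Hom.sgn w k = -1 then b w (Hsame H h) else
        b (lo w) (Hlo H) ≫ F.face x (ed w) (ed₀ w) (ed₁ w h), ?_⟩
      intro h w w' hw hw' H H'
      beta_reduce
      by_cases hk : Hom.sgn h k = 0
      · -- The edge points in the new direction.
        have h1 : Hom.sgn w k = -1 := by rw [← hw]; exact comp_d₀_sgn h hk
        have h2 : Hom.sgn w' k ≠ -1 := by
          rw [← hw', comp_d₁_sgn h hk]
          decide
        have h3 : ∀ j, j ≠ k → Hom.sgn w j = Hom.sgn h j ∧ Hom.sgn w' j = Hom.sgn h j := by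
          intro j hj
          have := sgn_ne_zero_of_ne h hk hj
          exact ⟨by rw [← hw, comp_sgn_of_ne h d₀ this], by rw [← hw', comp_sgn_of_ne h d₁ this]⟩
        obtain rfl : lo w' = w := by
          refine hom_ext (funext fun j => ?_)
          rw [lo_sgn]
          by_cases hj : j = k
          · rw [hj, Function.update_self, h1]
          · rw [Function.update_of_ne hj, (h3 j hj).1, (h3 j hj).2]
        obtain rfl : ed w' = h := by
          refine hom_ext (funext fun j => ?_)
          rw [ed_sgn]
          by_cases hj : j = k
          · rw [hj, Function.update_self, hk]
          · rw [Function.update_of_ne hj, (h3 j hj).2]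
        rw [dif_pos h1, dif_neg h2]
      · have h1 : Hom.sgn w k = Hom.sgn h k := by rw [← hw, comp_sgn_of_ne h d₀ hk]
        have h2 : Hom.sgn w' k = Hom.sgn h k := by rw [← hw', comp_sgn_of_ne h d₁ hk]
        by_cases h3 : Hom.sgn w k = -1
        · rw [dif_pos h3, dif_pos (h2.trans (h1.symm.trans h3))]
          exact hb h hw hw' _ _
        · have h4 : Hom.sgn w' k ≠ -1 := by rwa [h2, ← h1]
          rw [dif_neg h3, dif_neg h4]
          obtain ⟨i, hi⟩ := exists_sgn_eq_zero h
          have hik : i ≠ k := by rintro rfl; exact hk hi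
          -- The edge parallel to `h` on the opposite face of the cube.
          obtain ⟨h', hh'⟩ := exists_edge (lo w) i
          have hw_up : ∀ j, j ≠ i → Hom.sgn w' j = Hom.sgn w j := fun j hj => by
            have := sgn_ne_zero_of_ne h hi hj
            rw [← hw, ← hw', comp_sgn_of_ne h _ this, comp_sgn_of_ne h _ this]
          have wi : Hom.sgn w i = -1 := by rw [← hw]; exact comp_d₀_sgn h hi
          have wi' : Hom.sgn w' i = 1 := by rw [← hw']; exact comp_d₁_sgn h hi
          have c₀ : h' ≫ d₀ = lo w := comp_eq_of_update sgn_d₀ hh' (by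
            have : Hom.sgn (lo w) i = -1 := by rw [lo_sgn, Function.update_of_ne hik, wi]
            rw [← this, Function.update_eq_self])
          have c₁ : h' ≫ d₁ = lo w' := comp_eq_of_update sgn_d₁ hh' (by
            funext j
            rw [lo_sgn, lo_sgn]
            by_cases hj : j = i
            · rw [hj, Function.update_self, Function.update_of_ne hik, wi']
            · rw [Function.update_of_ne hj]
              by_cases hj' : j = k
              · rw [hj', Function.update_self, Function.update_self]
              · rw [Function.update_of_ne hj', Function.update_of_ne hj', hw_up j hj])
          have sq := F.face_square hF x c₀ c₁ (ed₀ w') (ed₁ w' h4) (ed₀ w) (ed₁ w h3) hw hw' hik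
            (by rw [hh', Function.update_self]) (by rw [ed_sgn, Function.update_self])
            (by rw [ed_sgn, Function.update_self]) hi
          rw [Category.assoc, ← sq, ← Category.assoc, hb h' c₀ c₁ (Hlo H) (Hlo H')]
  obtain ⟨b, hb⟩ := key Finset.univ
  have H : ∀ (w : A ⟶ ⟨0⟩) (k : Fin A.dim), k ∉ Finset.univ → Hom.sgn w k = -1 :=
    fun w k hk => (hk (Finset.mem_univ k)).elim
  exact ⟨_, fun w => b w (H w), fun h {w w'} hw hw' => hb h hw hw' _ _⟩

end HDiagram.EdgeData

/-! ### Path components of CW complexes -/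

section CWComplex

open RelCWComplex

variable {K : Type*} [TopologicalSpace K] {C : Set K} [CWComplex C]

/-- Two points of a closed cell are joined in the ambient space, since the cell is the image of a
ball. -/
theorem RelCWComplex.joined_of_mem_closedCell {n : ℕ} (j : cell C n) {x y : K}
    (hx : x ∈ closedCell n j) (hy : y ∈ closedCell n j) : Joined x y := by
  have h : IsPathConnected (closedCell n j) :=
    (((convex_closedBall (0 : Fin n → ℝ) 1).isPathConnected ⟨0, by simp⟩).image'
      (RelCWComplex.continuousOn n j))
  exact (h.joinedIn x hx y hy).joined

/-- Every point of a CW complex is joined to a point of the `0`-skeleton: a point of a cell of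
positive dimension is joined to a point of the frontier of the cell, which lies in cells of smaller
dimension. -/
theorem CWComplex.exists_mem_skeleton_zero_joined [T2Space K] {x : K} (hx : x ∈ C) :
    ∃ y ∈ (skeleton C 0 : Set K), Joined y x := by
  have key : ∀ (n : ℕ) (j : cell C n) (x : K), x ∈ closedCell n j →
      ∃ y ∈ (skeleton C 0 : Set K), Joined y x := by
    intro n
    induction n using Nat.strong_induction_on with
    | _ n ih =>
      intro j x hx
      by_cases hn : n = 0
      · subst hn
        exact ⟨x, closedCell_subset_skeleton 0 j hx, Joined.refl x⟩
      · obtain ⟨y, hy⟩ := nonempty_cellFrontier hn j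
        obtain ⟨I, hI⟩ := CWComplex.cellFrontier_subset_finite_closedCell n j
        have hy' := hI hy
        simp only [Set.mem_iUnion] at hy'
        obtain ⟨m, hm, i, -, hi⟩ := hy'
        obtain ⟨z, hz, hzy⟩ := ih m hm i y hi
        exact ⟨z, hz, hzy.trans
          (RelCWComplex.joined_of_mem_closedCell j (cellFrontier_subset_closedCell n j hy) hx)⟩
  rw [← CWComplex.union (C := C)] at hx
  simp only [Set.mem_iUnion] at hx
  obtain ⟨n, j, hj⟩ := hx
  exact key n j x hj

/-- The map from the `0`-skeleton hits every path component. -/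
theorem exists_joined_zeroSkeletonMap {K Z : Type u} [TopologicalSpace K] [T2Space K]
    [CWComplex (Set.univ : Set K)] [TopologicalSpace Z] (e : ContinuousMap.HomotopyEquiv K Z)
    (z : Z) : ∃ s, Joined (zeroSkeletonMap e s) z := by
  obtain ⟨y, hy, h⟩ := CWComplex.exists_mem_skeleton_zero_joined (Set.mem_univ (e.invFun z))
  obtain ⟨H⟩ := e.right_inv
  exact ⟨⟨y, hy⟩, (h.map e.toFun.continuous).trans ⟨H.evalAt z⟩⟩

end CWComplex

theorem Transport.map_ofEq_trans {W : Type*} [TopologicalSpace W] {G : Type*} [Groupoid G]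
    {obj : W → G} (M : Transport obj) {a b c : W} (h : a = b) (h' : b = c) :
    M.map (Path.ofEq h) ≫ M.map (Path.ofEq h') = M.map (Path.ofEq (h.trans h')) := by
  subst h h'
  rw [M.map_const (Path.ofEq rfl) fun _ => rfl, Category.comp_id]

/-- Conjugating `i ≫ q` by `e` and `z` amounts to conjugating `i'` by `e'` and `b`, if the
morphisms differ by `a` and `q'` only. -/
theorem CategoryTheory.inv_comp_comp_comp {G : Type*} [Groupoid G]
    {x x' u v w y k m : G} {a : x ⟶ x'} {i : x ⟶ u} {i' : x' ⟶ v} {q₂ : u ⟶ v} {q : u ⟶ w}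
    {q₁ : v ⟶ w} {e : x ⟶ y} {e' : x' ⟶ y} {z : w ⟶ k} {b : v ⟶ m} {q' : m ⟶ k}
    (h₁ : a ≫ i' = i ≫ q₂) (h₂ : a ≫ e' = e) (h₃ : q = q₂ ≫ q₁) (h₄ : q₁ ≫ z = b ≫ q') :
    CategoryTheory.inv e ≫ (i ≫ q) ≫ z = (CategoryTheory.inv e' ≫ i' ≫ b) ≫ q' := by
  subst h₂ h₃
  rw [← cancel_epi (a ≫ e'), IsIso.hom_inv_id_assoc]
  simp only [Category.assoc, IsIso.hom_inv_id_assoc]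
  rw [h₄, reassoc_of% h₁]

namespace HDiagram.Hom

open TimedChain

variable {C : Type*} [Category C] {C' : Type*} [Category C'] {F : C' ⥤ C}
  {D : HDiagram C} {Z : HDiagram C'} (ψ : Hom Z (D.restrict F))

/-! ### Morphisms to the restriction of a homotopy diagram -/

/-- The maps of spaces of a morphism to a restriction. -/
def appRestrict (A : C') : C(Z.obj A, D.obj (F.obj A)) := ψ.app A

theorem appRestrict_act {A B B' : C'} (f : B ⟶ B') (c : TimedChain A B) (x : Z.obj A) :
    ψ.appRestrict B' (Z.act f c x) = D.act (F.map f) (c.map F) (ψ.appRestrict A x) :=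
  ψ.app_act f c x

/-- The map of homotopy colimits given by a morphism to a restriction. -/
def hocolimRestrictMap : C(Z.Hocolim, D.Hocolim) := (D.hocolimRestrict F).comp ψ.hocolimMap

/-- The morphism `ψ` is a homeomorphism, with inverse `e.symm`, at the object `A`. -/
def IsHomeoAt (A : C') (e : Z.obj A ≃ₜ D.obj (F.obj A)) : Prop := ∀ x, e x = ψ.appRestrict A x

section

variable {ψ}

theorem IsHomeoAt.symm_act {A B : C'} {e : Z.obj B ≃ₜ D.obj (F.obj B)} (he : ψ.IsHomeoAt B e)
    {E : C'} (f : E ⟶ B) (c : TimedChain A E) {s : Z.obj A} {x : D.obj (F.obj A)}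
    (hx : ψ.appRestrict A s = x) : e.symm (D.act (F.map f) (c.map F) x) = Z.act f c s := by
  rw [e.symm_apply_eq, he, appRestrict_act, hx]

theorem IsHomeoAt.app_symm {B : C'} {e : Z.obj B ≃ₜ D.obj (F.obj B)} (he : ψ.IsHomeoAt B e)
    (x : D.obj (F.obj B)) : ψ.appRestrict B (e.symm x) = x := by
  rw [← he, e.apply_symm_apply]

variable [F.Full]

theorem IsHomeoAt.symm_actMap {A B : C'} {e : Z.obj B ≃ₜ D.obj (F.obj B)} (he : ψ.IsHomeoAt B e)
    (f : F.obj A ⟶ F.obj B) {s : Z.obj A} {x : D.obj (F.obj A)}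
    (hx : ψ.appRestrict A s = x) : e.symm (D.actMap f x) = Z.actMap (F.preimage f) s := by
  have := he.symm_act (F.preimage f) nil hx
  rwa [F.map_preimage] at this

/-- The path `t ↦ [t, f; s]` in the homotopy colimit of `Z`, for a morphism `f` and a point `x = ψ(s)`
of `D`. -/
noncomputable def IsHomeoAt.backPath {A B : C'} {e : Z.obj B ≃ₜ D.obj (F.obj B)}
    (he : ψ.IsHomeoAt B e) (f : F.obj A ⟶ F.obj B) (s : Z.obj A) (x : D.obj (F.obj A))
    (hx : ψ.appRestrict A s = x) : Path (Z.inc B (e.symm (D.actMap f x))) (Z.inc A s) :=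
  (Z.edgePath (F.preimage f) s).cast (congrArg (Z.inc B) (he.symm_actMap f hx)) rfl

theorem IsHomeoAt.backPath_apply {A B : C'} {e : Z.obj B ≃ₜ D.obj (F.obj B)}
    (he : ψ.IsHomeoAt B e) (f : F.obj A ⟶ F.obj B) (s : Z.obj A) (x : D.obj (F.obj A))
    (hx : ψ.appRestrict A s = x) (t : 𝕀) :
    he.backPath f s x hx t = Z.cls (cons t (F.preimage f) nil) s := rfl

variable {G : Type*} [Groupoid G] {obj : Z.Hocolim → G} (M : Transport obj)

theorem IsHomeoAt.map_backPath_natural {A B : C'} {e : Z.obj B ≃ₜ D.obj (F.obj B)}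
    (he : ψ.IsHomeoAt B e) {e' : Z.obj A ≃ₜ D.obj (F.obj A)} (he' : ψ.IsHomeoAt A e')
    (f : F.obj A ⟶ F.obj B) {x y : D.obj (F.obj A)} (p : Path x y) :
    M.map (((p.map (D.actMap f).continuous).map e.symm.continuous).map (Z.inc B).continuous) ≫
        M.map (he.backPath f (e'.symm y) y (he'.app_symm y)) =
      M.map (he.backPath f (e'.symm x) x (he'.app_symm x)) ≫
        M.map ((p.map e'.symm.continuous).map (Z.inc A).continuous) :=
  M.map_unitSquare (Γ := fun z => Z.cls (cons z.2 (F.preimage f) nil) (e'.symm (p z.1)))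
    ((Z.continuous_cls A B).comp (((continuous_cons _).comp
      (continuous_snd.prodMk continuous_const)).prodMk
        ((e'.symm.continuous.comp p.continuous).comp continuous_fst)))
    (fun s => (congrArg (Z.inc B) (he.symm_actMap f (he'.app_symm (p s)))).trans
      (Z.cls_cons_zero (F.preimage f) nil (e'.symm (p s))).symm)
    (fun _ => by rw [p.target]; rfl)
    (fun _ => by rw [p.source]; rfl) (fun s => (Z.cls_cons_one _ nil (e'.symm (p s))).symm)

theorem IsHomeoAt.map_backPath_comp [F.Faithful] {A B E : C'} {e : Z.obj B ≃ₜ D.obj (F.obj B)}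
    (he : ψ.IsHomeoAt B e) {e' : Z.obj E ≃ₜ D.obj (F.obj E)} (he' : ψ.IsHomeoAt E e')
    (f : F.obj A ⟶ F.obj B) (g : F.obj B ⟶ F.obj E) {k : F.obj A ⟶ F.obj E} (hk : f ≫ g = k)
    (s : Z.obj A) (x : D.obj (F.obj A)) (hx : ψ.appRestrict A s = x) :
    M.map (he'.backPath g (e.symm (D.actMap f x)) (D.actMap f x) (he.app_symm _)) ≫
        M.map (he.backPath f s x hx) =
      M.map (((D.compPathTo f g hk x).map e'.symm.continuous).map (Z.inc E).continuous) ≫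
        M.map (he'.backPath k s x hx) := by
  obtain ⟨f, rfl⟩ := F.map_surjective f
  obtain ⟨g, rfl⟩ := F.map_surjective g
  subst hk
  refine M.map_unitSquare (Γ := fun z => Z.cls (cons z.1 g (cons z.2 f nil)) s)
    ((Z.continuous_cls A E).comp (((continuous_cons g).comp
      (continuous_fst.prodMk ((continuous_cons f).comp
        (continuous_snd.prodMk continuous_const)))).prodMk continuous_const))
    (fun t => ?_) (fun t => ?_) (fun t => ?_) fun t => ?_
  · rw [he'.backPath_apply, F.preimage_map, he.symm_actMap (F.map f) hx, F.preimage_map]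
    exact ((SameHead.zero f nil s).cls_eq (cons t g nil)).symm
  · rw [he.backPath_apply, F.preimage_map]
    exact (Z.cls_cons_one g _ s).symm
  · refine Eq.trans ?_ (Z.cls_cons_zero g _ s).symm
    exact congrArg (Z.inc E) (he'.symm_act g (cons t f nil) hx)
  · rw [he'.backPath_apply, ← F.map_comp, F.preimage_map]
    exact ((SameHead.one t g f nil s).cls_eq nil).symm

end

/-! ### The inverse transport -/

section

variable {ψ} [F.Full] [F.Faithful] {o l : C'} {eo : Z.obj o ≃ₜ D.obj (F.obj o)}
  (ho : ψ.IsHomeoAt o eo) {el : Z.obj l ≃ₜ D.obj (F.obj l)} (hl : ψ.IsHomeoAt l el)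
  (d₀ d₁ : l ⟶ o)

/-- If `ψ` is a homeomorphism on vertices and on edges, then vertices and edges of `D` can be
lifted to the homotopy colimit of `Z`. -/
noncomputable def edgeData :
    D.EdgeData (F.map d₀) (F.map d₁) (FundamentalGroupoid Z.Hocolim) where
  obj x := ⟨Z.inc o (eo.symm x)⟩
  transport := ((Transport.fundamental Z.Hocolim).comap (Z.inc o)).comap
    ⟨eo.symm, eo.symm.continuous⟩
  link y := (Transport.fundamental Z.Hocolim).map
      (ho.backPath (F.map d₀) (el.symm y) y (hl.app_symm y)) ≫
    inv ((Transport.fundamental Z.Hocolim).map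
      (ho.backPath (F.map d₁) (el.symm y) y (hl.app_symm y)))
  link_natural {y y'} p := by
    have e₀ := ho.map_backPath_natural (Transport.fundamental Z.Hocolim) hl (F.map d₀) p
    have e₁ := ho.map_backPath_natural (Transport.fundamental Z.Hocolim) hl (F.map d₁) p
    rw [← IsIso.inv_comp_eq, ← Category.assoc, ← IsIso.eq_comp_inv] at e₁
    refine (Category.assoc _ _ _).symm.trans ((congrArg (· ≫ _) e₀).trans ?_)
    rw [Category.assoc, Category.assoc, ← e₁]
    rfl

/-- The points in the image of `ψ` have a cone: the whole cube has been lifted. -/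
theorem edgeData_hasCone {A : C'} (s : Z.obj A) :
    (edgeData ho hl d₀ d₁).HasCone (ψ.appRestrict A s) := by
  have key : ∀ {a b c d e f : FundamentalGroupoid Z.Hocolim} {r₀ : a ⟶ b} {r₁ : c ⟶ b} {E : b ⟶ d}
      {κ₀ : a ⟶ e} {κ₁ : c ⟶ f} {R₀ : e ⟶ d} {R₁ : f ⟶ d}, r₀ ≫ E = κ₀ ≫ R₀ → r₁ ≫ E = κ₁ ≫ R₁ →
      inv R₀ ≫ inv κ₀ ≫ (r₀ ≫ inv r₁) ≫ κ₁ = inv R₁ := by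
    intro a b c d e f r₀ r₁ E κ₀ κ₁ R₀ R₁ h₀ h₁
    rw [← cancel_mono R₁, IsIso.inv_hom_id]
    simp only [Category.assoc]
    rw [← h₁, IsIso.inv_hom_id_assoc, h₀]
    simp
  let b : ∀ w : F.obj A ⟶ F.obj o, FundamentalGroupoid.mk (Z.inc A s) ⟶
      FundamentalGroupoid.mk (Z.inc o (eo.symm (D.actMap w (ψ.appRestrict A s)))) := fun w =>
    inv ((Transport.fundamental Z.Hocolim).map (ho.backPath w s _ rfl))
  exact ⟨⟨Z.inc A s⟩, b, fun h {w w'} hw hw' => key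
    (hl.map_backPath_comp (Transport.fundamental Z.Hocolim) ho h (F.map d₀) hw s _ rfl)
    (hl.map_backPath_comp (Transport.fundamental Z.Hocolim) ho h (F.map d₁) hw' s _ rfl)⟩

/-- If `ψ` is a homeomorphism on vertices and edges, and if all points of `D` have a cone for the lift
of the vertices and edges, then `ψ` induces an equivalence of fundamental groupoids of homotopy
colimits: the lift extends to a transport on the homotopy colimit of `D`, and this is inverse to
`ψ` because natural isomorphisms need to be checked on vertices and edges only. -/
theorem isPiOneEquiv_hocolimRestrictMap [IsAcyclicCategory C] [IsAcyclicCategory C']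
    (hlo : F.obj l ≠ F.obj o) (hne : ∀ A : C, Nonempty (A ⟶ F.obj o))
    (hconn : EdgeConnected (F.map d₀) (F.map d₁)) (hne' : ∀ A : C', Nonempty (A ⟶ o))
    (hconn' : EdgeConnected d₀ d₁)
    (hF : ∀ {A : C} (x : D.obj A), (edgeData ho hl d₀ d₁).HasCone x) :
    IsPiOneEquiv ψ.hocolimRestrictMap := by
  obtain ⟨obj, Φ, ι₀, hι₀, hlink₀⟩ := (edgeData ho hl d₀ d₁).exists_extension hlo hne hconn hF
  let f := ψ.hocolimRestrictMap
  let M := Transport.fundamental Z.Hocolim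
  let N := Transport.fundamental D.Hocolim
  let P := FundamentalGroupoid.map f
  let ι : ∀ x : D.obj (F.obj o), obj (D.inc (F.obj o) x) ⟶
    FundamentalGroupoid.mk (Z.inc o (eo.symm x)) := ι₀
  have hι : ∀ {x x' : D.obj (F.obj o)} (p : Path x x'),
      Φ.map (p.map (D.inc (F.obj o)).continuous) ≫ ι x' =
        ι x ≫ M.map ((p.map eo.symm.continuous).map (Z.inc o).continuous) := hι₀
  let r : ∀ (d : l ⟶ o) (y : D.obj (F.obj l)),
      Path (Z.inc o (eo.symm (D.actMap (F.map d) y))) (Z.inc l (el.symm y)) :=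
    fun d y => ho.backPath (F.map d) (el.symm y) y (hl.app_symm y)
  have hlink : ∀ y : D.obj (F.obj l),
      inv (Φ.map (D.edgePath (F.map d₀) y)) ≫ ι (D.actMap (F.map d₀) y) ≫ M.map (r d₀ y) =
      inv (Φ.map (D.edgePath (F.map d₁) y)) ≫ ι (D.actMap (F.map d₁) y) ≫ M.map (r d₁ y) := by
    intro y
    rw [← cancel_mono (inv (M.map (r d₁ y)))]
    simp only [Category.assoc]
    rw [IsIso.hom_inv_id, Category.comp_id]
    exact hlink₀ y
  have hα : ∃ α, (Φ.comap f).IsNatural M α := by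
    have q : ∀ s, Z.inc o (eo.symm (ψ.appRestrict o s)) = Z.inc o s := fun s =>
      congrArg (Z.inc o) (by rw [← ho, eo.symm_apply_apply])
    refine Z.exists_isNatural_of_edges hne' hconn' (Φ.comap f) M
      (fun s => ι (ψ.appRestrict o s) ≫ M.map (Path.ofEq (q s))) (fun {s s'} p => ?_) fun y => ?_
    · exact (CommSq.vert_comp ⟨hι (p.map (ψ.appRestrict o).continuous)⟩
        ⟨(M.map_ofEq_comp (q s) (q s')
          (((p.map (ψ.appRestrict o).continuous).map eo.symm.continuous).map (Z.inc o).continuous)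
          (p.map (Z.inc o).continuous) fun t => q (p t)).symm⟩).w
    · have hy : Z.inc l (el.symm (ψ.appRestrict l y)) = Z.inc l y :=
        congrArg (Z.inc l) (by rw [← hl, el.symm_apply_apply])
      have key : ∀ d : l ⟶ o, inv ((Φ.comap f).map (Z.edgePath d y)) ≫
          (ι (ψ.appRestrict o (Z.actMap d y)) ≫ M.map (Path.ofEq (q (Z.actMap d y)))) ≫
            M.map (Z.edgePath d y) =
          (inv (Φ.map (D.edgePath (F.map d) (ψ.appRestrict l y))) ≫
            ι (D.actMap (F.map d) (ψ.appRestrict l y)) ≫ M.map (r d (ψ.appRestrict l y))) ≫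
              M.map (Path.ofEq hy) := by
        intro d
        have hd : ψ.appRestrict o (Z.actMap d y) = D.actMap (F.map d) (ψ.appRestrict l y) :=
          ψ.appRestrict_act d nil y
        have ha : Z.inc o (eo.symm (D.actMap (F.map d) (ψ.appRestrict l y))) =
            Z.inc o (Z.actMap d y) := by rw [← hd]; exact q _
        refine inv_comp_comp_comp (hι (Path.ofEq hd)) ?_ ?_ (M.map_ofEq_comp ha hy
          (r d (ψ.appRestrict l y)) (Z.edgePath d y) fun t => ?_)
        · refine (Φ.map_ofEq_comp (congrArg (D.inc (F.obj o)) hd) rfl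
            ((Z.edgePath d y).map f.continuous) (D.edgePath (F.map d) (ψ.appRestrict l y))
              fun t => rfl).trans ?_
          rw [Φ.map_const _ fun _ => rfl, Category.comp_id]
          rfl
        · exact (M.map_ofEq_trans (congrArg (fun x => Z.inc o (eo.symm x)) hd) ha).symm
        · change Z.cls (cons t (F.preimage (F.map d)) nil) (el.symm (ψ.appRestrict l y)) =
            Z.cls (cons t d nil) y
          rw [F.preimage_map, ← hl, el.symm_apply_apply]
      exact (key d₀).trans ((congrArg (· ≫ _) (hlink _)).trans (key d₁).symm)
  obtain ⟨α, hα⟩ := hα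
  have hβ : ∃ β, (Φ.postcomp P).IsNatural N β := by
    have q : ∀ x, f (Z.inc o (eo.symm x)) = D.inc (F.obj o) x := fun x =>
      congrArg (D.inc (F.obj o)) (ho.app_symm x)
    refine D.exists_isNatural_of_edges hne hconn (Φ.postcomp P) N
      (fun x => P.map (ι x) ≫ N.map (Path.ofEq (q x))) (fun {x x'} p => ?_) fun y => ?_
    · have e1 := congrArg (fun g => P.map g) (hι p)
      simp only [P.map_comp] at e1
      exact (CommSq.vert_comp ⟨e1⟩ ⟨(N.map_ofEq_comp (q x) (q x')
        (((p.map eo.symm.continuous).map (Z.inc o).continuous).map f.continuous)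
        (p.map (D.inc (F.obj o)).continuous) fun t => q (p t)).symm⟩).w
    · have hy : f (Z.inc l (el.symm y)) = D.inc (F.obj l) y :=
        congrArg (D.inc (F.obj l)) (hl.app_symm y)
      have key : ∀ d : l ⟶ o, inv ((Φ.postcomp P).map (D.edgePath (F.map d) y)) ≫
          (P.map (ι (D.actMap (F.map d) y)) ≫ N.map (Path.ofEq (q (D.actMap (F.map d) y)))) ≫
            N.map (D.edgePath (F.map d) y) =
          P.map (inv (Φ.map (D.edgePath (F.map d) y)) ≫ ι (D.actMap (F.map d) y) ≫
            M.map (r d y)) ≫ N.map (Path.ofEq hy) := by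
        intro d
        have e := N.map_ofEq_comp (q (D.actMap (F.map d) y)) hy ((r d y).map f.continuous)
          (D.edgePath (F.map d) y) fun t => by
            change D.cls (cons t (F.map (F.preimage (F.map d))) nil)
              (ψ.appRestrict l (el.symm y)) = D.cls (cons t (F.map d) nil) y
            rw [F.preimage_map, hl.app_symm]
        have e' : P.map (inv (Φ.map (D.edgePath (F.map d) y)) ≫ ι (D.actMap (F.map d) y) ≫
            M.map (r d y)) = inv (P.map (Φ.map (D.edgePath (F.map d) y))) ≫
              P.map (ι (D.actMap (F.map d) y)) ≫ P.map (M.map (r d y)) := by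
          simp only [P.map_comp, P.map_inv]
        rw [e']
        exact inv_comp_comp_comp (a := 𝟙 _) (i' := P.map (ι (D.actMap (F.map d) y)))
          ((Category.id_comp _).trans (Category.comp_id _).symm) (Category.id_comp _)
          (Category.id_comp _).symm e
      exact (key d₀).trans ((congrArg (fun g => P.map g ≫ _) (hlink _)).trans (key d₁).symm)
  obtain ⟨β, hβ⟩ := hβ
  exact IsPiOneEquiv.of_transport f Φ α hα β hβ

end

end HDiagram.Hom

/-! ### Truncations of cubical spaces -/

namespace CubicalSpace

/-- A morphism to `X_{≤ 2}` that is a homeomorphism in dimensions `0` and `1` and hits all path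
components in dimension `2` induces an equivalence of fundamental groupoids from its source to the
realization of the whole cubical space. -/
theorem isPiOneEquiv_truncateMap_comp (X : CubicalSpace.{u}) {Z : CubicalSpaceLE.{u} 2}
    (ψ : HDiagram.Hom Z (X.truncate 2))
    {e₀ : Z.obj (CubeLE.mk 0 zero_le_two) ≃ₜ X.obj ⟨0⟩} (h₀ : ψ.IsHomeoAt _ e₀)
    {e₁ : Z.obj (CubeLE.mk 1 one_le_two) ≃ₜ X.obj ⟨1⟩} (h₁ : ψ.IsHomeoAt _ e₁)
    (h₂ : ∀ x : X.obj ⟨2⟩, ∃ s, Joined (ψ.appRestrict (CubeLE.mk 2 le_rfl) s) x) :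
    IsPiOneEquiv ((X.truncateMap 2).comp ψ.hocolimMap) := by
  refine HDiagram.Hom.isPiOneEquiv_hocolimRestrictMap h₀ h₁ CubeLE.d₀ CubeLE.d₁
    (fun h => one_ne_zero (congrArg Cube.dim h)) Cube.nonempty_vertex Cube.edgeConnected
    CubeLE.nonempty_vertex CubeLE.edgeConnected fun x =>
      HDiagram.EdgeData.HasCone.of_squares _ (fun y => ?_) x
  obtain ⟨s, ⟨p⟩⟩ := h₂ y
  exact HDiagram.EdgeData.HasCone.of_path _ p (HDiagram.Hom.edgeData_hasCone h₀ h₁ _ _ s)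

end CubicalSpace

theorem mainTheorem4 (X : CubicalSpace.{u}) (hX : ∀ n : ℕ, IsCGCWType (X.obj ⟨n⟩))
    {K : Type u} [TopologicalSpace K] [T2Space K] [Topology.CWComplex (Set.univ : Set K)]
    (e : ContinuousMap.HomotopyEquiv K (X.obj ⟨2⟩)) :
    IsPiOneEquiv (X.truncateMap 2) ∧
      IsPiOneEquiv (CubicalSpaceLE.replaceTwoMap (X.truncate 2) (zeroSkeletonMap e)) := by
  have h : IsPiOneEquiv (X.truncateMap 2) := by
    let ψ : HDiagram.Hom (X.truncate 2) (X.truncate 2) :=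
      ⟨fun A => ContinuousMap.id _, fun _ _ _ => rfl⟩
    have hψ : (X.truncateMap 2).comp ψ.hocolimMap = X.truncateMap 2 :=
      ContinuousMap.ext fun z => Quot.inductionOn z fun _ => rfl
    rw [← hψ]
    exact X.isPiOneEquiv_truncateMap_comp ψ (e₀ := Homeomorph.refl _) (fun _ => rfl)
      (e₁ := Homeomorph.refl _) (fun _ => rfl) fun x => ⟨x, Joined.refl x⟩
  refine ⟨h, IsPiOneEquiv.of_comp h ?_⟩
  exact X.isPiOneEquiv_truncateMap_comp
    (CubicalSpaceLE.replaceTwoHom (X.truncate 2) (zeroSkeletonMap e))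
    (e₀ := Homeomorph.refl (X.obj ⟨0⟩)) (fun _ => rfl) (e₁ := Homeomorph.refl (X.obj ⟨1⟩))
    (fun _ => rfl) (exists_joined_zeroSkeletonMap e)
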